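/- Proposition (Total energy growth rate for minimizers). A unit loop is a closed curve $\gamma\in H^2(\mathbb R/\mathbb Z,\mathbb R^3)$ with $|\gamma'|\equiv 1$ and $\gamma(0)=0$. For such a curve put $$E_{\mathrm{bend}}(\gamma)=\int_0^1|\gamma''|^2\,ds,\qquad \triangle[\gamma]=\inf_{u\ne v\ne w\ne u}R(\gamma(u),\gamma(v),\gamma(w)),\qquad \mathcal R(\gamma)=\frac{1}{\triangle[\gamma]},$$ where $R(x,y,z)\in[0,\infty]$ is the radius of the circle through $x,y,z$ ($R=\infty$ for distinct collinear points), and where $\mathcal R(\gamma)$, the ropelength (length divided by thickness), is $\infty$ if $\triangle[\gamma]=0$. For $\vartheta>0$ let $E_\vartheta=E_{\mathrm{bend}}+\vartheta\,\mathcal R$. Let $a,b\in\mathbb Z\setminus\{-1,0,1\}$ with $\gcd(|a|,|b|)=1$. Let $\mathcal T(a,b)$ be the $(a,b)$-torus knot class, i.e. the ambient isotopy class of the curves $$t\mapsto\big((1+\rho\cos bt)\cos at,\ (1+\rho\cos bt)\sin at,\ \rho\sin bt\big),\quad t\in\mathbb R/2\pi\mathbb Z,\quad \rho\in(0,1),$$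 and let $\mathscr C(\mathcal T(a,b))$ be the set of embedded unit loops of this knot type. Then there is a constant $C=C(a,b)>0$ such that for every $\vartheta\in(0,1]$ every minimizer $\gamma_\vartheta$ of $E_\vartheta$ in $\mathscr C(\mathcal T(a,b))$ satisfies $$E_\vartheta(\gamma_\vartheta)\le(2a\pi)^2+C\,\vartheta^{2/3},$$ and, if $a=2$, also $$\mathcal R(\gamma_\vartheta)\le C\,\vartheta^{-1/3}.$$ -/

import Mathlib

open MeasureTheory
open scoped ENNReal ContDiff

namespace ElasticKnot

/-- Euclidean three-space. -/
abbrev E3 : Type := EuclideanSpace ℝ (Fin 3)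

/-- `g` is the weak derivative of `f` on the circle `ℝ/ℤ`, both being square-integrable.
Test functions are the smooth functions `φ` on `ℝ/ℤ`, with derivative `φ'`. -/
structure IsL2WeakDeriv (f g : UnitAddCircle → E3) : Prop where
  memLp_left : MemLp f 2 volume
  memLp_right : MemLp g 2 volume
  integral_eq : ∀ φ φ' : UnitAddCircle → ℝ,
    ContDiff ℝ ∞ (fun t : ℝ => φ (t : UnitAddCircle)) →
    (∀ t : ℝ, HasDerivAt (fun s : ℝ => φ (s : UnitAddCircle)) (φ' (t : UnitAddCircle)) t) →
    ∫ x, φ' x • f x = -∫ x, φ x • g x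

/-- `γ` belongs to the Sobolev space `H²(ℝ/ℤ, ℝ³)`; elements of this space are identified with
their continuous representatives. -/
def MemH2 (γ : UnitAddCircle → E3) : Prop :=
  Continuous γ ∧ ∃ γ₁ γ₂ : UnitAddCircle → E3, IsL2WeakDeriv γ γ₁ ∧ IsL2WeakDeriv γ₁ γ₂

/-- The bending energy `∫ κ² ds = ∫ |γ''|² ds` of an arclength parametrized `H²` loop, where `γ''`
is the weak second derivative. As `γ''` is unique up to null sets, the infimum runs over equal
numbers only; it is `∞` if `γ` has no square-integrable second weak derivative. -/
noncomputable def bendingEnergy (γ : UnitAddCircle → E3) : ℝ≥0∞ :=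
  ⨅ (γ₁ : UnitAddCircle → E3) (γ₂ : UnitAddCircle → E3)
    (_ : IsL2WeakDeriv γ γ₁ ∧ IsL2WeakDeriv γ₁ γ₂), ∫⁻ x, ‖γ₂ x‖ₑ ^ 2

/-- The radius of the circle through `x`, `y`, `z`. Its centre `c` is the point of the affine hull
of `{x, y, z}` with the same distance to the three points; there is at most one such `c`, and there
is none, so that the radius is `∞`, exactly when the three points are distinct and collinear. -/
noncomputable def circleRadius (x y z : E3) : ℝ≥0∞ :=
  ⨅ (c : E3) (_ : c ∈ affineSpan ℝ {x, y, z} ∧ dist c x = dist c y ∧ dist c y = dist c z),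
    edist c x

/-- The thickness of a closed curve. -/
noncomputable def thickness (γ : UnitAddCircle → E3) : ℝ≥0∞ :=
  ⨅ (u : UnitAddCircle) (v : UnitAddCircle) (w : UnitAddCircle) (_ : u ≠ v ∧ v ≠ w ∧ w ≠ u),
    circleRadius (γ u) (γ v) (γ w)

/-- The length of a (continuously differentiable) closed curve. -/
noncomputable def arcLength (γ : UnitAddCircle → E3) : ℝ≥0∞ :=
  ∫⁻ t in Set.Ioc (0 : ℝ) 1, ‖deriv (fun s : ℝ => γ (s : UnitAddCircle)) t‖ₑ

/-- The ropelength, i.e. length over thickness; it is `∞` if the thickness of a unit loop is `0`. -/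
noncomputable def ropelength (γ : UnitAddCircle → E3) : ℝ≥0∞ :=
  arcLength γ / thickness γ

/-- The total energy `E_θ = E_bend + θ · ropelength`. -/
noncomputable def totalEnergy (θ : ℝ) (γ : UnitAddCircle → E3) : ℝ≥0∞ :=
  bendingEnergy γ + ENNReal.ofReal θ * ropelength γ

/-- The sets `K` and `L` are ambient isotopic in `ℝ³`. -/
def AmbientIsotopic (K L : Set E3) : Prop :=
  ∃ H : unitInterval → (E3 ≃ₜ E3),
    Continuous (fun p : unitInterval × E3 => H p.1 p.2) ∧
      (∀ x, H 0 x = x) ∧ H 1 '' K = L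

/-- The standard `(a, b)`-torus knot on the torus with radii `1` and `ρ`. -/
noncomputable def torusKnot (a b : ℤ) (ρ t : ℝ) : E3 :=
  !₂[(1 + ρ * Real.cos (b * t)) * Real.cos (a * t),
     (1 + ρ * Real.cos (b * t)) * Real.sin (a * t),
     ρ * Real.sin (b * t)]

/-- The `(a, b)`-torus knot class, as a set of subsets of `ℝ³`: the ambient isotopy class of the
standard torus knots, where `ρ ∈ (0, 1)` is arbitrary. -/
def torusKnotClass (a b : ℤ) : Set (Set E3) :=
  {L | ∃ ρ ∈ Set.Ioo (0 : ℝ) 1, AmbientIsotopic (Set.range (torusKnot a b ρ)) L}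

/-- The unit loops representing the knot class `𝒦`: embedded, arclength parametrized `H²` loops
of length one that start at the origin and whose image belongs to `𝒦`. -/
def unitLoops (𝒦 : Set (Set E3)) : Set (UnitAddCircle → E3) :=
  {γ | MemH2 γ ∧ γ 0 = 0 ∧ (∀ t : ℝ, ‖deriv (fun s : ℝ => γ (s : UnitAddCircle)) t‖ = 1) ∧
    Function.Injective γ ∧ Set.range γ ∈ 𝒦}

end ElasticKnot

namespace ElasticKnot
open Topology unitInterval

theorem _root_.IsCoveringMap.deck_commute_of_torus {E X : Type*} [TopologicalSpace E]
    [TopologicalSpace X] {p : E → X} (hp : IsCoveringMap p) (Φ : C(I × I, X)) (a b : C(I, E))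
    (hab : a 0 = b 0) (ha₀ : ∀ s, p (a s) = Φ (s, 0)) (ha₁ : ∀ s, p (a s) = Φ (s, 1))
    (hb₀ : ∀ t, p (b t) = Φ (0, t)) (hb₁ : ∀ t, p (b t) = Φ (1, t)) (g h : E → E)
    (hg : Continuous g) (hh : Continuous h) (hpg : ∀ e, p (g e) = p e) (hph : ∀ e, p (h e) = p e)
    (hga : a 1 = g (a 0)) (hhb : b 1 = h (b 0)) : g (h (a 0)) = h (g (a 0)) := by
  let Ψ : C(I × I, E) := hp.liftHomotopy Φ b (fun t => by rw [← hb₀ t])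
  have hΨ : ∀ x, p (Ψ x) = Φ x := fun x => congrFun (hp.liftHomotopy_lifts Φ b _) x
  have hΨb : ∀ t, Ψ (0, t) = b t := hp.liftHomotopy_zero Φ b _
  have key : ∀ f₁ f₂ : I → E, Continuous f₁ → Continuous f₂ → (∀ t, p (f₁ t) = p (f₂ t)) →
      f₁ 0 = f₂ 0 → f₁ 1 = f₂ 1 := fun f₁ f₂ h₁ h₂ he h0 =>
    congrFun (hp.eq_of_comp_eq h₁ h₂ (funext he) 0 h0) 1
  have e₁ : Ψ (1, 0) = a 1 := key (fun s => Ψ (s, 0)) a (by fun_prop) (by fun_prop)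
    (fun s => by rw [hΨ, ha₀]) (by simp [hΨb, hab])
  have e₂ : Ψ (1, 1) = h (a 1) := key (fun s => Ψ (s, 1)) (fun s => h (a s)) (by fun_prop)
    (by fun_prop) (fun s => by rw [hΨ, hph, ha₁]) (by simp [hΨb, hab, hhb])
  have e₃ : Ψ (1, 1) = g (b 1) := key (fun s => Ψ (1, s)) (fun s => g (b s)) (by fun_prop)
    (by fun_prop) (fun s => by rw [hΨ, hpg, hb₁]) (by simp [e₁, hga, hab])
  rw [hga] at e₂
  rw [hhb, ← hab] at e₃
  rw [← e₂, ← e₃]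

/-- The quotient map of `ℂ²` by the dihedral group of order `2n`. -/
def dihedralQuotient (n : ℕ) (w : ℂ × ℂ) : ℂ × ℂ := (w.1 * w.2, w.1 ^ n + w.2 ^ n)

/-- The complement of the branch locus of `dihedralQuotient n`. -/
def regularValues (n : ℕ) : Set (ℂ × ℂ) := {w | w.2 ^ 2 ≠ 4 * w.1 ^ n}

theorem continuous_dihedralQuotient (n : ℕ) : Continuous (dihedralQuotient n) := by
  unfold dihedralQuotient; fun_prop

theorem isProperMap_dihedralQuotient {n : ℕ} (hn : n ≠ 0) : IsProperMap (dihedralQuotient n) := by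
  rw [isProperMap_iff_tendsto_cocompact]
  refine ⟨continuous_dihedralQuotient n, ?_⟩
  rw [← Metric.cobounded_eq_cocompact,
    ← tendsto_norm_atTop_iff_cobounded, Filter.tendsto_atTop]
  intro R
  filter_upwards [tendsto_norm_cobounded_atTop.eventually_gt_atTop
    (1 + |R| + |R| ^ n)] with w hw
  by_contra! hR
  have aux : ∀ u v : ℂ, ‖v‖ ≤ ‖u‖ → ‖u * v‖ ≤ |R| → ‖u ^ n + v ^ n‖ ≤ |R| →
      ‖u‖ ≤ 1 + |R| + |R| ^ n := by
    intro u v huv h₁ h₂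
    rcases le_or_gt ‖u‖ 1 with hu | hu
    · linarith [abs_nonneg R, pow_nonneg (abs_nonneg R) n]
    have hv : ‖v‖ ≤ |R| := by
      rw [norm_mul] at h₁
      nlinarith [norm_nonneg v]
    have h₃ : ‖u‖ ^ n ≤ |R| + ‖v‖ ^ n := by
      rw [← norm_pow, ← norm_pow]
      calc ‖u ^ n‖ = ‖(u ^ n + v ^ n) - v ^ n‖ := by ring_nf
        _ ≤ _ := (norm_sub_le _ _).trans (by linarith)
    have h₄ : ‖u‖ ≤ ‖u‖ ^ n := le_self_pow₀ hu.le hn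
    have h₅ : ‖v‖ ^ n ≤ |R| ^ n := pow_le_pow_left₀ (norm_nonneg v) hv n
    linarith
  have hR' := (hR.trans_le (le_abs_self R)).le
  have h₁ : ‖w.1 * w.2‖ ≤ |R| := (norm_fst_le (dihedralQuotient n w)).trans hR'
  have h₂ : ‖w.1 ^ n + w.2 ^ n‖ ≤ |R| := (norm_snd_le (dihedralQuotient n w)).trans hR'
  refine hw.not_ge ?_
  rw [Prod.norm_def]
  rcases le_total ‖w.2‖ ‖w.1‖ with h | h
  · rw [max_eq_left h]; exact aux _ _ h h₁ h₂
  · rw [max_eq_right h]; exact aux _ _ h (by rwa [mul_comm]) (by rwa [add_comm])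

theorem mem_preimage_regularValues {n : ℕ} {w : ℂ × ℂ} :
    dihedralQuotient n w ∈ regularValues n ↔ w.1 ^ n ≠ w.2 ^ n := by
  have : (w.1 ^ n + w.2 ^ n) ^ 2 - 4 * (w.1 * w.2) ^ n = (w.1 ^ n - w.2 ^ n) ^ 2 := by
    rw [mul_pow]; ring
  simp only [regularValues, dihedralQuotient, Set.mem_ofPred_eq]
  rw [← sub_ne_zero, this, pow_ne_zero_iff two_ne_zero, sub_ne_zero]

theorem isLocalHomeomorphOn_dihedralQuotient {n : ℕ} (hn : n ≠ 0) :
    IsLocalHomeomorphOn (dihedralQuotient n) (dihedralQuotient n ⁻¹' regularValues n) := by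
  refine IsLocalHomeomorphOn.mk _ _ fun w hw => ?_
  have hw' : w.1 ^ n ≠ w.2 ^ n := mem_preimage_regularValues.1 hw
  obtain ⟨m, rfl⟩ := Nat.exists_eq_succ_of_ne_zero hn
  let f' : ℂ × ℂ →L[ℂ] ℂ × ℂ :=
    (w.1 • ContinuousLinearMap.snd ℂ ℂ ℂ + w.2 • ContinuousLinearMap.fst ℂ ℂ ℂ).prod
      (((m + 1 : ℕ) * w.1 ^ m) • ContinuousLinearMap.fst ℂ ℂ ℂ +
        ((m + 1 : ℕ) * w.2 ^ m) • ContinuousLinearMap.snd ℂ ℂ ℂ)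
  have hf : HasStrictFDerivAt (dihedralQuotient (m + 1)) f' w := by
    have h₁ : HasStrictFDerivAt (Prod.fst : ℂ × ℂ → ℂ) (.fst ℂ ℂ ℂ) w := hasStrictFDerivAt_fst
    have h₂ : HasStrictFDerivAt (Prod.snd : ℂ × ℂ → ℂ) (.snd ℂ ℂ ℂ) w := hasStrictFDerivAt_snd
    refine ((h₁.mul h₂).prodMk ((h₁.pow (m + 1)).add (h₂.pow (m + 1)))).congr_fderiv ?_
    ext <;> simp [f']
  have hinj : Function.Injective f' := by
    rw [injective_iff_map_eq_zero]
    rintro ⟨x, y⟩ hxy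
    simp only [f', ContinuousLinearMap.prod_apply, Prod.mk_eq_zero, add_apply,
      smul_apply, ContinuousLinearMap.coe_fst', ContinuousLinearMap.coe_snd',
      smul_eq_mul] at hxy
    obtain ⟨h₁, h₂⟩ := hxy
    have hm : ((m + 1 : ℕ) : ℂ) ≠ 0 := Nat.cast_ne_zero.2 (Nat.succ_ne_zero m)
    have h₃ : w.1 ^ m * x + w.2 ^ m * y = 0 := by
      apply mul_left_cancel₀ hm
      linear_combination h₂
    have hne : w.1 ^ (m + 1) - w.2 ^ (m + 1) ≠ 0 := sub_ne_zero.2 hw'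
    have hx : x = 0 := by
      apply mul_left_cancel₀ hne
      linear_combination w.1 * h₃ - w.2 ^ m * h₁
    have hy : y = 0 := by
      apply mul_left_cancel₀ hne
      linear_combination w.1 ^ m * h₁ - w.2 * h₃
    simp [hx, hy]
  let e : (ℂ × ℂ) ≃L[ℂ] ℂ × ℂ :=
    (LinearEquiv.ofInjectiveEndo (f' : ℂ × ℂ →ₗ[ℂ] ℂ × ℂ) hinj).toContinuousLinearEquiv
  have he : (e : ℂ × ℂ →L[ℂ] ℂ × ℂ) = f' := by ext <;> rfl
  rw [← he] at hf
  exact ⟨hf.toOpenPartialHomeomorph _, hf.mem_toOpenPartialHomeomorph_source,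
    fun x _ => rfl⟩

theorem isCoveringMapOn_dihedralQuotient {n : ℕ} (hn : n ≠ 0) :
    IsCoveringMapOn (dihedralQuotient n) (regularValues n) := by
  refine (isProperMap_dihedralQuotient hn).isClosedMap.isCoveringMapOn_of_isLocalHomeomorphOn
    (fun w hw => ?_) (isLocalHomeomorphOn_dihedralQuotient hn)
  refine ((isProperMap_dihedralQuotient hn).isCompact_preimage isCompact_singleton).finite ?_
  refine .of_openPartialHomeomorph (dihedralQuotient n) subset_rfl fun x hx => ?_
  obtain ⟨φ, hφ, h⟩ := isLocalHomeomorphOn_dihedralQuotient hn x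
    (by rw [Set.mem_preimage, Set.mem_singleton_iff] at hx; rwa [Set.mem_preimage, hx])
  exact ⟨φ, hφ, h.symm⟩

end ElasticKnot

namespace ElasticKnot
open Topology unitInterval

theorem _root_.IsCoveringMapOn.deck_commute_of_torus {E X : Type*} [TopologicalSpace E]
    [TopologicalSpace X] {p : E → X} {S : Set X} (hp : IsCoveringMapOn p S) (Φ : C(I × I, X))
    (hΦ : ∀ x, Φ x ∈ S) (a b : C(I, E))
    (hab : a 0 = b 0) (ha₀ : ∀ s, p (a s) = Φ (s, 0)) (ha₁ : ∀ s, p (a s) = Φ (s, 1))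
    (hb₀ : ∀ t, p (b t) = Φ (0, t)) (hb₁ : ∀ t, p (b t) = Φ (1, t)) (g h : E → E)
    (hg : Continuous g) (hh : Continuous h) (hpg : ∀ e, p (g e) = p e) (hph : ∀ e, p (h e) = p e)
    (hga : a 1 = g (a 0)) (hhb : b 1 = h (b 0)) : g (h (a 0)) = h (g (a 0)) := by
  have hmap : ∀ f : E → E, (∀ e, p (f e) = p e) → ∀ e ∈ p ⁻¹' S, f e ∈ p ⁻¹' S := by
    intro f hf e he
    rw [Set.mem_preimage, hf]; exact he
  have hma : ∀ s, a s ∈ p ⁻¹' S := fun s => by rw [Set.mem_preimage, ha₀]; exact hΦ _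
  have hmb : ∀ s, b s ∈ p ⁻¹' S := fun s => by rw [Set.mem_preimage, hb₀]; exact hΦ _
  have := hp.isCoveringMap_restrictPreimage.deck_commute_of_torus
    ⟨fun x => (⟨Φ x, hΦ x⟩ : S), by fun_prop⟩
    ⟨fun s => (⟨a s, hma s⟩ : p ⁻¹' S), by fun_prop⟩ ⟨fun s => (⟨b s, hmb s⟩ : p ⁻¹' S), by fun_prop⟩
    (Subtype.ext hab) (fun s => Subtype.ext (ha₀ s)) (fun s => Subtype.ext (ha₁ s))
    (fun s => Subtype.ext (hb₀ s)) (fun s => Subtype.ext (hb₁ s))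
    (fun e => ⟨g e, hmap g hpg e e.2⟩) (fun e => ⟨h e, hmap h hph e e.2⟩)
    (by fun_prop) (by fun_prop) (fun e => Subtype.ext (hpg e)) (fun e => Subtype.ext (hph e))
    (Subtype.ext hga) (Subtype.ext hhb)
  exact congrArg Subtype.val this

/-- The unit circle in the plane spanned by the first and the last coordinate axis. -/
def verticalCircle : Set (ℂ × ℝ) := {x | x.1.im = 0 ∧ x.1.re ^ 2 + x.2 ^ 2 = 1}

/-- The homogeneous coordinates of the complement of `verticalCircle` in `S³ ⊆ ℂ²`. -/
noncomputable def sphereCoord (x : ℂ × ℝ) : ℂ × ℂ :=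
  (⟨x.1.re ^ 2 + x.1.im ^ 2 + x.2 ^ 2 - 1, 2 * x.1.im⟩, ⟨2 * x.1.re, 2 * x.2⟩)

/-- The denominator of the stereographic projection. -/
noncomputable def stereoDenom (y : ℂ × ℂ) : ℝ := √(‖y.1‖ ^ 2 + ‖y.2‖ ^ 2) - y.1.re

/-- Stereographic projection in homogeneous coordinates. -/
noncomputable def stereo (y : ℂ × ℂ) : ℂ × ℝ :=
  (⟨y.2.re / stereoDenom y, y.1.im / stereoDenom y⟩, y.2.im / stereoDenom y)

theorem continuous_complex_mk {X : Type*} [TopologicalSpace X] {f g : X → ℝ} (hf : Continuous f)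
    (hg : Continuous g) : Continuous fun x => (⟨f x, g x⟩ : ℂ) :=
  Complex.equivRealProdCLM.symm.continuous.comp (hf.prodMk hg)

theorem continuousAt_complex_mk {X : Type*} [TopologicalSpace X] {f g : X → ℝ} {x : X}
    (hf : ContinuousAt f x) (hg : ContinuousAt g x) :
    ContinuousAt (fun x => (⟨f x, g x⟩ : ℂ)) x :=
  Complex.equivRealProdCLM.symm.continuous.continuousAt.comp (hf.prodMk hg)

theorem continuous_sphereCoord : Continuous sphereCoord :=
  (continuous_complex_mk (by fun_prop) (by fun_prop)).prodMk
    (continuous_complex_mk (by fun_prop) (by fun_prop))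

theorem continuous_stereoDenom : Continuous stereoDenom := by
  unfold stereoDenom; fun_prop

theorem stereoDenom_nonneg (y : ℂ × ℂ) : 0 ≤ stereoDenom y := by
  refine sub_nonneg.2 (Real.le_sqrt_of_sq_le ?_)
  rw [Complex.sq_norm, Complex.normSq_apply]
  nlinarith [sq_nonneg ‖y.2‖, sq_nonneg y.1.im]

theorem continuousAt_stereo {y : ℂ × ℂ} (hy : stereoDenom y ≠ 0) : ContinuousAt stereo y := by
  have h := continuous_stereoDenom.continuousAt (x := y)
  refine ContinuousAt.prodMk (continuousAt_complex_mk ?_ ?_) ?_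
  all_goals exact ContinuousAt.div (by fun_prop) h hy

theorem sphereCoord_fst_ne_zero {x : ℂ × ℝ} (hx : x ∉ verticalCircle) :
    (sphereCoord x).1 ≠ 0 := by
  contrapose! hx
  have h1 := congrArg Complex.re hx
  have h2 := congrArg Complex.im hx
  simp only [sphereCoord, Complex.zero_re, Complex.zero_im] at h1 h2
  have h3 : x.1.im = 0 := by linarith
  rw [h3] at h1
  exact ⟨h3, by linarith⟩

theorem stereoDenom_sphereCoord (x : ℂ × ℝ) : stereoDenom (sphereCoord x) = 2 := by
  have : ‖(sphereCoord x).1‖ ^ 2 + ‖(sphereCoord x).2‖ ^ 2 =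
      (x.1.re ^ 2 + x.1.im ^ 2 + x.2 ^ 2 + 1) ^ 2 := by
    rw [Complex.sq_norm, Complex.normSq_apply, Complex.sq_norm, Complex.normSq_apply]
    simp only [sphereCoord]; ring
  rw [stereoDenom, this, Real.sqrt_sq (by positivity)]
  simp only [sphereCoord]; ring

theorem stereo_sphereCoord (x : ℂ × ℝ) : stereo (sphereCoord x) = x := by
  rw [stereo, stereoDenom_sphereCoord]
  simp [sphereCoord]

theorem stereoDenom_mul_add (y : ℂ × ℂ) :
    stereoDenom y * (stereoDenom y + 2 * y.1.re) = y.1.im ^ 2 + y.2.re ^ 2 + y.2.im ^ 2 := by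
  have h := Real.sq_sqrt (show 0 ≤ ‖y.1‖ ^ 2 + ‖y.2‖ ^ 2 by positivity)
  have h1 := Complex.sq_norm y.1
  have h2 := Complex.sq_norm y.2
  rw [Complex.normSq_apply] at h1 h2
  unfold stereoDenom
  linear_combination h + h1 + h2

theorem stereo_notMem {y : ℂ × ℂ} (hy : y.1 ≠ 0) (hd : stereoDenom y ≠ 0) :
    stereo y ∉ verticalCircle := by
  rintro ⟨h1, h2⟩
  simp only [stereo] at h1 h2
  have h3 : y.1.im = 0 := by simpa [hd] using h1
  have h4 := stereoDenom_mul_add y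
  field_simp at h2
  have h5 : y.1.re = 0 := by
    rw [h3] at h4
    have : stereoDenom y * (2 * y.1.re) = 0 := by linarith
    simpa [hd] using this
  exact hy (Complex.ext h5 h3)

theorem tendsto_stereo_cocompact {y : ℂ × ℂ} (hy : y.1 ≠ 0) (hd : stereoDenom y = 0) :
    Filter.Tendsto stereo (𝓝[{y | stereoDenom y ≠ 0}] y) (Filter.cocompact (ℂ × ℝ)) := by
  have h4 := stereoDenom_mul_add y
  rw [hd, zero_mul] at h4
  have h5 : y.1.im = 0 := by nlinarith [sq_nonneg y.1.im, sq_nonneg y.2.re, sq_nonneg y.2.im]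
  have h6 : 0 < y.1.re := by
    have h7 : y.1.re = √(‖y.1‖ ^ 2 + ‖y.2‖ ^ 2) := by unfold stereoDenom at hd; linarith
    rw [h7]
    have := norm_pos_iff.2 hy
    positivity
  rw [← Metric.cobounded_eq_cocompact, ← tendsto_norm_atTop_iff_cobounded]
  have h8 : Filter.Tendsto (fun x : ℂ × ℂ => (stereoDenom x + 2 * x.1.re) / stereoDenom x)
      (𝓝[{y | stereoDenom y ≠ 0}] y) Filter.atTop := by
    simp_rw [div_eq_mul_inv]
    refine Filter.Tendsto.pos_mul_atTop (C := 2 * y.1.re) (by positivity) ?_ ?_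
    · have : ContinuousAt (fun x : ℂ × ℂ => stereoDenom x + 2 * x.1.re) y :=
        (continuous_stereoDenom.add (by fun_prop)).continuousAt
      have h9 := this.tendsto
      simp only [hd, zero_add] at h9
      exact h9.mono_left nhdsWithin_le_nhds
    · refine Filter.Tendsto.inv_tendsto_nhdsGT_zero ?_
      refine tendsto_nhdsWithin_iff.2 ⟨?_, ?_⟩
      · have h9 := (continuous_stereoDenom.continuousAt (x := y)).tendsto
        rw [hd] at h9
        exact h9.mono_left nhdsWithin_le_nhds
      · filter_upwards [self_mem_nhdsWithin] with x hx
        exact lt_of_le_of_ne (stereoDenom_nonneg x) (Ne.symm hx)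
  have h10 : Filter.Tendsto (fun x : ℂ × ℂ => 2 * ‖stereo x‖ ^ 2)
      (𝓝[{y | stereoDenom y ≠ 0}] y) Filter.atTop := by
    refine Filter.tendsto_atTop_mono' _ ?_ h8
    filter_upwards [self_mem_nhdsWithin] with x hx
    have hx' : stereoDenom x ≠ 0 := hx
    have e1 : (stereoDenom x + 2 * x.1.re) / stereoDenom x =
        ‖(stereo x).1‖ ^ 2 + ‖(stereo x).2‖ ^ 2 := by
      rw [Complex.sq_norm, Complex.normSq_apply, Real.norm_eq_abs, sq_abs]
      simp only [stereo]
      field_simp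
      linear_combination stereoDenom_mul_add x
    rw [e1]
    have e2 := pow_le_pow_left₀ (norm_nonneg _) (norm_fst_le (stereo x)) 2
    have e3 := pow_le_pow_left₀ (norm_nonneg _) (norm_snd_le (stereo x)) 2
    linarith
  rw [Filter.tendsto_atTop] at h10 ⊢
  intro R
  filter_upwards [h10 (2 * R ^ 2)] with x hx
  exact (le_abs_self R).trans (abs_le_of_sq_le_sq (by linarith) (norm_nonneg _))

end ElasticKnot

namespace ElasticKnot
open Topology unitInterval

/-- A function of the distance `r` from the axis and of the height `z`, that equals `r - 1`
near the torus. -/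
noncomputable def radialPart (ρ : ℝ) (x : ℂ × ℝ) : ℝ := ‖x.1‖ - 1 + max 0 (|x.2| - ρ)

/-- A map from `ℝ³` to the base of `dihedralQuotient n`; the torus knot of type `(2, n)` is the
preimage of the branch locus if `ν ^ n = ρ / 2`. -/
noncomputable def knotMap (ρ ν : ℝ) (x : ℂ × ℝ) : ℂ × ℂ :=
  (((ν ^ 2 / max ‖x.1‖ (1 - ρ) * (3 / max 3 (‖x.1‖ + |x.2|)) : ℝ) : ℂ) * x.1,
    ⟨radialPart ρ x / max 1 (|radialPart ρ x| / 2),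
      x.2 / max 1 |x.2| / max 1 (|radialPart ρ x| / 2)⟩)

/-- The standard torus knot of type `(2, n)` in `ℂ × ℝ`. -/
noncomputable def torusKnotTwo (n : ℕ) (ρ t : ℝ) : ℂ × ℝ :=
  (((1 + ρ * Real.cos (n * t) : ℝ) : ℂ) * Complex.exp (2 * t * Complex.I), ρ * Real.sin (n * t))

theorem continuous_knotMap {ρ : ℝ} (ν : ℝ) (hρ : ρ < 1) : Continuous (knotMap ρ ν) := by
  have h0 : Continuous (radialPart ρ) := by unfold radialPart; fun_prop
  have h1 : ∀ x : ℂ × ℝ, max ‖x.1‖ (1 - ρ) ≠ 0 := fun x =>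
    (lt_max_of_lt_right (by linarith)).ne'
  have h2 : ∀ x : ℂ × ℝ, max 3 (‖x.1‖ + |x.2|) ≠ 0 := fun x =>
    (lt_max_of_lt_left (by norm_num)).ne'
  have h3 : ∀ x : ℂ × ℝ, max 1 (|radialPart ρ x| / 2) ≠ 0 := fun x =>
    (lt_max_of_lt_left (by norm_num)).ne'
  have h4 : ∀ x : ℂ × ℝ, max 1 |x.2| ≠ 0 := fun x =>
    (lt_max_of_lt_left (by norm_num)).ne'
  refine Continuous.prodMk ?_ (continuous_complex_mk ?_ ?_)
  · refine Continuous.mul (Complex.continuous_ofReal.comp ?_) continuous_fst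
    exact (continuous_const.div (by fun_prop) h1).mul (continuous_const.div (by fun_prop) h2)
  · exact h0.div (by fun_prop) h3
  · exact (continuous_snd.div (by fun_prop) h4).div (by fun_prop) h3

theorem knotMap_of_near {ρ ν : ℝ} {x : ℂ × ℝ} (hρ : ρ < 1) (h1 : |x.2| ≤ ρ)
    (h2 : 1 - ρ ≤ ‖x.1‖) (h3 : ‖x.1‖ + |x.2| ≤ 3) :
    knotMap ρ ν x = (((ν ^ 2 / ‖x.1‖ : ℝ) : ℂ) * x.1, ⟨‖x.1‖ - 1, x.2⟩) := by
  have hr : radialPart ρ x = ‖x.1‖ - 1 := by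
    rw [radialPart, max_eq_left (by linarith), add_zero]
  have h4 : max 1 (|‖x.1‖ - 1| / 2) = 1 := by
    refine max_eq_left ?_
    have : |‖x.1‖ - 1| ≤ 2 := abs_le.2 ⟨by linarith, by linarith [abs_nonneg x.2]⟩
    linarith
  simp only [knotMap]
  rw [hr, h4, max_eq_left h2, max_eq_left h3, max_eq_left (h1.trans hρ.le)]
  simp

theorem tendsto_knotMap {ρ : ℝ} (ν : ℝ) (hρ : ρ < 1) (hρ0 : 0 < ρ) :
    Filter.Tendsto (knotMap ρ ν) (Filter.cocompact (ℂ × ℝ)) (𝓝 (0, 2)) := by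
  have hN : Filter.Tendsto (fun x : ℂ × ℝ => ‖x.1‖ + |x.2|) (Filter.cocompact (ℂ × ℝ))
      Filter.atTop := by
    refine Filter.tendsto_atTop_mono (fun x => ?_) (tendsto_norm_cocompact_atTop (E := ℂ × ℝ))
    rw [Prod.norm_def, Real.norm_eq_abs]
    exact max_le (by linarith [abs_nonneg x.2]) (by linarith [norm_nonneg x.1])
  have hA : Filter.Tendsto (radialPart ρ) (Filter.cocompact (ℂ × ℝ)) Filter.atTop := by
    refine Filter.tendsto_atTop_mono (fun x => ?_) (Filter.tendsto_atTop_add_const_right _ (-2) hN)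
    have := le_max_right 0 (|x.2| - ρ)
    unfold radialPart
    linarith
  refine Filter.Tendsto.prodMk_nhds ?_ ?_
  · rw [tendsto_zero_iff_norm_tendsto_zero]
    have h := (tendsto_inv_atTop_zero.comp hN).const_mul (3 * ν ^ 2)
    rw [mul_zero] at h
    refine squeeze_zero' (Filter.Eventually.of_forall fun _ => norm_nonneg _) ?_ h
    filter_upwards [hN.eventually_ge_atTop 3] with x hx
    have h1 : 0 < max ‖x.1‖ (1 - ρ) := lt_max_of_lt_right (by linarith)
    have h2 : ‖x.1‖ / max ‖x.1‖ (1 - ρ) ≤ 1 := (div_le_one h1).2 (le_max_left _ _)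
    rw [max_eq_right hx, norm_mul, Complex.norm_real, Real.norm_eq_abs, abs_of_nonneg (by positivity)]
    calc ν ^ 2 / max ‖x.1‖ (1 - ρ) * (3 / (‖x.1‖ + |x.2|)) * ‖x.1‖
        = (‖x.1‖ / max ‖x.1‖ (1 - ρ)) * (3 * ν ^ 2 * (‖x.1‖ + |x.2|)⁻¹) := by ring
      _ ≤ 1 * (3 * ν ^ 2 * (‖x.1‖ + |x.2|)⁻¹) := by gcongr
      _ = _ := one_mul _
  · have h1 : Filter.Tendsto (fun x => radialPart ρ x / max 1 (|radialPart ρ x| / 2))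
        (Filter.cocompact (ℂ × ℝ)) (𝓝 2) := by
      refine tendsto_const_nhds.congr' ?_
      filter_upwards [hA.eventually_ge_atTop 2] with x hx
      rw [abs_of_nonneg (by linarith), max_eq_right (by linarith)]
      field_simp
    have h2 : Filter.Tendsto (fun x : ℂ × ℝ => x.2 / max 1 |x.2| / max 1 (|radialPart ρ x| / 2))
        (Filter.cocompact (ℂ × ℝ)) (𝓝 0) := by
      rw [tendsto_zero_iff_norm_tendsto_zero]
      have h := (tendsto_inv_atTop_zero.comp hA).const_mul 2
      rw [mul_zero] at h
      refine squeeze_zero' (Filter.Eventually.of_forall fun _ => norm_nonneg _) ?_ h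
      filter_upwards [hA.eventually_ge_atTop 2] with x hx
      have h4 : 0 < max 1 |x.2| := lt_max_of_lt_left one_pos
      rw [abs_of_nonneg (by linarith : 0 ≤ radialPart ρ x),
        max_eq_right (by linarith : 1 ≤ radialPart ρ x / 2),
        norm_div, norm_div, Real.norm_eq_abs, Real.norm_eq_abs, Real.norm_eq_abs, abs_of_pos h4,
        abs_of_nonneg (by linarith : 0 ≤ radialPart ρ x / 2)]
      have h5 : |x.2| / max 1 |x.2| ≤ 1 := (div_le_one h4).2 (le_max_right _ _)
      calc |x.2| / max 1 |x.2| / (radialPart ρ x / 2) ≤ 1 / (radialPart ρ x / 2) := by gcongr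
        _ = 2 * (radialPart ρ x)⁻¹ := by field_simp
    have := (Complex.equivRealProdCLM.symm.continuous.tendsto ((2 : ℝ), (0 : ℝ))).comp
      (h1.prodMk_nhds h2)
    convert this using 2
    · rfl
    · apply Complex.ext <;> rfl

theorem norm_exp_mul_I' (s : ℝ) : ‖Complex.exp (2 * s * Complex.I)‖ = 1 := by
  have := Complex.norm_exp_ofReal_mul_I (2 * s)
  push_cast at this
  exact this

theorem norm_torusKnotTwo_fst {n : ℕ} {ρ t : ℝ} (hρ0 : 0 < ρ) (hρ : ρ < 1) :
    ‖(torusKnotTwo n ρ t).1‖ = 1 + ρ * Real.cos (n * t) := by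
  rw [torusKnotTwo, norm_mul, norm_exp_mul_I', mul_one, Complex.norm_real, Real.norm_eq_abs,
    abs_of_nonneg]
  nlinarith [Real.neg_one_le_cos (n * t)]

theorem knotMap_torusKnotTwo_notMem {n : ℕ} {ρ ν : ℝ} (hρ0 : 0 < ρ) (hρ : ρ < 1)
    (hν : ν ^ n = ρ / 2) (t : ℝ) : knotMap ρ ν (torusKnotTwo n ρ t) ∉ regularValues n := by
  have hr := norm_torusKnotTwo_fst (n := n) (t := t) hρ0 hρ
  have hz : |(torusKnotTwo n ρ t).2| ≤ ρ := by
    simp only [torusKnotTwo]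
    rw [abs_mul, abs_of_pos hρ0]
    exact mul_le_of_le_one_right hρ0.le (Real.abs_sin_le_one _)
  have hc := Real.neg_one_le_cos (n * t)
  have hc' := Real.cos_le_one (n * t)
  rw [knotMap_of_near hρ hz (by rw [hr]; nlinarith) (by rw [hr]; nlinarith), hr]
  have h1 : (0 : ℝ) < 1 + ρ * Real.cos (n * t) := by nlinarith
  have h2 : ((1 + ρ * Real.cos (n * t) : ℝ) : ℂ) ≠ 0 := Complex.ofReal_ne_zero.2 h1.ne'
  have h3 : ((ν ^ 2 / (1 + ρ * Real.cos (n * t)) : ℝ) : ℂ) * (torusKnotTwo n ρ t).1 =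
      (ν : ℂ) ^ 2 * Complex.exp (2 * t * Complex.I) := by
    simp only [torusKnotTwo]
    rw [Complex.ofReal_div]
    field_simp
    push_cast; rfl
  have h4 : (⟨1 + ρ * Real.cos (n * t) - 1, (torusKnotTwo n ρ t).2⟩ : ℂ) =
      ρ * Complex.exp (n * t * Complex.I) := by
    have := Complex.exp_ofReal_mul_I_re (n * t)
    have := Complex.exp_ofReal_mul_I_im (n * t)
    push_cast at *
    apply Complex.ext <;> simp [torusKnotTwo, *]
  simp only [regularValues, Set.mem_ofPred_eq, not_not]
  rw [h3, h4, mul_pow, mul_pow, ← pow_mul, mul_comm 2 n, pow_mul]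
  have h5 : (ν : ℂ) ^ n = ρ / 2 := by exact_mod_cast congrArg ((↑) : ℝ → ℂ) hν
  rw [h5, ← Complex.exp_nat_mul, ← Complex.exp_nat_mul]
  rw [show ((2 : ℕ) : ℂ) * (n * t * Complex.I) = n * (2 * t * Complex.I) by push_cast; ring]
  ring

theorem mem_range_torusKnotTwo {n : ℕ} (hn : Odd n) {ρ ν : ℝ} (hρ0 : 0 < ρ) (hρ : ρ < 1)
    (hν0 : 0 < ν) (hν : ν ^ n = ρ / 2) {x : ℂ × ℝ} (hx : knotMap ρ ν x ∉ regularValues n) :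
    x ∈ Set.range (torusKnotTwo n ρ) := by
  simp only [regularValues, Set.mem_ofPred_eq, not_not] at hx
  have hν' : 4 * (ν ^ 2) ^ n = ρ ^ 2 := by
    rw [← pow_mul, mul_comm 2 n, pow_mul, hν]; ring
  set p := (knotMap ρ ν x).1 with hp
  set q := (knotMap ρ ν x).2 with hq
  have hp1 : ‖p‖ ≤ ν ^ 2 := by
    have h1 : 0 < max ‖x.1‖ (1 - ρ) := lt_max_of_lt_right (by linarith)
    have h2 : ‖x.1‖ / max ‖x.1‖ (1 - ρ) ≤ 1 := (div_le_one h1).2 (le_max_left _ _)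
    have h3 : (0:ℝ) < max 3 (‖x.1‖ + |x.2|) := lt_max_of_lt_left (by norm_num)
    have h4 : 3 / max 3 (‖x.1‖ + |x.2|) ≤ 1 := (div_le_one h3).2 (le_max_left _ _)
    rw [hp]
    simp only [knotMap]
    rw [norm_mul, Complex.norm_real, Real.norm_eq_abs, abs_of_nonneg (by positivity)]
    calc ν ^ 2 / max ‖x.1‖ (1 - ρ) * (3 / max 3 (‖x.1‖ + |x.2|)) * ‖x.1‖
        = ν ^ 2 * (‖x.1‖ / max ‖x.1‖ (1 - ρ)) * (3 / max 3 (‖x.1‖ + |x.2|)) := by ring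
      _ ≤ ν ^ 2 * 1 * 1 := by gcongr
      _ = _ := by ring
  have hnorm : ‖q‖ ^ 2 = 4 * ‖p‖ ^ n := by
    rw [← norm_pow, hx]; simp
  have hq1 : ‖q‖ ≤ ρ := by
    refine (abs_le_of_sq_le_sq' ?_ hρ0.le).2
    rw [hnorm, ← hν']
    gcongr
  have hre : |q.re| ≤ ρ := (Complex.abs_re_le_norm q).trans hq1
  have him : |q.im| ≤ ρ := (Complex.abs_im_le_norm q).trans hq1
  have hA : max 1 (|radialPart ρ x| / 2) = 1 := by
    refine max_eq_left ?_
    by_contra! hlt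
    have : |q.re| = 2 := by
      rw [hq]; simp only [knotMap]
      rw [max_eq_right hlt.le, abs_div, abs_of_pos (by linarith : 0 < |radialPart ρ x| / 2)]
      have : |radialPart ρ x| ≠ 0 := by linarith
      field_simp
    linarith
  have hqre : q.re = radialPart ρ x := by
    rw [hq]; simp only [knotMap]; rw [hA, div_one]
  have hqim : q.im = x.2 / max 1 |x.2| := by
    rw [hq]; simp only [knotMap]; rw [hA, div_one]
  have hz1 : |x.2| < 1 := by
    by_contra! hle
    rw [hqim, max_eq_right hle, abs_div, abs_abs, div_self (by linarith)] at him
    linarith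
  have hz : |x.2| ≤ ρ := by
    rwa [hqim, max_eq_left hz1.le, div_one] at him
  have hr : |‖x.1‖ - 1| ≤ ρ := by
    rwa [hqre, radialPart, max_eq_left (by linarith), add_zero] at hre
  obtain ⟨hr1, hr2⟩ := abs_le.1 hr
  have hval := knotMap_of_near (ν := ν) hρ hz (by linarith) (by linarith)
  have hr0 : 0 < ‖x.1‖ := by linarith
  have hpv : p = ((ν ^ 2 / ‖x.1‖ : ℝ) : ℂ) * x.1 := by rw [hp, hval]
  have hqv : q = ⟨‖x.1‖ - 1, x.2⟩ := by rw [hq, hval]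
  have hpn : ‖p‖ = ν ^ 2 := by
    rw [hpv, norm_mul, Complex.norm_real, Real.norm_eq_abs, abs_of_nonneg (by positivity)]
    field_simp
  have hqn : ‖q‖ = ρ := by
    have : ‖q‖ ^ 2 = ρ ^ 2 := by rw [hnorm, hpn, hν']
    exact (pow_left_inj₀ (norm_nonneg _) hρ0.le two_ne_zero).1 this
  obtain ⟨k, rfl⟩ := hn
  have hρc : (ρ : ℂ) ≠ 0 := Complex.ofReal_ne_zero.2 hρ0.ne'
  have hνc : (ν : ℂ) ≠ 0 := Complex.ofReal_ne_zero.2 hν0.ne'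
  have hrc : (‖x.1‖ : ℂ) ≠ 0 := Complex.ofReal_ne_zero.2 hr0.ne'
  set e : ℂ := x.1 / ‖x.1‖ with he
  set f : ℂ := q / ρ with hf
  have hen : ‖e‖ = 1 := by
    rw [he, norm_div, Complex.norm_real, norm_norm, div_self hr0.ne']
  have hfn : ‖f‖ = 1 := by
    rw [hf, norm_div, hqn, Complex.norm_real, Real.norm_eq_abs, abs_of_pos hρ0, div_self hρ0.ne']
  have he0 : e ≠ 0 := norm_ne_zero_iff.1 (by rw [hen]; norm_num)
  have hpe : p = (ν : ℂ) ^ 2 * e := by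
    rw [hpv, he]; push_cast; field_simp
  have hqf : q = ρ * f := by rw [hf]; field_simp
  have hef : f ^ 2 = e ^ (2 * k + 1) := by
    have h5 : 4 * ((ν : ℂ) ^ 2) ^ (2 * k + 1) = (ρ : ℂ) ^ 2 := by exact_mod_cast congrArg ((↑) : ℝ → ℂ) hν'
    rw [hpe, hqf, mul_pow, mul_pow, ← mul_assoc, h5] at hx
    exact mul_left_cancel₀ (pow_ne_zero 2 hρc) hx
  set g : ℂ := f / e ^ k with hg
  have hgn : ‖g‖ = 1 := by rw [hg, norm_div, norm_pow, hen, hfn]; simp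
  have hg2 : g ^ 2 = e := by
    rw [hg, div_pow, hef, ← pow_mul, mul_comm k 2, pow_succ]
    field_simp
  have hgk : g ^ (2 * k + 1) = f := by
    rw [pow_succ, pow_mul, hg2, hg]; field_simp
  have hgexp : g = Complex.exp (g.arg * Complex.I) := by
    have := Complex.norm_mul_exp_arg_mul_I g
    rw [hgn] at this
    simpa using this.symm
  refine ⟨g.arg, ?_⟩
  have h6 : Complex.exp (2 * g.arg * Complex.I) = e := by
    rw [← hg2]; nth_rw 2 [hgexp]; rw [← Complex.exp_nat_mul]; congr 1; push_cast; ring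
  have h7 : Complex.exp (((2 * k + 1 : ℕ) * g.arg : ℝ) * Complex.I) = f := by
    rw [← hgk]; nth_rw 2 [hgexp]; rw [← Complex.exp_nat_mul]; congr 1; push_cast; ring
  have h8 := Complex.exp_ofReal_mul_I_re ((2 * k + 1 : ℕ) * g.arg)
  have h9 := Complex.exp_ofReal_mul_I_im ((2 * k + 1 : ℕ) * g.arg)
  rw [h7] at h8 h9
  have h10 := congrArg Complex.re hqf
  have h11 := congrArg Complex.im hqf
  rw [hqv] at h10 h11
  simp only [Complex.re_ofReal_mul, Complex.im_ofReal_mul, h8, h9] at h10 h11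
  refine Prod.ext ?_ ?_
  · simp only [torusKnotTwo]
    rw [h6, ← h10, he]
    push_cast
    field_simp
    ring
  · simp only [torusKnotTwo]
    rw [h11]

end ElasticKnot

namespace ElasticKnot
open Topology unitInterval

open Classical in
/-- A map on the complement of `verticalCircle` in `S³`, in homogeneous coordinates. -/
noncomputable def extendToSphere (f : ℂ × ℝ → ℂ × ℂ) (l : ℂ × ℂ) (y : ℂ × ℂ) : ℂ × ℂ :=
  if stereoDenom y = 0 then l else f (stereo y)

theorem continuousAt_extendToSphere {f : ℂ × ℝ → ℂ × ℂ} {l : ℂ × ℂ} (hf : Continuous f)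
    (hl : Filter.Tendsto f (Filter.cocompact (ℂ × ℝ)) (𝓝 l)) {y : ℂ × ℂ} (hy : y.1 ≠ 0) :
    ContinuousAt (extendToSphere f l) y := by
  by_cases hd : stereoDenom y = 0
  · have h1 : extendToSphere f l y = l := if_pos hd
    rw [ContinuousAt, h1, ← nhdsWithin_univ, ← Set.compl_union_self {y | stereoDenom y ≠ 0},
      nhdsWithin_union, Filter.tendsto_sup]
    constructor
    · refine tendsto_const_nhds.congr' ?_
      filter_upwards [self_mem_nhdsWithin] with x hx
      exact (if_pos (not_not.1 hx)).symm
    · refine (hl.comp (tendsto_stereo_cocompact hy hd)).congr' ?_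
      filter_upwards [self_mem_nhdsWithin] with x hx
      exact (if_neg hx).symm
  · refine (hf.continuousAt.comp (continuousAt_stereo hd)).congr ?_
    filter_upwards [continuous_stereoDenom.continuousAt.eventually_ne hd] with x hx
    exact (if_neg hx).symm

theorem extendToSphere_sphereCoord (f : ℂ × ℝ → ℂ × ℂ) (l : ℂ × ℂ) (x : ℂ × ℝ) :
    extendToSphere f l (sphereCoord x) = f x := by
  rw [extendToSphere, if_neg (by rw [stereoDenom_sphereCoord]; norm_num), stereo_sphereCoord]

/-- Loops in the complement of an unknotted circle commute up to homotopy. -/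
theorem exists_torus_of_loops {f : ℂ × ℝ → ℂ × ℂ} {l : ℂ × ℂ} {S : Set (ℂ × ℂ)} (hf : Continuous f)
    (hl : Filter.Tendsto f (Filter.cocompact (ℂ × ℝ)) (𝓝 l)) (hlS : l ∈ S)
    (hfS : ∀ x ∉ verticalCircle, f x ∈ S) (a b : C(I, ℂ × ℝ)) (ha : ∀ s, a s ∉ verticalCircle)
    (hb : ∀ s, b s ∉ verticalCircle) (h₀ : a 0 = b 0) (ha₁ : a 1 = a 0) (hb₁ : b 1 = b 0) :
    ∃ Φ : C(I × I, ℂ × ℂ), (∀ x, Φ x ∈ S) ∧ (∀ s, f (a s) = Φ (s, 0)) ∧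
      (∀ s, f (a s) = Φ (s, 1)) ∧ (∀ t, f (b t) = Φ (0, t)) ∧ (∀ t, f (b t) = Φ (1, t)) := by
  let A := fun s => sphereCoord (a s)
  let B := fun s => sphereCoord (b s)
  have hA : Continuous A := continuous_sphereCoord.comp a.continuous
  have hB : Continuous B := continuous_sphereCoord.comp b.continuous
  have hA0 : ∀ s, (A s).1 ≠ 0 := fun s => sphereCoord_fst_ne_zero (ha s)
  have hB0 : ∀ s, (B s).1 ≠ 0 := fun s => sphereCoord_fst_ne_zero (hb s)
  have hAB : A 0 = B 0 := congrArg sphereCoord h₀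
  have hA1 : A 1 = A 0 := congrArg sphereCoord ha₁
  have hB1 : B 1 = B 0 := congrArg sphereCoord hb₁
  let y : I × I → ℂ × ℂ := fun x =>
    ((A x.1).1 * (B x.2).1 / (A 0).1, (A x.1).2 + (B x.2).2 - (A 0).2)
  have hy0 : ∀ x, (y x).1 ≠ 0 := fun x => div_ne_zero (mul_ne_zero (hA0 _) (hB0 _)) (hA0 0)
  have hyc : Continuous y := by
    refine Continuous.prodMk (Continuous.div_const ?_ _) ?_ <;> fun_prop
  have hya : ∀ s, y (s, 0) = A s := fun s => by
    refine Prod.ext ?_ ?_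
    · simp only [y, ← hAB]; exact mul_div_cancel_right₀ _ (hA0 0)
    · simp only [y, ← hAB]; ring
  have hyb : ∀ t, y (0, t) = B t := fun t => by
    refine Prod.ext ?_ ?_
    · simp only [y]; exact mul_div_cancel_left₀ _ (hA0 0)
    · simp only [y]; ring
  have hya' : ∀ s, y (s, 1) = A s := fun s => by rw [← hya s]; simp only [y, hB1]
  have hyb' : ∀ t, y (1, t) = B t := fun t => by rw [← hyb t]; simp only [y, hA1]
  refine ⟨⟨fun x => extendToSphere f l (y x), continuous_iff_continuousAt.2 fun x =>
    (continuousAt_extendToSphere hf hl (hy0 x)).comp hyc.continuousAt⟩, fun x => ?_, ?_⟩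
  · simp only [ContinuousMap.coe_mk, extendToSphere]
    split_ifs with h
    · exact hlS
    · exact hfS _ (stereo_notMem (hy0 x) h)
  · simp only [ContinuousMap.coe_mk, hya, hyb, hya', hyb', A, B, extendToSphere_sphereCoord]
    simp

/-- No homeomorphism of space maps a round circle to the torus knot of type `(2, n)`. -/
theorem image_verticalCircle_ne_torusKnotTwo {n : ℕ} (hn : Odd n) (hn1 : n ≠ 1) {ρ : ℝ}
    (hρ0 : 0 < ρ) (hρ : ρ < 1) (Ψ : (ℂ × ℝ) ≃ₜ (ℂ × ℝ)) :
    Ψ '' verticalCircle ≠ Set.range (torusKnotTwo n ρ) := by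
  intro hΨ
  have hn0 : n ≠ 0 := hn.pos.ne'
  have hnc : (n : ℂ) ≠ 0 := Nat.cast_ne_zero.2 hn0
  obtain ⟨ν, hν0, hν⟩ : ∃ ν : ℝ, 0 < ν ∧ ν ^ n = ρ / 2 :=
    ⟨(ρ / 2) ^ (n⁻¹ : ℝ), by positivity, Real.rpow_inv_natCast_pow (by positivity) hn0⟩
  have hνc : (ν : ℂ) ^ n = ρ / 2 := by exact_mod_cast congrArg ((↑) : ℝ → ℂ) hν
  have hνc0 : (ν : ℂ) ≠ 0 := Complex.ofReal_ne_zero.2 hν0.ne'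
  let Q : ℂ → ℂ × ℂ := fun z => (ν * Complex.exp (z / n), ν * Complex.exp (-z / n))
  have hQc : Continuous Q := by fun_prop
  have hQ : ∀ z, dihedralQuotient n (Q z) = ((ν : ℂ) ^ 2, ρ * Complex.cosh z) := fun z => by
    refine Prod.ext ?_ ?_
    · simp only [dihedralQuotient, Q]
      rw [mul_mul_mul_comm, ← Complex.exp_add, neg_div, add_neg_cancel, Complex.exp_zero]; ring
    · simp only [dihedralQuotient, Q]
      rw [mul_pow, mul_pow, ← Complex.exp_nat_mul, ← Complex.exp_nat_mul, hνc,
        mul_div_cancel₀ _ hnc, mul_div_cancel₀ _ hnc, Complex.cosh]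
      ring
  -- the two loops and their lifts
  let τ : I → ℝ := fun s => Real.pi / 2 - Real.pi * s
  let ζ : I → ℂ := fun s => ((Real.cos (τ s) / 2 : ℝ) : ℂ) + (τ s : ℂ) * Complex.I
  have hζ : Continuous ζ := by fun_prop
  let a' : C(I, ℂ × ℂ) := ⟨fun s => Q (ζ s), hQc.comp hζ⟩
  let a : C(I, ℂ × ℝ) := ⟨fun s => (1 + ((ρ * Complex.cosh (ζ s)).re : ℂ),
    (ρ * Complex.cosh (ζ s)).im), by fun_prop⟩
  let b' : C(I, ℂ × ℂ) := ⟨fun t => (Complex.exp (Real.pi * t * Complex.I) * (a' 0).1,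
    Complex.exp (Real.pi * t * Complex.I) * (a' 0).2), by fun_prop⟩
  let b : C(I, ℂ × ℝ) := ⟨fun t => (Complex.exp (2 * Real.pi * t * Complex.I), 0), by fun_prop⟩
  have hζ0 : ζ 0 = (Real.pi / 2 : ℝ) * Complex.I := by simp [ζ, τ]
  have hζ1 : ζ 1 = -ζ 0 := by
    rw [hζ0]; simp only [ζ, τ, Set.Icc.coe_one, mul_one]
    rw [show Real.pi / 2 - Real.pi = -(Real.pi / 2) by ring, Real.cos_neg, Real.cos_pi_div_two]
    simp
  have hcosh0 : Complex.cosh (ζ 0) = 0 := by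
    rw [hζ0, Complex.cosh_mul_I, ← Complex.ofReal_cos, Real.cos_pi_div_two, Complex.ofReal_zero]
  have hcosh1 : Complex.cosh (ζ 1) = 0 := by rw [hζ1, Complex.cosh_neg, hcosh0]
  have hma : ∀ s, knotMap ρ ν (a s) = dihedralQuotient n (a' s) := fun s => by
    have hs0 := s.2.1
    have hs1 := s.2.2
    have hcos : 0 ≤ Real.cos (τ s) := Real.cos_nonneg_of_neg_pi_div_two_le_of_le
      (by simp only [τ]; nlinarith [Real.pi_pos]) (by simp only [τ]; nlinarith [Real.pi_pos])
    have hre : (Complex.cosh (ζ s)).re = Real.cosh (Real.cos (τ s) / 2) * Real.cos (τ s) := by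
      simp only [ζ]
      rw [Complex.cosh_add, Complex.cosh_mul_I, Complex.sinh_mul_I, ← Complex.ofReal_cosh,
        ← Complex.ofReal_sinh, ← Complex.ofReal_cos, ← Complex.ofReal_sin]
      simp [-Complex.ofReal_cosh, -Complex.ofReal_sinh, -Complex.ofReal_cos, -Complex.ofReal_sin]
    have him : (Complex.cosh (ζ s)).im = Real.sinh (Real.cos (τ s) / 2) * Real.sin (τ s) := by
      simp only [ζ]
      rw [Complex.cosh_add, Complex.cosh_mul_I, Complex.sinh_mul_I, ← Complex.ofReal_cosh,
        ← Complex.ofReal_sinh, ← Complex.ofReal_cos, ← Complex.ofReal_sin]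
      simp [-Complex.ofReal_cosh, -Complex.ofReal_sinh, -Complex.ofReal_cos, -Complex.ofReal_sin]
    set c := Real.cos (τ s) / 2 with hc
    have hc1 : c ≤ 1 / 2 := by rw [hc]; linarith [Real.cos_le_one (τ s)]
    have hc0 : 0 ≤ c := by rw [hc]; linarith
    have hexp : Real.exp c ≤ 2 := by
      have h1 : Real.exp (1 / 2) ^ 2 = Real.exp 1 := by rw [← Real.exp_nat_mul]; norm_num
      have h2 := Real.exp_one_lt_d9
      have h3 := Real.exp_le_exp.2 hc1
      nlinarith [Real.exp_pos (1 / 2)]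
    have hsum := Real.cosh_add_sinh c
    have hsinh : 0 ≤ Real.sinh c := Real.sinh_nonneg_iff.2 hc0
    have hcosh : 1 ≤ Real.cosh c := Real.one_le_cosh c
    have habs : |Real.sinh c * Real.sin (τ s)| ≤ Real.sinh c := by
      rw [abs_mul, abs_of_nonneg hsinh]
      exact mul_le_of_le_one_right hsinh (Real.abs_sin_le_one _)
    have hC : Real.cosh c * Real.cos (τ s) ≤ Real.cosh c :=
      mul_le_of_le_one_right (by linarith) (Real.cos_le_one _)
    have hC0 : 0 ≤ Real.cosh c * Real.cos (τ s) := mul_nonneg (by linarith) hcos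
    have e1 : (a s).1 = ((1 + ρ * (Real.cosh c * Real.cos (τ s)) : ℝ) : ℂ) := by
      simp only [a, ContinuousMap.coe_mk]; rw [Complex.re_ofReal_mul, hre]; push_cast; ring
    have e2 : (a s).2 = ρ * (Real.sinh c * Real.sin (τ s)) := by
      simp only [a, ContinuousMap.coe_mk]; rw [Complex.im_ofReal_mul, him]
    have e3 : ‖(a s).1‖ = 1 + ρ * (Real.cosh c * Real.cos (τ s)) := by
      rw [e1, Complex.norm_real, Real.norm_eq_abs, abs_of_nonneg (by positivity)]
    have e4 : |(a s).2| ≤ ρ * Real.sinh c := by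
      rw [e2, abs_mul, abs_of_pos hρ0]; gcongr
    rw [knotMap_of_near hρ (by nlinarith) (by rw [e3]; nlinarith) (by rw [e3]; nlinarith)]
    simp only [a', ContinuousMap.coe_mk]
    rw [hQ, e3, e1, e2]
    refine Prod.ext ?_ ?_
    · have : (1 + ρ * (Real.cosh c * Real.cos (τ s)) : ℝ) ≠ 0 := by positivity
      simp only
      rw [← Complex.ofReal_mul, div_mul_cancel₀ _ this]; push_cast; rfl
    · apply Complex.ext
      · rw [Complex.re_ofReal_mul, hre]; simp
      · rw [Complex.im_ofReal_mul, him]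
  have ha'0 : (a' 0).1 ^ n + (a' 0).2 ^ n = 0 := by
    have := congrArg Prod.snd (hQ (ζ 0))
    rw [hcosh0, mul_zero] at this
    exact this
  have ha'0' : (a' 0).1 * (a' 0).2 = (ν : ℂ) ^ 2 := congrArg Prod.fst (hQ (ζ 0))
  have hmb : ∀ t, knotMap ρ ν (b t) = dihedralQuotient n (b' t) := fun t => by
    have e1 : ‖(b t).1‖ = 1 := by
      have := norm_exp_mul_I' (Real.pi * t)
      push_cast at this
      simp only [b, ContinuousMap.coe_mk]; rwa [mul_assoc (2 : ℂ)]
    have e2 : (b t).2 = 0 := rfl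
    rw [knotMap_of_near hρ (by rw [e2]; simpa using hρ0.le) (by rw [e1]; linarith)
      (by rw [e1, e2]; norm_num), e1, e2]
    simp only [dihedralQuotient, b', b, ContinuousMap.coe_mk]
    refine Prod.ext ?_ ?_
    · simp only
      rw [mul_mul_mul_comm, ha'0', ← Complex.exp_add, div_one, mul_comm]
      push_cast
      ring_nf
    · simp only
      rw [mul_pow, mul_pow, ← mul_add, ha'0, mul_zero]
      apply Complex.ext <;> simp
  have ha'S : ∀ s, dihedralQuotient n (a' s) ∈ regularValues n := fun s => by
    rw [mem_preimage_regularValues]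
    simp only [a', Q, ContinuousMap.coe_mk]
    rw [mul_pow, mul_pow, ← Complex.exp_nat_mul, ← Complex.exp_nat_mul,
        mul_div_cancel₀ _ hnc, mul_div_cancel₀ _ hnc]
    intro h
    have h1 := mul_left_cancel₀ (pow_ne_zero n hνc0) h
    have h2 : Complex.exp (2 * ζ s) = 1 := by
      rw [two_mul, Complex.exp_add]; nth_rw 2 [h1]
      rw [← Complex.exp_add, add_neg_cancel, Complex.exp_zero]
    obtain ⟨k, hk⟩ := Complex.exp_eq_one_iff.1 h2
    have hre := congrArg Complex.re hk
    have him := congrArg Complex.im hk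
    simp [ζ, -Complex.ofReal_cos] at hre him
    have h3 : τ s = k * Real.pi := by linarith
    rw [h3] at hre
    have h4 := Real.sin_sq_add_cos_sq (k * Real.pi)
    rw [hre, Real.sin_int_mul_pi] at h4
    norm_num at h4
  have hb'S : ∀ s, dihedralQuotient n (b' s) ∈ regularValues n := fun s => by
    have h0 := ha'S 0
    rw [mem_preimage_regularValues] at h0 ⊢
    simp only [b', ContinuousMap.coe_mk, mul_pow]
    intro h
    exact h0 (mul_left_cancel₀ (pow_ne_zero n (Complex.exp_ne_zero _)) h)
  -- transport to the complement of the circle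
  have hout : ∀ x, knotMap ρ ν x ∈ regularValues n → Ψ.symm x ∉ verticalCircle := fun x hx h => by
    have h1 : x ∈ Ψ '' verticalCircle := ⟨_, h, Ψ.apply_symm_apply x⟩
    rw [hΨ] at h1
    obtain ⟨t, rfl⟩ := h1
    exact knotMap_torusKnotTwo_notMem hρ0 hρ hν t hx
  have hin : ∀ x ∉ verticalCircle, knotMap ρ ν (Ψ x) ∈ regularValues n := fun x hx => by
    by_contra h
    have h1 := mem_range_torusKnotTwo hn hρ0 hρ hν0 hν h
    rw [← hΨ] at h1
    obtain ⟨y, hy, hyx⟩ := h1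
    exact hx (Ψ.injective hyx ▸ hy)
  have hab0 : a 0 = b 0 := by simp [a, b, hcosh0]
  have ha1 : a 1 = a 0 := by simp [a, hcosh0, hcosh1]
  have hb1 : b 1 = b 0 := by simp [b, Complex.exp_two_pi_mul_I]
  have hl : ((0, 2) : ℂ × ℂ) ∈ regularValues n := by simp [regularValues, hn0]
  obtain ⟨Φ, hΦ, hΦa, hΦa', hΦb, hΦb'⟩ := exists_torus_of_loops
    (f := fun x => knotMap ρ ν (Ψ x)) ((continuous_knotMap ν hρ).comp Ψ.continuous)
    ((tendsto_knotMap ν hρ hρ0).comp Ψ.isClosedEmbedding.tendsto_cocompact) hl hin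
    ⟨fun s => Ψ.symm (a s), by fun_prop⟩ ⟨fun s => Ψ.symm (b s), by fun_prop⟩
    (fun s => hout _ (by rw [hma]; exact ha'S s)) (fun s => hout _ (by rw [hmb]; exact hb'S s))
    (congrArg Ψ.symm hab0) (congrArg Ψ.symm ha1) (congrArg Ψ.symm hb1)
  simp only [ContinuousMap.coe_mk, Homeomorph.apply_symm_apply, hma, hmb] at hΦa hΦa' hΦb hΦb'
  -- the deck transformations
  let c : ℂ := -Complex.exp (Real.pi * Complex.I / n)
  have hc0 : c ≠ 0 := neg_ne_zero.2 (Complex.exp_ne_zero _)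
  have hcn : c ^ n = 1 := by
    simp only [c]
    rw [hn.neg_pow, ← Complex.exp_nat_mul, mul_div_cancel₀ _ hnc, Complex.exp_pi_mul_I]; norm_num
  have hP1 : (a' 0).1 = ν * Complex.exp (ζ 0 / n) := rfl
  have hP2 : (a' 0).2 = ν * Complex.exp (-ζ 0 / n) := rfl
  have hP : (a' 0).1 = Complex.exp (Real.pi * Complex.I / n) * (a' 0).2 := by
    rw [hP1, hP2, mul_left_comm, ← Complex.exp_add, hζ0]
    congr 2; push_cast; ring
  have hcomm := (isCoveringMapOn_dihedralQuotient hn0).deck_commute_of_torus Φ hΦ a' b'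
    (by simp [b']) hΦa hΦa' hΦb hΦb' Prod.swap (fun w => (c * w.2, c⁻¹ * w.1)) continuous_swap
    (by fun_prop) (fun w => by simp [dihedralQuotient, mul_comm, add_comm])
    (fun w => by
      refine Prod.ext ?_ ?_
      · simp only [dihedralQuotient]; field_simp
      · simp only [dihedralQuotient]; rw [mul_pow, mul_pow, inv_pow, hcn]; ring)
    (by simp only [a', ContinuousMap.coe_mk, hζ1, Q, neg_neg]; rfl)
    (by
      refine Prod.ext ?_ ?_
      · simp only [b', ContinuousMap.coe_mk, c, Set.Icc.coe_one, Complex.ofReal_one, mul_one,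
          Complex.exp_pi_mul_I, Set.Icc.coe_zero, Complex.ofReal_zero, mul_zero, zero_mul,
          Complex.exp_zero, one_mul]
        rw [hP]; ring
      · simp only [b', ContinuousMap.coe_mk, c, Set.Icc.coe_one, Complex.ofReal_one, mul_one,
          Complex.exp_pi_mul_I, Set.Icc.coe_zero, Complex.ofReal_zero, mul_zero, zero_mul,
          Complex.exp_zero, one_mul]
        rw [hP]; field_simp)
  have h1 := congrArg Prod.fst hcomm
  simp only [Prod.fst_swap, Prod.snd_swap] at h1
  have hPne : (a' 0).1 ≠ 0 := mul_ne_zero hνc0 (Complex.exp_ne_zero _)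
  have h2 : c ^ 2 = 1 := by
    have := mul_right_cancel₀ hPne h1
    field_simp at this
    exact this.symm
  have h3 : Complex.exp (2 * Real.pi * Complex.I / n) = 1 := by
    rw [← h2]; simp only [c]; rw [neg_sq, ← Complex.exp_nat_mul]; congr 1; push_cast; ring
  exact hn1 ((Complex.isPrimitiveRoot_exp n hn0).unique
    (IsPrimitiveRoot.one_right_iff.2 h3 ))

end ElasticKnot

namespace ElasticKnot
open Topology

theorem exists_continuous_inverse {h : ℝ → ℝ} {a b : ℝ} (hab : a ≤ b)
    (hc : ContinuousOn h (Set.Icc a b)) (hm : StrictMonoOn h (Set.Icc a b)) :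
    ∃ ι : ℝ → ℝ, Continuous ι ∧ (∀ z, ι z ∈ Set.Icc a b) ∧
      (∀ z ∈ Set.Icc (h a) (h b), h (ι z) = z) ∧ (∀ t ∈ Set.Icc a b, ι (h t) = t) ∧
      (∀ z ≤ h a, ι z = a) ∧ ∀ z ≥ h b, ι z = b := by
  let P : ℝ → ℝ := fun t => max a (min b t)
  have hP : ∀ t, P t ∈ Set.Icc a b := fun t => ⟨le_max_left _ _, max_le hab (min_le_left _ _)⟩
  have hPc : Continuous P := by fun_prop
  have hPid : ∀ t ∈ Set.Icc a b, P t = t := fun t ht => by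
    simp only [P]; rw [min_eq_right ht.2, max_eq_right ht.1]
  let k : ℝ → ℝ := fun t => h (P t) + (t - P t)
  have hkc : Continuous k :=
    (hc.comp_continuous hPc hP).add (continuous_id.sub hPc)
  have hPm : Monotone P := fun s t hst => max_le_max le_rfl (min_le_min le_rfl hst)
  have hkm : StrictMono k := by
    intro s t hst
    have h1 := hPm hst.le
    have h2 : s - P s ≤ t - P t := by
      simp only [P]
      rcases max_cases a (min b s) with ⟨e1, _⟩ | ⟨e1, _⟩ <;>
      rcases max_cases a (min b t) with ⟨e2, _⟩ | ⟨e2, _⟩ <;>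
      rcases min_cases b s with ⟨e3, _⟩ | ⟨e3, _⟩ <;>
      rcases min_cases b t with ⟨e4, _⟩ | ⟨e4, _⟩ <;> rw [e1, e2] <;> linarith
    rcases h1.eq_or_lt with h3 | h3
    · simp only [k]; rw [h3]; linarith
    · have := hm (hP s) (hP t) h3
      simp only [k]; linarith
  have hks : Function.Surjective k := by
    refine hkc.surjective ?_ ?_
    · refine Filter.tendsto_atTop_mono' _ ?_
        (Filter.tendsto_atTop_add_const_right _ (h b - b) Filter.tendsto_id)
      filter_upwards [Filter.eventually_ge_atTop b] with t ht
      have : P t = b := by simp only [P]; rw [min_eq_left ht, max_eq_right hab]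
      simp only [k, this, id]; linarith
    · refine Filter.tendsto_atBot_mono' _ ?_
        (Filter.tendsto_atBot_add_const_right _ (h a - a) Filter.tendsto_id)
      filter_upwards [Filter.eventually_le_atBot a] with t ht
      have : P t = a := by simp only [P]; rw [min_eq_right (ht.trans hab), max_eq_left ht]
      simp only [k, this, id]; linarith
  let e := hkm.orderIsoOfSurjective k hks
  have he : ∀ t, e.symm (k t) = t := fun t => e.symm_apply_apply t
  have he' : ∀ z, k (e.symm z) = z := fun z => e.apply_symm_apply z
  have hka : k a = h a := by simp only [k]; rw [hPid a ⟨le_rfl, hab⟩]; ring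
  have hkb : k b = h b := by simp only [k]; rw [hPid b ⟨hab, le_rfl⟩]; ring
  refine ⟨fun z => P (e.symm z), hPc.comp e.symm.continuous, fun z => hP _, fun z hz => ?_,
    fun t ht => ?_, fun z hz => ?_, fun z hz => ?_⟩
  · have h1 : e.symm z ∈ Set.Icc a b := by
      constructor
      · rw [← hkm.le_iff_le, he', hka]; exact hz.1
      · rw [← hkm.le_iff_le, he', hkb]; exact hz.2
    have h2 := he' z
    simp only [k] at h2 ⊢
    rw [hPid _ h1] at h2 ⊢
    linarith
  · have : k t = h t := by simp only [k]; rw [hPid t ht]; ring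
    simp only [← this, he, hPid t ht]
  · have h1 : e.symm z ≤ a := by rw [← hkm.le_iff_le, he', hka]; exact hz
    simp only [P]; rw [min_eq_right (h1.trans hab), max_eq_left h1]
  · have h1 : b ≤ e.symm z := by rw [← hkm.le_iff_le, he', hkb]; exact hz
    simp only [P]; rw [min_eq_left h1, max_eq_right hab]

/-- A radial homeomorphism of the plane that maps the circle of radius `d` to the circle of
radius `d'`. -/
noncomputable def radialShift (d d' : ℝ) (x : ℂ) : ℂ := x * ((1 + (d' - d) / max d ‖x‖ : ℝ) : ℂ)

theorem radialShift_radialShift {d d' : ℝ} (hd : 0 ≤ d) (hd' : 0 ≤ d') (h : d = 0 ↔ d' = 0)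
    (x : ℂ) : radialShift d' d (radialShift d d' x) = x := by
  rcases hd.eq_or_lt with rfl | hd
  · have : d' = 0 := h.1 rfl
    subst this
    simp [radialShift]
  have hd' : 0 < d' := lt_of_le_of_ne hd' fun h1 => hd.ne' (h.2 h1.symm)
  rcases le_or_gt ‖x‖ d with hx | hx
  · have h1 : radialShift d d' x = x * ((d' / d : ℝ) : ℂ) := by
      rw [radialShift, max_eq_left hx]
      congr 2; field_simp; ring
    have h2 : ‖radialShift d d' x‖ ≤ d' := by
      rw [h1, norm_mul, Complex.norm_real, Real.norm_eq_abs, abs_of_pos (by positivity)]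
      calc ‖x‖ * (d' / d) ≤ d * (d' / d) := by gcongr
        _ = d' := by field_simp
    rw [radialShift, max_eq_left h2, h1, mul_assoc, ← Complex.ofReal_mul]
    have : d' / d * (1 + (d - d') / d') = 1 := by field_simp; ring
    rw [this]; simp
  · have hx0 : 0 < ‖x‖ := hd.trans hx
    have h1 : radialShift d d' x = x * (((‖x‖ + d' - d) / ‖x‖ : ℝ) : ℂ) := by
      rw [radialShift, max_eq_right hx.le]
      congr 2; field_simp; ring
    have h0 : 0 < ‖x‖ + d' - d := by linarith
    have h2 : ‖radialShift d d' x‖ = ‖x‖ + d' - d := by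
      rw [h1, norm_mul, Complex.norm_real, Real.norm_eq_abs, abs_of_pos (by positivity)]
      field_simp
    rw [radialShift, h2, max_eq_right (by linarith), h1, mul_assoc, ← Complex.ofReal_mul]
    have : (‖x‖ + d' - d) / ‖x‖ * (1 + (d - d') / (‖x‖ + d' - d)) = 1 := by field_simp; ring
    rw [this]; simp

theorem radialShift_of_norm_eq {d d' : ℝ} (h : d = 0 → d' = 0) {x : ℂ} (hx : ‖x‖ = d) :
    (d : ℂ) * radialShift d d' x = d' * x := by
  by_cases hd : d = 0
  · have := h hd
    simp [hd, this]
  · rw [radialShift, hx, max_self]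
    have : 1 + (d' - d) / d = d' / d := by field_simp; ring
    rw [this]
    have hdc : (d : ℂ) ≠ 0 := Complex.ofReal_ne_zero.2 hd
    push_cast; field_simp

theorem continuous_radialShift {X : Type*} [TopologicalSpace X] {d d' : X → ℝ} {x : X → ℂ}
    (hd : Continuous d) (hd' : Continuous d') (hx : Continuous x) (hd0 : ∀ z, 0 ≤ d z)
    (h : ∀ z, d z = 0 → d' z = 0) : Continuous fun z => radialShift (d z) (d' z) (x z) := by
  have : Continuous fun z => x z * (((d' z - d z) / max (d z) ‖x z‖ : ℝ) : ℂ) := by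
    rw [continuous_iff_continuousAt]
    intro z
    by_cases hz : max (d z) ‖x z‖ = 0
    · have h1 : d z = 0 := le_antisymm (hz ▸ le_max_left _ _) (hd0 z)
      have h2 := h z h1
      rw [ContinuousAt, hz, div_zero, Complex.ofReal_zero, mul_zero,
        tendsto_zero_iff_norm_tendsto_zero]
      have h3 : Filter.Tendsto (fun z => |d' z - d z|) (𝓝 z) (𝓝 0) := by
        have := (hd'.sub hd).abs.tendsto z
        simpa [h1, h2] using this
      refine squeeze_zero (fun _ => norm_nonneg _) (fun y => ?_) h3
      rw [norm_mul, Complex.norm_real, Real.norm_eq_abs, abs_div,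
        abs_of_nonneg ((hd0 y).trans (le_max_left _ ‖x y‖))]
      rcases (norm_nonneg (x y)).eq_or_lt with h4 | h4
      · rw [← h4, zero_mul]; exact abs_nonneg _
      · have h5 : 0 < max (d y) ‖x y‖ := lt_max_of_lt_right h4
        rw [mul_div_assoc', div_le_iff₀ h5, mul_comm]
        gcongr
        exact le_max_right _ _
    · refine hx.continuousAt.mul (Complex.continuous_ofReal.continuousAt.comp ?_)
      exact (hd'.sub hd).continuousAt.div (hd.max hx.norm).continuousAt hz
  have h2 := hx.add this
  refine h2.congr fun z => ?_
  simp only [radialShift, Pi.add_apply]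
  push_cast; ring

/-- A family of radial homeomorphisms. -/
noncomputable def radialShiftHomeomorph {d d' : ℝ → ℝ} (hd : Continuous d) (hd' : Continuous d')
    (hd0 : ∀ z, 0 ≤ d z) (hd0' : ∀ z, 0 ≤ d' z) (h : ∀ z, d z = 0 ↔ d' z = 0) :
    (ℂ × ℝ) ≃ₜ (ℂ × ℝ) where
  toFun x := (radialShift (d x.2) (d' x.2) x.1, x.2)
  invFun x := (radialShift (d' x.2) (d x.2) x.1, x.2)
  left_inv _ := Prod.ext (radialShift_radialShift (hd0 _) (hd0' _) (h _) _) rfl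
  right_inv _ := Prod.ext (radialShift_radialShift (hd0' _) (hd0 _) (h _).symm _) rfl
  continuous_toFun := (continuous_radialShift (hd.comp continuous_snd) (hd'.comp continuous_snd)
    continuous_fst (fun _ => hd0 _) fun _ => (h _).1).prodMk continuous_snd
  continuous_invFun := (continuous_radialShift (hd'.comp continuous_snd) (hd.comp continuous_snd)
    continuous_fst (fun _ => hd0' _) fun _ => (h _).2).prodMk continuous_snd

/-- A family of rigid motions of the plane. -/
noncomputable def motionHomeomorph {m w : ℝ → ℂ} (hm : Continuous m) (hw : Continuous w)
    (hw0 : ∀ z, w z ≠ 0) : (ℂ × ℝ) ≃ₜ (ℂ × ℝ) where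
  toFun x := ((w x.2)⁻¹ * (x.1 - m x.2), x.2)
  invFun x := (w x.2 * x.1 + m x.2, x.2)
  left_inv _ := Prod.ext (by simp only; rw [mul_inv_cancel_left₀ (hw0 _)]; ring) rfl
  right_inv _ := Prod.ext (by simp only; rw [add_sub_cancel_right, inv_mul_cancel_left₀ (hw0 _)]) rfl
  continuous_toFun := by
    have : Continuous fun z => (w z)⁻¹ := hw.inv₀ hw0
    exact ((this.comp continuous_snd).mul (by fun_prop)).prodMk continuous_snd
  continuous_invFun := by fun_prop

/-- The mean of a function over a segment. -/
noncomputable def segmentMean (f : ℝ → ℂ) (s t : ℝ) : ℂ := ∫ r in (0 : ℝ)..1, f (t + r * (s - t))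

theorem continuous_segmentMean {f : ℝ → ℂ} (hf : Continuous f) :
    Continuous fun p : ℝ × ℝ => segmentMean f p.1 p.2 := by
  unfold segmentMean
  apply intervalIntegral.continuous_parametric_intervalIntegral_of_continuous'
  fun_prop

theorem sub_mul_segmentMean {x x' : ℝ → ℂ} (hx : ∀ t, HasDerivAt x (x' t) t) (hc : Continuous x')
    (s t : ℝ) : ((s - t : ℝ) : ℂ) * segmentMean x' s t = x s - x t := by
  have h : ∀ r ∈ Set.uIcc (0 : ℝ) 1, HasDerivAt (fun r => x (t + r * (s - t)))
      (((s - t : ℝ) : ℂ) * x' (t + r * (s - t))) r := fun r _ => by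
    have h1 : HasDerivAt (fun r : ℝ => t + r * (s - t)) (s - t) r := by
      simpa using ((hasDerivAt_id r).mul_const (s - t)).const_add t
    have h2 := (hx (t + r * (s - t))).scomp r h1
    rwa [Complex.real_smul] at h2
  have h3 := intervalIntegral.integral_eq_sub_of_hasDerivAt h
    (Continuous.intervalIntegrable (by fun_prop) _ _)
  rw [intervalIntegral.integral_const_mul] at h3
  rw [segmentMean, h3]
  simp

end ElasticKnot

namespace ElasticKnot
open Topology

/-- The affine homeomorphism that normalizes a vertical circle. -/
noncomputable def rescaleHomeomorph (m R : ℝ) (hR : R ≠ 0) : (ℂ × ℝ) ≃ₜ (ℂ × ℝ) where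
  toFun x := ((R : ℂ)⁻¹ * x.1, R⁻¹ * (x.2 - m))
  invFun x := (R * x.1, R * x.2 + m)
  left_inv x := Prod.ext (mul_inv_cancel_left₀ (Complex.ofReal_ne_zero.2 hR) _)
    (by simp only; rw [mul_inv_cancel_left₀ hR]; ring)
  right_inv x := Prod.ext (inv_mul_cancel_left₀ (Complex.ofReal_ne_zero.2 hR) _)
    (by simp only; rw [add_sub_cancel_right, inv_mul_cancel_left₀ hR])

/-- A closed curve whose height has one maximum and one minimum is unknotted. -/
theorem exists_homeomorph_verticalCircle {x x' : ℝ → ℂ} {h : ℝ → ℝ} {t₀ t₁ : ℝ}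
    (hx : ∀ t, HasDerivAt x (x' t) t) (hx'c : Continuous x') (hxp : Function.Periodic x 1)
    (hhp : Function.Periodic h 1) (hhc : Continuous h)
    (h01 : t₀ < t₁) (h10 : t₁ < t₀ + 1) (hmono : StrictMonoOn h (Set.Icc t₀ t₁))
    (hanti : StrictAntiOn h (Set.Icc t₁ (t₀ + 1))) (hd₀ : x' t₀ ≠ 0) (hd₁ : x' t₁ ≠ 0)
    (hinj : ∀ s ∈ Set.Ioo t₀ t₁, ∀ t ∈ Set.Ioo t₁ (t₀ + 1), h s = h t → x s ≠ x t) :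
    ∃ Ψ : (ℂ × ℝ) ≃ₜ (ℂ × ℝ), Ψ '' verticalCircle = Set.range fun t => (x t, h t) := by
  have hxc : Continuous x := continuous_iff_continuousAt.2 fun t => (hx t).continuousAt
  have hx'p : ∀ t, x' (t + 1) = x' t := fun t => by
    have h1 := (hx (t + 1)).comp_add_const t 1
    rw [funext hxp] at h1
    exact h1.unique (hx t)
  obtain ⟨ι, hιc, hι, hι1, hι2, hι3, hι4⟩ :=
    exists_continuous_inverse h01.le hhc.continuousOn hmono
  obtain ⟨κ', hκc', hκ', hκ1', hκ2', hκ3', hκ4'⟩ :=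
    exists_continuous_inverse h10.le hhc.neg.continuousOn hanti.neg
  set lo := h t₀ with hlo
  set hi := h t₁ with hhi
  have hlohi : lo < hi := hmono ⟨le_rfl, h01.le⟩ ⟨h01.le, le_rfl⟩ h01
  have hlo' : h (t₀ + 1) = lo := hhp t₀
  let κ : ℝ → ℝ := fun z => κ' (-z)
  have hκc : Continuous κ := by fun_prop
  have hκ : ∀ z, κ z ∈ Set.Icc t₁ (t₀ + 1) := fun z => hκ' _
  have hκ1 : ∀ z ∈ Set.Icc lo hi, h (κ z) = z := fun z hz => by
    have := hκ1' (-z) ⟨neg_le_neg hz.2, by simp only [Pi.neg_apply, hlo']; exact neg_le_neg hz.1⟩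
    simpa using this
  have hκ2 : ∀ t ∈ Set.Icc t₁ (t₀ + 1), κ (h t) = t := fun t ht => hκ2' t ht
  have hκ3 : ∀ z, hi ≤ z → κ z = t₁ := fun z hz => hκ3' _ (neg_le_neg hz)
  have hκ4 : ∀ z ≤ lo, κ z = t₀ + 1 := fun z hz =>
    hκ4' _ (by simp only [Pi.neg_apply, hlo']; exact neg_le_neg hz)
  let m : ℝ → ℂ := fun z => (x (ι z) + x (κ z)) / 2
  let D : ℝ → ℂ := fun z => (x (ι z) - x (κ z)) / 2
  have hmc : Continuous m := by fun_prop
  have hDc : Continuous D := by fun_prop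
  let G := segmentMean x'
  let u : ℝ → ℂ := fun z => G (ι z) (κ z - 1) - G (ι z) (κ z)
  have hGc : Continuous fun p : ℝ × ℝ => G p.1 p.2 := continuous_segmentMean hx'c
  have huc : Continuous u :=
    (hGc.comp (hιc.prodMk (hκc.sub continuous_const))).sub (hGc.comp (hιc.prodMk hκc))
  have hG : ∀ s t, ((s - t : ℝ) : ℂ) * G s t = x s - x t := sub_mul_segmentMean hx hx'c
  have hGd : ∀ t, G t t = x' t := fun t => by simp [G, segmentMean]
  have hG1 : ∀ t, G t (t - 1) = 0 := fun t => by
    have h1 := hG t (t - 1)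
    have h2 := hxp (t - 1)
    rw [sub_add_cancel] at h2
    rw [h2, sub_self, sub_sub_cancel, Complex.ofReal_one, one_mul] at h1
    exact h1
  have hG1' : ∀ t, G t (t + 1) = 0 := fun t => by
    have h1 := hG t (t + 1)
    rw [hxp t, sub_self] at h1
    simpa using h1
  -- values at the ends and in the interior
  have hends : ∀ z, z ∉ Set.Ioo lo hi → D z = 0 ∧ u z ≠ 0 := fun z hz => by
    rcases le_or_gt z lo with h1 | h1
    · have e1 := hι3 z h1
      have e2 := hκ4 z h1
      simp only [D, u]
      rw [e1, e2, hxp, add_sub_cancel_right, hGd, hG1']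
      simpa using hd₀
    · have h2 : hi ≤ z := not_lt.1 fun h2 => hz ⟨h1, h2⟩
      have e1 := hι4 z h2
      have e2 := hκ3 z h2
      simp only [D, u]
      rw [e1, e2, hGd, hG1]
      simpa using hd₁
  have hint : ∀ z ∈ Set.Ioo lo hi, D z ≠ 0 ∧ ∃ c : ℝ, 0 < c ∧ u z = c * D z := fun z hz => by
    have e1 := hι1 z ⟨hz.1.le, hz.2.le⟩
    have e2 := hκ1 z ⟨hz.1.le, hz.2.le⟩
    have hs0 : ι z ≠ t₀ := fun h1 => by rw [h1] at e1; exact hz.1.ne e1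
    have hs1 : ι z ≠ t₁ := fun h1 => by rw [h1] at e1; exact hz.2.ne' e1
    have ht1 : κ z ≠ t₁ := fun h1 => by rw [h1] at e2; exact hz.2.ne' e2
    have ht0 : κ z ≠ t₀ + 1 := fun h1 => by rw [h1, hlo'] at e2; exact hz.1.ne e2
    have hs : ι z ∈ Set.Ioo t₀ t₁ :=
      ⟨lt_of_le_of_ne (hι z).1 hs0.symm, lt_of_le_of_ne (hι z).2 hs1⟩
    have ht : κ z ∈ Set.Ioo t₁ (t₀ + 1) :=
      ⟨lt_of_le_of_ne (hκ z).1 ht1.symm, lt_of_le_of_ne (hκ z).2 ht0⟩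
    have hne := hinj _ hs _ ht (e1.trans e2.symm)
    refine ⟨div_ne_zero (sub_ne_zero.2 hne) two_ne_zero, ?_⟩
    have p1 : 0 < ι z - (κ z - 1) := by linarith [hs.1, ht.2]
    have p2 : 0 < κ z - ι z := by linarith [hs.2, ht.1]
    refine ⟨2 / (ι z - (κ z - 1)) + 2 / (κ z - ι z), by positivity, ?_⟩
    have g1 := hG (ι z) (κ z - 1)
    have g2 := hG (ι z) (κ z)
    have g3 := hxp (κ z - 1)
    rw [sub_add_cancel] at g3
    rw [← g3] at g1
    have q1 : ((ι z - (κ z - 1) : ℝ) : ℂ) ≠ 0 := Complex.ofReal_ne_zero.2 p1.ne'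
    have q2 : ((κ z - ι z : ℝ) : ℂ) ≠ 0 := Complex.ofReal_ne_zero.2 p2.ne'
    have g1' : G (ι z) (κ z - 1) = 2 * D z / ((ι z - (κ z - 1) : ℝ) : ℂ) := by
      rw [eq_div_iff q1, mul_comm, g1]; simp only [D]; ring
    have g2' : - G (ι z) (κ z) = 2 * D z / ((κ z - ι z : ℝ) : ℂ) := by
      rw [eq_div_iff q2]
      have : ((κ z - ι z : ℝ) : ℂ) = -((ι z - κ z : ℝ) : ℂ) := by push_cast; ring
      rw [this, neg_mul_neg, mul_comm, g2]; simp only [D]; ring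
    simp only [u]
    rw [sub_eq_add_neg, g1', g2']
    push_cast
    ring
  have hu0 : ∀ z, u z ≠ 0 := fun z => by
    by_cases hz : z ∈ Set.Ioo lo hi
    · obtain ⟨h1, c, h2, h3⟩ := hint z hz
      rw [h3]
      exact mul_ne_zero (Complex.ofReal_ne_zero.2 h2.ne') h1
    · exact (hends z hz).2
  let w : ℝ → ℂ := fun z => u z / ‖u z‖
  have hun : ∀ z, (‖u z‖ : ℂ) ≠ 0 := fun z =>
    Complex.ofReal_ne_zero.2 (norm_ne_zero_iff.2 (hu0 z))
  have hwc : Continuous w := huc.div (Complex.continuous_ofReal.comp huc.norm) hun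
  have hw0 : ∀ z, w z ≠ 0 := fun z => div_ne_zero (hu0 z) (hun z)
  have hwD : ∀ z, D z = w z * ‖D z‖ := fun z => by
    by_cases hz : z ∈ Set.Ioo lo hi
    · obtain ⟨h1, c, h2, h3⟩ := hint z hz
      have h4 : (‖u z‖ : ℂ) = c * ‖D z‖ := by
        rw [h3, norm_mul, Complex.norm_real, Real.norm_eq_abs, abs_of_pos h2]; push_cast; rfl
      have h5 : (‖D z‖ : ℂ) ≠ 0 := Complex.ofReal_ne_zero.2 (norm_ne_zero_iff.2 h1)
      have h6 : (c : ℂ) ≠ 0 := Complex.ofReal_ne_zero.2 h2.ne'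
      simp only [w]
      rw [h4, h3]
      field_simp
    · rw [(hends z hz).1]; simp
  let d' : ℝ → ℝ := fun z => √((z - lo) * (hi - z))
  have hd'c : Continuous d' := by fun_prop
  have hdd' : ∀ z, ‖D z‖ = 0 ↔ d' z = 0 := fun z => by
    by_cases hz : z ∈ Set.Ioo lo hi
    · have h1 := (hint z hz).1
      have h2 : 0 < (z - lo) * (hi - z) := mul_pos (sub_pos.2 hz.1) (sub_pos.2 hz.2)
      exact iff_of_false (norm_ne_zero_iff.2 h1) (Real.sqrt_ne_zero'.2 h2)
    · refine iff_of_true (norm_eq_zero.2 (hends z hz).1) (Real.sqrt_eq_zero'.2 ?_)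
      rcases le_or_gt z lo with h1 | h1
      · exact mul_nonpos_of_nonpos_of_nonneg (sub_nonpos.2 h1) (sub_nonneg.2 (h1.trans hlohi.le))
      · have h2 : hi ≤ z := not_lt.1 fun h2 => hz ⟨h1, h2⟩
        exact mul_nonpos_of_nonneg_of_nonpos (sub_nonneg.2 h1.le) (sub_nonpos.2 h2)
  let Θ₁ := motionHomeomorph hmc hwc hw0
  let Θ₂ := radialShiftHomeomorph hDc.norm hd'c (fun z => norm_nonneg (D z))
    (fun z => Real.sqrt_nonneg _) hdd'
  have hR : (hi - lo) / 2 ≠ 0 := by linarith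
  let Θ₃ := rescaleHomeomorph ((lo + hi) / 2) ((hi - lo) / 2) hR
  let Θ := (Θ₁.trans Θ₂).trans Θ₃
  have hΘ : ∀ (ε : ℝ), |ε| = 1 → ∀ z y, y = m z + ε * D z →
      Θ (y, z) = ((((hi - lo) / 2 : ℝ) : ℂ)⁻¹ * (ε * d' z), ((hi - lo) / 2)⁻¹ * (z - (lo + hi) / 2)) := by
    rintro ε hε z y rfl
    have h1 : Θ₁ (m z + ε * D z, z) = ((ε : ℂ) * ‖D z‖, z) := by
      refine Prod.ext ?_ rfl
      change (w z)⁻¹ * (m z + ε * D z - m z) = _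
      rw [add_sub_cancel_left]
      nth_rw 1 [hwD z]
      rw [mul_left_comm, inv_mul_cancel_left₀ (hw0 z)]
    have h2 : Θ₂ ((ε : ℂ) * ‖D z‖, z) = ((ε : ℂ) * d' z, z) := by
      refine Prod.ext ?_ rfl
      change radialShift ‖D z‖ (d' z) (ε * ‖D z‖) = _
      by_cases h0 : ‖D z‖ = 0
      · have h3 := (hdd' z).1 h0
        simp [radialShift, h0, h3]
      · have h4 := radialShift_of_norm_eq (d' := d' z) (hdd' z).1
          (x := ε * ‖D z‖) (d := ‖D z‖) (by simp [hε])
        have h5 : (‖D z‖ : ℂ) ≠ 0 := Complex.ofReal_ne_zero.2 h0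
        apply mul_left_cancel₀ h5
        rw [h4]; ring
    change Θ₃ (Θ₂ (Θ₁ _)) = _
    rw [h1, h2]
    rfl
  have hmem : ∀ (ε : ℝ), |ε| = 1 → ∀ z ∈ Set.Icc lo hi,
      ((((hi - lo) / 2 : ℝ) : ℂ)⁻¹ * (ε * d' z), ((hi - lo) / 2)⁻¹ * (z - (lo + hi) / 2))
        ∈ verticalCircle := by
    intro ε hε z hz
    have h1 : d' z ^ 2 = (z - lo) * (hi - z) :=
      Real.sq_sqrt (mul_nonneg (sub_nonneg.2 hz.1) (sub_nonneg.2 hz.2))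
    have h2 : ε ^ 2 = 1 := by rw [← sq_abs, hε, one_pow]
    rw [← Complex.ofReal_inv, ← Complex.ofReal_mul, ← Complex.ofReal_mul]
    refine ⟨Complex.ofReal_im _, ?_⟩
    simp only [Complex.ofReal_re]
    rw [mul_pow, mul_pow, mul_pow, h1, h2]
    have h3 : hi - lo ≠ 0 := by linarith
    field_simp
    ring
  have hp : ∀ z, x (ι z) = m z + (1 : ℝ) * D z := fun z => by
    simp only [m, D]; push_cast; ring
  have hn : ∀ z, x (κ z) = m z + (-1 : ℝ) * D z := fun z => by
    simp only [m, D]; push_cast; ring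
  have himg : Θ '' (Set.range fun t => (x t, h t)) = verticalCircle := by
    apply Set.Subset.antisymm
    · rintro _ ⟨_, ⟨t, rfl⟩, rfl⟩
      have hper : Function.Periodic (fun t => (x t, h t)) 1 := fun t => Prod.ext (hxp t) (hhp t)
      obtain ⟨s, hs, e1⟩ := hper.exists_mem_Ico one_pos t t₀
      simp only at e1 ⊢
      rw [e1]
      rcases le_total s t₁ with hst | hst
      · have hs' : s ∈ Set.Icc t₀ t₁ := ⟨hs.1, hst⟩
        have e2 := hp (h s)
        rw [hι2 s hs'] at e2
        rw [hΘ 1 (by simp) (h s) _ e2]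
        exact hmem 1 (by simp) _ ⟨hmono.monotoneOn ⟨le_rfl, h01.le⟩ hs' hs.1,
          hmono.monotoneOn hs' ⟨h01.le, le_rfl⟩ hst⟩
      · have hs' : s ∈ Set.Icc t₁ (t₀ + 1) := ⟨hst, hs.2.le⟩
        have e2 := hn (h s)
        rw [hκ2 s hs'] at e2
        rw [hΘ (-1) (by simp) (h s) _ e2]
        exact hmem (-1) (by simp) _ ⟨hlo' ▸ hanti.antitoneOn hs' ⟨h10.le, le_rfl⟩ hs.2.le,
          hanti.antitoneOn ⟨le_rfl, h10.le⟩ hs' hst⟩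
    · rintro ⟨y, s⟩ ⟨h1, h2⟩
      simp only at h1 h2
      have hs : |s| ≤ 1 := abs_le_one_iff_mul_self_le_one.2 (by nlinarith [sq_nonneg y.re])
      obtain ⟨hs1, hs2⟩ := abs_le.1 hs
      set z := (hi - lo) / 2 * s + (lo + hi) / 2 with hz
      have hzm : z ∈ Set.Icc lo hi := ⟨by rw [hz]; nlinarith, by rw [hz]; nlinarith⟩
      have h3 : d' z = (hi - lo) / 2 * |y.re| := by
        simp only [d']
        rw [show (z - lo) * (hi - z) = ((hi - lo) / 2 * |y.re|) ^ 2 by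
          rw [mul_pow, sq_abs, hz]; linear_combination - ((hi - lo) / 2) ^ 2 * h2]
        exact Real.sqrt_sq (mul_nonneg (by linarith) (abs_nonneg _))
      have h4 : y = (y.re : ℂ) := Complex.ext rfl (by simpa using h1)
      have hRc : (((hi - lo) / 2 : ℝ) : ℂ) ≠ 0 := Complex.ofReal_ne_zero.2 hR
      have h5 : ((hi - lo) / 2)⁻¹ * (z - (lo + hi) / 2) = s := by
        rw [hz, add_sub_cancel_right, inv_mul_cancel_left₀ hR]
      rcases le_total 0 y.re with h6 | h6
      · refine ⟨_, ⟨ι z, rfl⟩, ?_⟩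
        simp only
        rw [hι1 z hzm, hΘ 1 (by simp) z _ (hp z), h5, h3, abs_of_nonneg h6]
        refine Prod.ext ?_ rfl
        simp only
        rw [Complex.ofReal_mul, mul_left_comm _ (((hi - lo) / 2 : ℝ) : ℂ), inv_mul_cancel_left₀ hRc, ← h4]
        simp
      · refine ⟨_, ⟨κ z, rfl⟩, ?_⟩
        simp only
        rw [hκ1 z hzm, hΘ (-1) (by simp) z _ (hn z), h5, h3, abs_of_nonpos h6]
        refine Prod.ext ?_ rfl
        simp only
        rw [Complex.ofReal_mul, mul_left_comm _ (((hi - lo) / 2 : ℝ) : ℂ), inv_mul_cancel_left₀ hRc,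
          Complex.ofReal_neg, Complex.ofReal_neg, ← h4]
        simp
  exact ⟨Θ.symm, by rw [← himg, ← Set.image_comp]; simp⟩

end ElasticKnot

namespace ElasticKnot
open Topology

/-- The vectors of the unit ball that separate `u` from `v`. -/
def separators (u v : E3) : Set E3 := Metric.ball 0 1 ∩ {e | inner ℝ u e * inner ℝ v e < 0}

theorem measurableSet_separators (u v : E3) : MeasurableSet (separators u v) := by
  refine measurableSet_ball.inter (IsOpen.measurableSet ?_)
  exact isOpen_lt (by fun_prop) continuous_const

theorem volume_separators_eq {u v w : E3} (hu : ‖u‖ = 1) (hw : ‖w‖ = 1)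
    (h : inner ℝ v (w - u) = 0) : volume (separators u v) = volume (separators v w) := by
  let A := (ℝ ∙ (u - w))ᗮ.reflection
  have hA : A u = w := Submodule.reflection_sub (by rw [hu, hw])
  have hv : A v = v := by
    refine Submodule.reflection_mem_subspace_eq_self ?_
    rw [Submodule.mem_orthogonal_singleton_iff_inner_left, ← neg_sub, inner_neg_right, h, neg_zero]
  have hp : A ⁻¹' separators v w = separators u v := by
    ext e
    have h1 : inner ℝ w (A e) = inner ℝ u e := by rw [← hA, A.inner_map_map]
    have h2 : inner ℝ v (A e) = inner ℝ v e := by nth_rw 1 [← hv]; rw [A.inner_map_map]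
    simp only [separators, Set.mem_preimage, Set.mem_inter_iff, mem_ball_zero_iff, A.norm_map,
      Set.mem_ofPred_eq, h1, h2, mul_comm]
  rw [← hp]
  exact A.measurePreserving.measure_preimage (measurableSet_separators v w).nullMeasurableSet

theorem sign_change_unique {p q : ℝ} {s₁ s₂ s₃ s₄ : ℝ} (h₁ : 0 ≤ s₁) (h₁₂ : s₁ < s₂) (h₂₃ : s₂ ≤ s₃)
    (h₃₄ : s₃ < s₄) (h₄ : s₄ ≤ Real.pi)
    (h : (Real.cos s₁ * p + Real.sin s₁ * q) * (Real.cos s₂ * p + Real.sin s₂ * q) < 0) :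
    0 ≤ (Real.cos s₃ * p + Real.sin s₃ * q) * (Real.cos s₄ * p + Real.sin s₄ * q) := by
  have key : ∀ s, s₂ ≤ s → s ≤ Real.pi →
      0 ≤ (Real.cos s * p + Real.sin s * q) * (Real.cos s₂ * p + Real.sin s₂ * q) := by
    intro s hs hs'
    have e1 : 0 < Real.sin (s₂ - s₁) :=
      Real.sin_pos_of_pos_of_lt_pi (by linarith) (by linarith [Real.pi_pos])
    have e2 : 0 ≤ Real.sin (s - s₁) :=
      Real.sin_nonneg_of_nonneg_of_le_pi (by linarith) (by linarith)
    have e3 : 0 ≤ Real.sin (s - s₂) :=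
      Real.sin_nonneg_of_nonneg_of_le_pi (by linarith) (by linarith)
    have e4 : (Real.cos s * p + Real.sin s * q) * Real.sin (s₂ - s₁) =
        (Real.cos s₂ * p + Real.sin s₂ * q) * Real.sin (s - s₁) -
        (Real.cos s₁ * p + Real.sin s₁ * q) * Real.sin (s - s₂) := by
      simp only [Real.sin_sub]
      ring
    have e5 : 0 ≤ ((Real.cos s * p + Real.sin s * q) * (Real.cos s₂ * p + Real.sin s₂ * q)) *
        Real.sin (s₂ - s₁) := by
      have h0 := mul_nonneg (sq_nonneg (Real.cos s₂ * p + Real.sin s₂ * q)) e2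
      have := mul_nonneg (neg_nonneg.2 h.le) e3
      linear_combination -(Real.cos s₂ * p + Real.sin s₂ * q) * e4 + this + h0
    exact nonneg_of_mul_nonneg_left e5 e1
  have k3 := key s₃ h₂₃ (by linarith)
  have k4 := key s₄ (by linarith) h₄
  have hne : Real.cos s₂ * p + Real.sin s₂ * q ≠ 0 := fun h0 => by rw [h0, mul_zero] at h; exact h.false
  have hsq : 0 < (Real.cos s₂ * p + Real.sin s₂ * q) ^ 2 := by positivity
  have := mul_nonneg k3 k4
  refine nonneg_of_mul_nonneg_left (b := (Real.cos s₂ * p + Real.sin s₂ * q) ^ 2) ?_ hsq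
  linear_combination this

theorem natCast_mul_volume_separators_le {p q : E3} (hp : ‖p‖ = 1) (hq : ‖q‖ = 1)
    (hpq : inner ℝ p q = 0) {δ : ℝ} (hδ : 0 < δ) {n : ℕ} (hn : n * δ ≤ Real.pi) :
    (n : ℝ≥0∞) * volume (separators p (Real.cos δ • p + Real.sin δ • q)) ≤
      volume (Metric.ball (0 : E3) 1) := by
  let c : ℝ → E3 := fun s => Real.cos s • p + Real.sin s • q
  have hcin : ∀ s t, inner ℝ (c s) (c t) = Real.cos (s - t) := fun s t => by
    have hqp : inner ℝ q p = 0 := by rw [real_inner_comm]; exact hpq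
    simp only [c, inner_add_left, inner_add_right, real_inner_smul_left, real_inner_smul_right,
      hpq, hqp, real_inner_self_eq_norm_sq, hp, hq, Real.cos_sub]
    ring
  have hcn : ∀ s, ‖c s‖ = 1 := fun s => by
    have h := hcin s s
    rw [real_inner_self_eq_norm_sq, sub_self, Real.cos_zero] at h
    exact (pow_eq_one_iff_of_nonneg (norm_nonneg _) two_ne_zero).1 h
  let W : ℕ → Set E3 := fun i => separators (c (i * δ)) (c ((i + 1 : ℕ) * δ))
  have hW : ∀ i, volume (W i) = volume (W 0) := by
    intro i
    induction i with
    | zero => rfl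
    | succ i ih =>
      rw [← ih]
      refine (volume_separators_eq (hcn _) (hcn _) ?_).symm
      rw [inner_sub_right, hcin, hcin, ← Real.cos_neg, sub_eq_zero]
      congr 1; push_cast; ring
  have hW0 : W 0 = separators p (Real.cos δ • p + Real.sin δ • q) := by simp [W, c]
  have hdisj : Set.PairwiseDisjoint (↑(Finset.range n)) W := by
    have aux : ∀ i j : ℕ, i < j → j < n → Disjoint (W i) (W j) := by
      intro i j hij hj
      rw [Set.disjoint_left]
      rintro e ⟨_, h1⟩ ⟨_, h2⟩
      simp only [Set.mem_ofPred_eq, c, inner_add_left, real_inner_smul_left] at h1 h2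
      have hij' : ((i + 1 : ℕ) : ℝ) ≤ j := by exact_mod_cast hij
      have hj' : ((j + 1 : ℕ) : ℝ) ≤ n := by exact_mod_cast hj
      refine (sign_change_unique (by positivity) ?_ ?_ ?_ ?_ h1).not_gt h2
      · push_cast; nlinarith
      · gcongr
      · push_cast; nlinarith
      · exact le_trans (by gcongr) hn
    intro i hi j hj hij
    rcases lt_or_gt_of_ne hij with h | h
    · exact aux i j h (Finset.mem_range.1 hj)
    · exact (aux j i h (Finset.mem_range.1 hi)).symm
  calc (n : ℝ≥0∞) * volume (separators p (Real.cos δ • p + Real.sin δ • q))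
      = ∑ i ∈ Finset.range n, volume (W i) := by simp [hW, hW0]
    _ = volume (⋃ i ∈ Finset.range n, W i) :=
        (measure_biUnion_finset hdisj fun i _ => measurableSet_separators _ _).symm
    _ ≤ _ := measure_mono (Set.iUnion₂_subset fun i _ => Set.inter_subset_left)

theorem volume_separators_le_angle {u v : E3} (hu : ‖u‖ = 1) (hv : ‖v‖ = 1)
    (hπ : InnerProductGeometry.angle u v < Real.pi) :
    volume (separators u v) ≤ ENNReal.ofReal (InnerProductGeometry.angle u v /
      (Real.pi - InnerProductGeometry.angle u v)) * volume (Metric.ball (0 : E3) 1) := by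
  set α := InnerProductGeometry.angle u v with hα
  have hcos : inner ℝ u v = Real.cos α := by
    have := InnerProductGeometry.cos_angle_mul_norm_mul_norm u v
    rw [hu, hv] at this; rw [hα]; linarith
  rcases (InnerProductGeometry.angle_nonneg u v).eq_or_lt with h0 | h0
  · have huv : u = v := by
      rw [← hα] at h0
      rw [← h0, Real.cos_zero] at hcos
      exact (inner_eq_one_iff_of_norm_eq_one hu hv).1 hcos
    have : separators u v = ∅ := by
      rw [huv]
      ext e
      simp only [separators, Set.mem_inter_iff, Set.mem_ofPred_eq, Set.mem_empty_iff_false, iff_false,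
        not_and, not_lt]
      exact fun _ => mul_self_nonneg _
    rw [this, measure_empty]; exact zero_le
  rw [← hα] at h0
  have hsin : 0 < Real.sin α := Real.sin_pos_of_pos_of_lt_pi h0 hπ
  let q : E3 := (Real.sin α)⁻¹ • (v - Real.cos α • u)
  have hv' : v = Real.cos α • u + Real.sin α • q := by
    simp only [q]; rw [smul_inv_smul₀ hsin.ne']; abel
  have huq : inner ℝ u q = 0 := by
    simp only [q]
    rw [real_inner_smul_right, inner_sub_right, real_inner_smul_right, real_inner_self_eq_norm_sq,
      hu, hcos]; ring
  have hq : ‖q‖ = 1 := by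
    have h1 : ‖v - Real.cos α • u‖ ^ 2 = Real.sin α ^ 2 := by
      rw [norm_sub_sq_real, norm_smul, real_inner_smul_right, real_inner_comm, hcos, hu, hv,
        Real.norm_eq_abs, mul_one, sq_abs, Real.sin_sq]; ring
    have h2 := (pow_left_inj₀ (norm_nonneg _) hsin.le two_ne_zero).1 h1
    simp only [q]
    rw [norm_smul, h2, Real.norm_eq_abs, abs_of_pos (inv_pos.2 hsin), inv_mul_cancel₀ hsin.ne']
  set n := ⌊Real.pi / α⌋₊ with hn
  have hn1 : n * α ≤ Real.pi := by
    rw [← le_div_iff₀ h0]; exact Nat.floor_le (by positivity)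
  have hn2 : Real.pi / α - 1 < n := by
    have := Nat.lt_floor_add_one (Real.pi / α); linarith
  have key := natCast_mul_volume_separators_le hu hq huq h0 hn1
  rw [← hv'] at key
  have hn3 : (Real.pi - α) / α ≤ n := by
    rw [sub_div, div_self h0.ne']; exact hn2.le
  have h3 : ENNReal.ofReal (α / (Real.pi - α)) * (n : ℝ≥0∞) ≥ 1 := by
    rw [← ENNReal.ofReal_natCast, ← ENNReal.ofReal_mul (div_nonneg h0.le (by linarith)), ge_iff_le,
      ENNReal.one_le_ofReal]
    calc 1 = α / (Real.pi - α) * ((Real.pi - α) / α) := by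
            have : Real.pi - α ≠ 0 := by linarith
            field_simp
      _ ≤ _ := mul_le_mul_of_nonneg_left hn3 (div_nonneg h0.le (by linarith))
  calc volume (separators u v) = 1 * volume (separators u v) := (one_mul _).symm
    _ ≤ ENNReal.ofReal (α / (Real.pi - α)) * n * volume (separators u v) := by gcongr
    _ = ENNReal.ofReal (α / (Real.pi - α)) * (n * volume (separators u v)) := mul_assoc _ _ _
    _ ≤ _ := by gcongr

/-- The volume of the set of vectors separating two unit vectors at small distance. -/
theorem exists_volume_separators_le {ε : ℝ} (hε : 0 < ε) :
    ∃ δ > 0, ∀ u v : E3, ‖u‖ = 1 → ‖v‖ = 1 → ‖u - v‖ < δ →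
      volume (separators u v) ≤ ENNReal.ofReal ((1 + ε) / Real.pi * ‖u - v‖) *
        volume (Metric.ball (0 : E3) 1) := by
  have hc : ContinuousAt (fun α : ℝ => (1 + ε) * (Real.pi - α) * (1 - α ^ 2 / 16)) 0 := by fun_prop
  have hlt : Real.pi < (fun α : ℝ => (1 + ε) * (Real.pi - α) * (1 - α ^ 2 / 16)) 0 := by
    simp only; nlinarith [Real.pi_pos]
  obtain ⟨r, hr, hball⟩ := Metric.eventually_nhds_iff.1 (hc.eventually_const_lt hlt)
  refine ⟨min r 1 / 2, by positivity, fun u v hu hv huv => ?_⟩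
  have hmin1 := min_le_left r 1
  have hmin2 := min_le_right r 1
  set α := InnerProductGeometry.angle u v with hα
  have hα0 : 0 ≤ α := InnerProductGeometry.angle_nonneg u v
  have hαπ : α ≤ Real.pi := InnerProductGeometry.angle_le_pi u v
  have hcos : inner ℝ u v = Real.cos α := by
    have := InnerProductGeometry.cos_angle_mul_norm_mul_norm u v
    rw [hu, hv] at this; rw [hα]; linarith
  have hchord : ‖u - v‖ = 2 * Real.sin (α / 2) := by
    have h1 : ‖u - v‖ ^ 2 = (2 * Real.sin (α / 2)) ^ 2 := by
      rw [norm_sub_sq_real, hcos, hu, hv, mul_pow, Real.sin_sq_eq_half_sub,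
        mul_div_cancel₀ α two_ne_zero]; ring
    exact (pow_left_inj₀ (norm_nonneg _)
      (mul_nonneg two_pos.le (Real.sin_nonneg_of_nonneg_of_le_pi (by linarith) (by linarith)))
      two_ne_zero).1 h1
  have hα1 : α < min r 1 := by
    have h1 := Real.mul_le_sin (x := α / 2) (by linarith) (by linarith)
    have h2 : 2 / Real.pi * (α / 2) = α / Real.pi := by ring
    rw [h2] at h1
    have h3 : α / Real.pi ≥ α / 4 := by
      gcongr; exact Real.pi_le_four
    linarith
  rcases hα0.eq_or_lt with h0 | h0
  · refine (volume_separators_le_angle hu hv (by rw [← hα]; linarith [Real.pi_pos])).trans ?_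
    rw [← hα, ← h0]; simp
  have hπα : 0 < Real.pi - α := by linarith [Real.pi_gt_three]
  refine (volume_separators_le_angle hu hv (by linarith)).trans ?_
  gcongr
  rw [← hα, div_le_iff₀ hπα]
  have h1 := Real.sin_gt_sub_cube (x := α / 2) (by linarith)
  have h2 : α * (1 - α ^ 2 / 16) ≤ ‖u - v‖ := by rw [hchord]; nlinarith [pow_pos h0 3]
  have h3 := hball (y := α) (by rw [Real.dist_eq, sub_zero, abs_of_pos h0]; linarith)
  calc α = Real.pi * α / Real.pi := by field_simp
    _ ≤ (1 + ε) * (Real.pi - α) * (1 - α ^ 2 / 16) * α / Real.pi := by gcongr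
    _ = (1 + ε) / Real.pi * (α * (1 - α ^ 2 / 16)) * (Real.pi - α) := by ring
    _ ≤ _ := by gcongr

end ElasticKnot

namespace ElasticKnot
open Topology

theorem exists_sign_change {s : ℕ → ℝ} {a b : ℕ} (hab : a ≤ b) (hs : ∀ i, s i ≠ 0)
    (h : s a * s b < 0) : ∃ i ∈ Finset.Ico a b, s i * s (i + 1) < 0 := by
  induction b, hab using Nat.le_induction with
  | base => exact absurd h (mul_self_nonneg _).not_gt
  | succ b hab ih =>
    by_cases hb : s a * s b < 0
    · obtain ⟨i, hi, h'⟩ := ih hb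
      rw [Finset.mem_Ico] at hi
      exact ⟨i, Finset.mem_Ico.2 ⟨hi.1, by omega⟩, h'⟩
    · have hb' : 0 < s a * s b := lt_of_le_of_ne (not_lt.1 hb) (mul_ne_zero (hs a) (hs b)).symm
      refine ⟨b, Finset.mem_Ico.2 ⟨hab, by omega⟩, ?_⟩
      have h1 : (s a) ^ 2 * (s b * s (b + 1)) < 0 := by
        have := mul_neg_of_pos_of_neg hb' h
        linarith
      exact not_le.1 fun hc => h1.not_ge (mul_nonneg (sq_nonneg _) hc)

/-- The number of sign changes of a function on the circle at dyadic points. -/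
noncomputable def signChanges (f : ℝ → ℝ) (k : ℕ) : ℕ :=
  ∑ i ∈ Finset.range (2 ^ k), if f (i / 2 ^ k) * f ((i + 1 : ℕ) / 2 ^ k) < 0 then 1 else 0

theorem sum_range_two_mul (g : ℕ → ℕ) (n : ℕ) :
    ∑ i ∈ Finset.range (2 * n), g i = ∑ i ∈ Finset.range n, (g (2 * i) + g (2 * i + 1)) := by
  induction n with
  | zero => simp
  | succ n ih =>
    rw [mul_add, mul_one, Finset.sum_range_succ, Finset.sum_range_succ, ih, Finset.sum_range_succ,
      add_assoc]

theorem monotone_signChanges {f : ℝ → ℝ} (hf : ∀ k i : ℕ, f (i / 2 ^ k) ≠ 0) :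
    Monotone (signChanges f) := by
  refine monotone_nat_of_le_succ fun k => ?_
  simp only [signChanges]
  rw [pow_succ' 2 k, sum_range_two_mul]
  refine Finset.sum_le_sum fun i _ => ?_
  have e1 : (((2 * i : ℕ) : ℝ) / 2 ^ (k + 1)) = i / 2 ^ k := by
    push_cast; rw [pow_succ]; field_simp
  have e2 : (((2 * i + 1 + 1 : ℕ) : ℝ) / 2 ^ (k + 1)) = (i + 1 : ℕ) / 2 ^ k := by
    push_cast; rw [pow_succ]; field_simp; ring
  rw [e1, e2]
  have h0 := hf (k + 1) (2 * i + 1)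
  set x := f (i / 2 ^ k)
  set y := f ((2 * i + 1 : ℕ) / 2 ^ (k + 1))
  set z := f ((i + 1 : ℕ) / 2 ^ k)
  by_cases hxz : x * z < 0
  · by_cases hxy : x * y < 0
    · simp [hxz, hxy]
    · have hyz : y * z < 0 := by
        have hx : x ≠ 0 := fun h => by simp [h] at hxz
        have hxy' : 0 < x * y := lt_of_le_of_ne (not_lt.1 hxy) (mul_ne_zero hx h0).symm
        have h1 : x ^ 2 * (y * z) < 0 := by
          have := mul_neg_of_pos_of_neg hxy' hxz
          linarith
        exact not_le.1 fun hc => h1.not_ge (mul_nonneg (sq_nonneg _) hc)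
      simp [hxz, hyz]
  · simp [hxz]

/-- A function on the circle with at most three sign changes does not alternate. -/
theorem not_alternating {f : ℝ → ℝ} (hfc : Continuous f) (hfp : Function.Periodic f 1)
    (hf : ∀ k i : ℕ, f (i / 2 ^ k) ≠ 0) (hS : ∀ k, signChanges f k ≤ 3) {p₁ p₂ p₃ p₄ : ℝ}
    (h₁₂ : p₁ < p₂) (h₂₃ : p₂ < p₃) (h₃₄ : p₃ < p₄) (h₄₁ : p₄ < p₁ + 1)
    (h₁ : 0 < f p₁) (h₂ : f p₂ < 0) (h₃ : 0 < f p₃) (h₄ : f p₄ < 0) : False := by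
  wlog hp : 0 ≤ p₁ generalizing p₁ p₂ p₃ p₄
  · obtain ⟨n, hn⟩ := exists_nat_ge (-p₁)
    have hper : ∀ x, f (x + n) = f x := fun x => by simpa using hfp.nat_mul n x
    exact this (p₁ := p₁ + n) (p₂ := p₂ + n) (p₃ := p₃ + n) (p₄ := p₄ + n) (by linarith)
      (by linarith) (by linarith) (by linarith) (by rwa [hper]) (by rwa [hper]) (by rwa [hper])
      (by rwa [hper]) (by linarith)
  have hlim : ∀ p : ℝ, 0 ≤ p →
      Filter.Tendsto (fun k : ℕ => f ((⌊p * 2 ^ k⌋₊ : ℝ) / 2 ^ k)) Filter.atTop (𝓝 (f p)) :=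
    fun p hp => (hfc.tendsto p).comp ((tendsto_nat_floor_mul_div_atTop hp).comp
      (tendsto_pow_atTop_atTop_of_one_lt (one_lt_two : (1 : ℝ) < 2)))
  obtain ⟨k, ⟨e₁, e₂⟩, e₃, e₄⟩ := (((hlim p₁ hp).eventually_const_lt h₁).and
    ((hlim p₂ (by linarith)).eventually_lt_const h₂)).and
    (((hlim p₃ (by linarith)).eventually_const_lt h₃).and
    ((hlim p₄ (by linarith)).eventually_lt_const h₄)) |>.exists
  let s : ℕ → ℝ := fun i => f (i / 2 ^ k)
  have hsp : Function.Periodic s (2 ^ k) := fun i => by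
    simp only [s]; push_cast
    rw [add_div, div_self (by positivity), hfp]
  set i₁ := ⌊p₁ * 2 ^ k⌋₊
  set i₂ := ⌊p₂ * 2 ^ k⌋₊
  set i₃ := ⌊p₃ * 2 ^ k⌋₊
  set i₄ := ⌊p₄ * 2 ^ k⌋₊
  have l₁ : i₁ ≤ i₂ := Nat.floor_le_floor (by gcongr)
  have l₂ : i₂ ≤ i₃ := Nat.floor_le_floor (by gcongr)
  have l₃ : i₃ ≤ i₄ := Nat.floor_le_floor (by gcongr)
  have l₄ : i₄ ≤ i₁ + 2 ^ k := by
    have : ⌊p₁ * 2 ^ k + (2 ^ k : ℕ)⌋₊ = i₁ + 2 ^ k := Nat.floor_add_natCast (by positivity) _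
    rw [← this]
    refine Nat.floor_le_floor ?_
    push_cast
    calc p₄ * 2 ^ k ≤ (p₁ + 1) * 2 ^ k := by gcongr
      _ = _ := by ring
  have e₅ : 0 < s (i₁ + 2 ^ k) := by rw [hsp]; exact e₁
  obtain ⟨j₁, hj₁, c₁⟩ := exists_sign_change l₁ (hf k) (mul_neg_of_pos_of_neg e₁ e₂)
  obtain ⟨j₂, hj₂, c₂⟩ := exists_sign_change l₂ (hf k) (mul_neg_of_neg_of_pos e₂ e₃)
  obtain ⟨j₃, hj₃, c₃⟩ := exists_sign_change l₃ (hf k) (mul_neg_of_pos_of_neg e₃ e₄)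
  obtain ⟨j₄, hj₄, c₄⟩ := exists_sign_change l₄ (hf k) (mul_neg_of_neg_of_pos e₄ e₅)
  rw [Finset.mem_Ico] at hj₁ hj₂ hj₃ hj₄
  have hcard : 4 ≤ signChanges f k := by
    rw [signChanges, ← Finset.card_filter, ← Nat.count_eq_card_filter_range]
    have hper : Function.Periodic (fun i : ℕ => s i * s (i + 1) < 0) (2 ^ k) := fun i => by
      simp only [hsp i, add_right_comm i (2 ^ k) 1, hsp (i + 1)]
    rw [← Nat.filter_Ico_card_eq_of_periodic i₁ (2 ^ k) (fun i : ℕ => s i * s (i + 1) < 0) hper]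
    have h4 : ({j₁, j₂, j₃, j₄} : Finset ℕ).card = 4 := by
      rw [Finset.card_insert_of_notMem, Finset.card_insert_of_notMem, Finset.card_pair (by omega)] <;>
        simp only [Finset.mem_insert, Finset.mem_singleton] <;> omega
    rw [← h4]
    refine Finset.card_le_card fun j hj => ?_
    simp only [Finset.mem_insert, Finset.mem_singleton] at hj
    rw [Finset.mem_filter, Finset.mem_Ico]
    rcases hj with rfl | rfl | rfl | rfl
    · exact ⟨by omega, c₁⟩
    · exact ⟨by omega, c₂⟩
    · exact ⟨by omega, c₃⟩
    · exact ⟨by omega, c₄⟩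
  have := hS k
  omega

/-- A height function whose derivative does not alternate has one maximum and one minimum. -/
theorem exists_monotone_arcs {h f : ℝ → ℝ} (hh : ∀ t, HasDerivAt h (f t) t) 
    (hhp : Function.Periodic h 1) (hd : Dense {t | f t ≠ 0})
    (halt : ∀ p₁ p₂ p₃ p₄, p₁ < p₂ → p₂ < p₃ → p₃ < p₄ → p₄ < p₁ + 1 →
      0 < f p₁ → f p₂ < 0 → 0 < f p₃ → f p₄ < 0 → False) :
    ∃ t₀ t₁, t₀ < t₁ ∧ t₁ < t₀ + 1 ∧ StrictMonoOn h (Set.Icc t₀ t₁) ∧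
      StrictAntiOn h (Set.Icc t₁ (t₀ + 1)) ∧ f t₀ = 0 ∧ f t₁ = 0 := by
  have hhc : Continuous h := continuous_iff_continuousAt.2 fun t => (hh t).continuousAt
  have hfp : Function.Periodic f 1 := fun t => by
    have h1 := (hh (t + 1)).comp_add_const t 1
    rw [funext hhp] at h1
    exact h1.unique (hh t)
  -- monotonicity on intervals where the derivative has a sign
  have hmono : ∀ a b, (∀ t ∈ Set.Ioo a b, 0 ≤ f t) → StrictMonoOn h (Set.Icc a b) := by
    intro a b hab x hx y hy hxy
    have hm : MonotoneOn h (Set.Icc a b) := by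
      refine monotoneOn_of_deriv_nonneg (convex_Icc a b) hhc.continuousOn
        (fun t _ => (hh t).differentiableAt.differentiableWithinAt) fun t ht => ?_
      rw [interior_Icc] at ht
      rw [(hh t).deriv]; exact hab t ht
    refine lt_of_le_of_ne (hm hx hy hxy.le) fun heq => ?_
    obtain ⟨z, hz, hz'⟩ := hd.exists_between hxy
    refine hz ?_
    have hconst : h =ᶠ[𝓝 z] fun _ => h x := by
      filter_upwards [Ioo_mem_nhds hz'.1 hz'.2] with w hw
      have hw' : w ∈ Set.Icc a b := ⟨hx.1.trans hw.1.le, hw.2.le.trans hy.2⟩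
      exact le_antisymm (heq ▸ hm hw' hy hw.2.le) (hm hx hw' hw.1.le)
    exact (hh z).unique ((hasDerivAt_const z (h x)).congr_of_eventuallyEq hconst)
  have hanti : ∀ a b, (∀ t ∈ Set.Ioo a b, f t ≤ 0) → StrictAntiOn h (Set.Icc a b) := by
    intro a b hab x hx y hy hxy
    have hm : AntitoneOn h (Set.Icc a b) := by
      refine antitoneOn_of_deriv_nonpos (convex_Icc a b) hhc.continuousOn
        (fun t _ => (hh t).differentiableAt.differentiableWithinAt) fun t ht => ?_
      rw [interior_Icc] at ht
      rw [(hh t).deriv]; exact hab t ht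
    refine lt_of_le_of_ne (hm hx hy hxy.le) fun heq => ?_
    obtain ⟨z, hz, hz'⟩ := hd.exists_between hxy
    refine hz ?_
    have hconst : h =ᶠ[𝓝 z] fun _ => h x := by
      filter_upwards [Ioo_mem_nhds hz'.1 hz'.2] with w hw
      have hw' : w ∈ Set.Icc a b := ⟨hx.1.trans hw.1.le, hw.2.le.trans hy.2⟩
      exact le_antisymm (hm hx hw' hw.1.le) (heq ▸ hm hw' hy hw.2.le)
    exact (hh z).unique ((hasDerivAt_const z (h x)).congr_of_eventuallyEq hconst)
  -- the extrema
  obtain ⟨t₀, -, hmin⟩ := isCompact_Icc.exists_isMinOn (s := Set.Icc (0 : ℝ) 1)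
    (Set.nonempty_Icc.2 zero_le_one) hhc.continuousOn
  have hmin' : ∀ t, h t₀ ≤ h t := fun t => by
    obtain ⟨s, hs, e⟩ := hhp.exists_mem_Ico₀ one_pos t
    rw [e]; exact hmin ⟨hs.1, hs.2.le⟩
  obtain ⟨t₁, ht₁, hmax⟩ := isCompact_Icc.exists_isMaxOn (s := Set.Icc t₀ (t₀ + 1))
    (Set.nonempty_Icc.2 (by linarith)) hhc.continuousOn
  have hmax' : ∀ t, h t ≤ h t₁ := fun t => by
    obtain ⟨s, hs, e⟩ := hhp.exists_mem_Ico one_pos t t₀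
    rw [e]; exact hmax ⟨hs.1, hs.2.le⟩
  have hf₀ : f t₀ = 0 :=
    IsLocalMin.hasDerivAt_eq_zero (Filter.Eventually.of_forall hmin') (hh t₀)
  have hf₁ : f t₁ = 0 :=
    IsLocalMax.hasDerivAt_eq_zero (Filter.Eventually.of_forall hmax') (hh t₁)
  have hlt : h t₀ < h t₁ := by
    refine lt_of_le_of_ne (hmin' t₁) fun heq => ?_
    obtain ⟨z, hz⟩ := hd.nonempty
    refine hz (IsLocalMin.hasDerivAt_eq_zero (Filter.Eventually.of_forall fun t => ?_) (hh z))
    exact (hmax' z).trans (heq ▸ hmin' t)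
  have h01 : t₀ < t₁ := lt_of_le_of_ne ht₁.1 fun e => by rw [e] at hlt; exact hlt.false
  have h10 : t₁ < t₀ + 1 := lt_of_le_of_ne ht₁.2 fun e => by rw [e, hhp] at hlt; exact hlt.false
  -- mean value theorem
  have hpos : ∀ a b, a < b → h a < h b → ∃ t ∈ Set.Ioo a b, 0 < f t := fun a b hab hlt => by
    obtain ⟨c, hc, e⟩ := exists_hasDerivAt_eq_slope h f hab hhc.continuousOn fun t _ => hh t
    exact ⟨c, hc, by rw [e]; exact div_pos (sub_pos.2 hlt) (sub_pos.2 hab)⟩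
  have hneg : ∀ a b, a < b → h b < h a → ∃ t ∈ Set.Ioo a b, f t < 0 := fun a b hab hlt => by
    obtain ⟨c, hc, e⟩ := exists_hasDerivAt_eq_slope h f hab hhc.continuousOn fun t _ => hh t
    exact ⟨c, hc, by rw [e]; exact div_neg_of_neg_of_pos (sub_neg.2 hlt) (sub_pos.2 hab)⟩
  have hstep : ∀ w, f w ≠ 0 → h t₀ < h w ∧ h w < h t₁ := fun w hw =>
    ⟨lt_of_le_of_ne (hmin' w) fun e => hw (IsLocalMin.hasDerivAt_eq_zero
      (Filter.Eventually.of_forall fun t => e ▸ hmin' t) (hh w)),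
    lt_of_le_of_ne (hmax' w) fun e => hw (IsLocalMax.hasDerivAt_eq_zero
      (Filter.Eventually.of_forall fun t => e ▸ hmax' t) (hh w))⟩
  refine ⟨t₀, t₁, h01, h10, hmono _ _ fun w hw => ?_, hanti _ _ fun w hw => ?_, hf₀, hf₁⟩
  · by_contra! hneg'
    obtain ⟨s1, s2⟩ := hstep w hneg'.ne
    obtain ⟨a, ha, fa⟩ := hpos t₀ w hw.1 s1
    obtain ⟨b, hb, fb⟩ := hpos w t₁ hw.2 s2
    obtain ⟨c, hc, fc⟩ := hneg t₁ (t₀ + 1) h10 (by rw [hhp]; exact hlt)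
    exact halt a w b c ha.2 hb.1 (hb.2.trans hc.1) (by linarith [ha.1, hc.2]) fa hneg' fb fc
  · by_contra! hpos'
    obtain ⟨s1, s2⟩ := hstep w hpos'.ne'
    obtain ⟨a, ha, fa⟩ := hpos t₀ t₁ h01 hlt
    obtain ⟨b, hb, fb⟩ := hneg t₁ w hw.1 s2
    obtain ⟨c, hc, fc⟩ := hneg w (t₀ + 1) hw.2 (by rw [hhp]; exact s1)
    exact halt a b w c (ha.2.trans hb.1) hb.2 hc.1 (by linarith [ha.1, hc.2]) fa fb hpos' fc

end ElasticKnot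

namespace ElasticKnot
open Topology

theorem volume_inner_eq_zero {u : E3} (hu : u ≠ 0) : volume {e : E3 | inner ℝ u e = 0} = 0 := by
  have h : {e : E3 | inner ℝ u e = 0} = ((ℝ ∙ u)ᗮ : Submodule ℝ E3) := by
    ext e
    exact Submodule.mem_orthogonal_singleton_iff_inner_right.symm
  rw [h]
  refine Measure.addHaar_submodule _ _ fun htop => hu ?_
  have : u ∈ (ℝ ∙ u)ᗮ := by rw [htop]; trivial
  rw [Submodule.mem_orthogonal_singleton_iff_inner_right] at this
  exact inner_self_eq_zero.1 this

/-- For a closed curve on the unit sphere that is shorter than `4π` there is a great circle that is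
crossed at most three times. -/
theorem exists_signChanges_le {T : ℝ → E3} {V : ℝ → ℝ} (hT : Continuous T) (hTn : ∀ t, ‖T t‖ = 1)
    (hV : ∀ s t, s ≤ t → ‖T t - T s‖ ≤ V t - V s) (hV1 : V 1 - V 0 < 4 * Real.pi) :
    ∃ e : E3, (∀ k i : ℕ, inner ℝ (T (i / 2 ^ k)) e ≠ 0) ∧
      ∀ k, signChanges (fun t => inner ℝ (T t) e) k ≤ 3 := by
  let B := Metric.ball (0 : E3) 1
  have hB0 : volume B ≠ 0 := (Metric.measure_ball_pos volume 0 one_pos).ne'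
  have hBt : volume B ≠ ⊤ := measure_ball_lt_top.ne
  have hVpos : 0 ≤ V 1 - V 0 := (norm_nonneg _).trans (hV 0 1 zero_le_one)
  obtain ⟨ε, hε, hε1⟩ : ∃ ε > 0, (1 + ε) * (V 1 - V 0) < 4 * Real.pi := by
    have hc : ContinuousAt (fun ε : ℝ => (1 + ε) * (V 1 - V 0)) 0 := by fun_prop
    have := (hc.eventually_lt_const (by simpa using hV1 : (1 + (0:ℝ)) * (V 1 - V 0) < 4 * Real.pi))
    obtain ⟨r, hr, hball⟩ := Metric.eventually_nhds_iff.1 this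
    exact ⟨r / 2, by positivity, hball (by
      rw [Real.dist_eq, sub_zero, abs_of_pos (by positivity)]; linarith)⟩
  obtain ⟨δ, hδ, hsep⟩ := exists_volume_separators_le hε
  let N : Set E3 := ⋃ (k : ℕ) (i : ℕ), {e | inner ℝ (T (i / 2 ^ k)) e = 0}
  have hN : volume N = 0 := measure_iUnion_null fun k => measure_iUnion_null fun i =>
    volume_inner_eq_zero (norm_ne_zero_iff.1 (by rw [hTn]; norm_num))
  have hNmem : ∀ e ∉ N, ∀ k i : ℕ, inner ℝ (T (i / 2 ^ k)) e ≠ 0 := fun e he k i h0 =>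
    he (Set.mem_iUnion₂.2 ⟨k, i, h0⟩)
  let bad : ℕ → Set E3 := fun k => {e | e ∈ B ∧ 4 ≤ signChanges (fun t => inner ℝ (T t) e) k} \ N
  have hbadm : Monotone bad := fun k l hkl e he =>
    ⟨⟨he.1.1, he.1.2.trans (monotone_signChanges (hNmem e he.2) hkl)⟩, he.2⟩
  set c : ℝ := (1 + ε) / Real.pi * (V 1 - V 0) / 4 with hc
  have hc1 : c < 1 := by
    rw [hc, div_lt_one (by norm_num), div_mul_eq_mul_div, div_lt_iff₀ Real.pi_pos]; exact hε1
  have hc0 : 0 ≤ c := by positivity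
  -- the estimate on fine grids
  have hfine : ∀ᶠ k : ℕ in Filter.atTop, volume (bad k) ≤ ENNReal.ofReal c * volume B := by
    obtain ⟨η, hη, hunif⟩ := Metric.uniformContinuousOn_iff.1
      (isCompact_Icc.uniformContinuousOn_of_continuous (hT.continuousOn (s := Set.Icc 0 1))) δ hδ
    filter_upwards [(tendsto_pow_atTop_atTop_of_one_lt (one_lt_two : (1 : ℝ) < 2)).eventually_gt_atTop
      (1 / η)] with k hk
    have hk' : 1 / (2 : ℝ) ^ k < η := by
      rw [div_lt_iff₀ (by positivity)]; rw [div_lt_iff₀ hη] at hk; linarith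
    let W : ℕ → Set E3 := fun i => separators (T (i / 2 ^ k)) (T ((i + 1 : ℕ) / 2 ^ k))
    have hWm : ∀ i, MeasurableSet (W i) := fun i => measurableSet_separators _ _
    have hstep : ∀ i : ℕ, ((i + 1 : ℕ) : ℝ) / 2 ^ k = i / 2 ^ k + 1 / 2 ^ k := fun i => by
      push_cast; ring
    have hW : ∀ i ∈ Finset.range (2 ^ k), volume (W i) ≤ ENNReal.ofReal ((1 + ε) / Real.pi *
        (V ((i + 1 : ℕ) / 2 ^ k) - V (i / 2 ^ k))) * volume B := fun i hi => by
      have hi1 : ((i + 1 : ℕ) : ℝ) ≤ 2 ^ k := by exact_mod_cast Finset.mem_range.1 hi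
      have hi0 : (0 : ℝ) ≤ i / 2 ^ k := by positivity
      have hp : (0 : ℝ) < 1 / 2 ^ k := by positivity
      have hi2 : ((i + 1 : ℕ) : ℝ) / 2 ^ k ≤ 1 := (div_le_one (by positivity)).2 hi1
      have hlt : ‖T (i / 2 ^ k) - T ((i + 1 : ℕ) / 2 ^ k)‖ < δ := by
        rw [← dist_eq_norm]
        refine hunif _ ⟨hi0, by linarith [hstep i]⟩ _ ⟨by positivity, hi2⟩ ?_
        rw [hstep, Real.dist_eq, sub_add_cancel_left, abs_neg, abs_of_pos hp]
        exact hk'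
      refine (hsep _ _ (hTn _) (hTn _) hlt).trans ?_
      gcongr
      rw [norm_sub_rev]
      exact hV _ _ (by linarith [hstep i])
    have hsum : ∑ i ∈ Finset.range (2 ^ k), volume (W i) ≤ ENNReal.ofReal (4 * c) * volume B := by
      refine (Finset.sum_le_sum hW).trans ?_
      rw [← Finset.sum_mul, ← ENNReal.ofReal_sum_of_nonneg, ← Finset.mul_sum,
        Finset.sum_range_sub (fun i : ℕ => V (i / 2 ^ k))]
      · refine le_of_eq ?_
        congr 2
        rw [hc]
        push_cast
        rw [div_self (by positivity), zero_div]; ring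
      · intro i _
        refine mul_nonneg (by positivity) ((norm_nonneg _).trans (hV _ _ ?_))
        rw [hstep]; linarith [show (0 : ℝ) < 1 / 2 ^ k by positivity]
    have hmark := mul_meas_ge_le_lintegral (μ := volume)
      (f := fun e => ∑ i ∈ Finset.range (2 ^ k), (W i).indicator (fun _ => (1 : ℝ≥0∞)) e)
      (Finset.measurable_fun_sum _ fun i _ => measurable_const.indicator (hWm i)) 4
    rw [lintegral_finsetSum _ fun i _ =>
      measurable_const.indicator (hWm i)] at hmark
    have hind : ∀ i, ∫⁻ e, (W i).indicator (fun _ => (1 : ℝ≥0∞)) e = volume (W i) := fun i =>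
      (lintegral_indicator_const (hWm i) 1).trans (one_mul _)
    rw [Finset.sum_congr rfl fun i _ => hind i] at hmark
    have hsub : bad k ⊆ {e | 4 ≤ ∑ i ∈ Finset.range (2 ^ k), (W i).indicator (fun _ => (1 : ℝ≥0∞)) e} := by
      rintro e ⟨⟨he, h4⟩, -⟩
      have : ((signChanges (fun t => inner ℝ (T t) e) k : ℕ) : ℝ≥0∞) =
          ∑ i ∈ Finset.range (2 ^ k), (W i).indicator (fun _ => (1 : ℝ≥0∞)) e := by
        rw [signChanges, Nat.cast_sum]
        refine Finset.sum_congr rfl fun i _ => ?_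
        by_cases hi : inner ℝ (T (i / 2 ^ k)) e * inner ℝ (T ((i + 1 : ℕ) / 2 ^ k)) e < 0
        · rw [if_pos hi, Set.indicator_of_mem (show e ∈ W i from ⟨he, hi⟩), Nat.cast_one]
        · rw [if_neg hi, Set.indicator_of_notMem (fun h : e ∈ W i => hi h.2), Nat.cast_zero]
      rw [Set.mem_ofPred_eq, ← this]
      exact_mod_cast h4
    have h4 : 4 * volume (bad k) ≤ 4 * (ENNReal.ofReal c * volume B) := by
      calc 4 * volume (bad k) ≤ _ := by gcongr
        _ ≤ _ := hmark
        _ ≤ _ := hsum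
        _ = _ := by rw [ENNReal.ofReal_mul (by norm_num), mul_assoc]; simp
    exact (ENNReal.mul_le_mul_iff_right (by norm_num) (by norm_num)).1 h4
  have hall : volume (⋃ k, bad k) ≤ ENNReal.ofReal c * volume B := by
    rw [hbadm.measure_iUnion]
    refine iSup_le fun k => ?_
    obtain ⟨l, hl, hl'⟩ := (hfine.and (Filter.eventually_ge_atTop k)).exists
    exact (measure_mono (hbadm hl')).trans hl
  have hlt : volume ((⋃ k, bad k) ∪ N) < volume B := by
    refine (measure_union_le _ _).trans_lt ?_
    rw [hN, add_zero]
    refine hall.trans_lt ?_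
    calc ENNReal.ofReal c * volume B < 1 * volume B := by
          rw [ENNReal.mul_lt_mul_iff_left hB0 hBt]
          exact (ENNReal.ofReal_lt_one).2 hc1
      _ = _ := one_mul _
  obtain ⟨e, heB, he⟩ := Set.not_subset.1 fun hsub => (measure_mono hsub).not_gt hlt
  rw [Set.mem_union, not_or] at he
  refine ⟨e, hNmem e he.2, fun k => ?_⟩
  by_contra! hk
  exact he.1 (Set.mem_iUnion.2 ⟨k, ⟨heB, hk⟩, he.2⟩)

theorem dense_of_dyadic {f : ℝ → ℝ} (hfp : Function.Periodic f 1)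
    (hf : ∀ k i : ℕ, f (i / 2 ^ k) ≠ 0) : Dense {t | f t ≠ 0} := by
  rw [dense_iff_exists_between]
  intro a b hab
  obtain ⟨n, hn⟩ := exists_nat_ge (-a)
  have hlim := ((tendsto_nat_floor_mul_div_atTop (a := (a + b) / 2 + n) (by linarith)).comp
      (tendsto_pow_atTop_atTop_of_one_lt (one_lt_two : (1 : ℝ) < 2)))
  obtain ⟨k, hk⟩ := (hlim.eventually_mem (Ioo_mem_nhds (a := a + n) (b := b + n) (by linarith)
    (by linarith))).exists
  refine ⟨((⌊((a + b) / 2 + n) * 2 ^ k⌋₊ : ℝ) / 2 ^ k) - n, ?_, ?_, ?_⟩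
  · have : f ((⌊((a + b) / 2 + n) * 2 ^ k⌋₊ : ℝ) / 2 ^ k - n) =
        f ((⌊((a + b) / 2 + n) * 2 ^ k⌋₊ : ℝ) / 2 ^ k) := by
      simpa using hfp.sub_nat_mul_eq n
    rw [Set.mem_ofPred_eq, this]; exact hf _ _
  · have := hk.1; simp only [Function.comp_apply] at this; linarith
  · have := hk.2; simp only [Function.comp_apply] at this; linarith

end ElasticKnot

namespace ElasticKnot
open Topology

theorem volume_unitAddCircle : (volume : Measure UnitAddCircle) = AddCircle.haarAddCircle := by
  rw [AddCircle.volume_eq_smul_haarAddCircle]; simp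

theorem ae_eq_zero_of_fourier {h : UnitAddCircle → ℂ} (hh : MemLp h 2 volume)
    (h0 : ∀ n : ℤ, ∫ x, fourier n x * h x = 0) : h =ᵐ[volume] 0 := by
  have hh' : MemLp h 2 AddCircle.haarAddCircle := hh.haarAddCircle
  have hc : ∀ n, fourierCoeff (hh'.toLp h) n = 0 := fun n => by
    rw [← h0 (-n), fourierCoeff, volume_unitAddCircle]
    refine integral_congr_ae ?_
    filter_upwards [hh'.coeFn_toLp] with x hx
    rw [hx, smul_eq_mul]
  have := hasSum_fourier_series_L2 (hh'.toLp h)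
  simp only [hc, zero_smul] at this
  have hz : hh'.toLp h = 0 := this.unique hasSum_zero
  rw [volume_unitAddCircle]
  have h2 := hh'.coeFn_toLp
  rw [hz] at h2
  exact h2.symm.trans (Lp.coeFn_zero _ _ _)

/-- `φ` is a smooth test function on the circle, with derivative `φ'`. -/
def IsTest (φ φ' : UnitAddCircle → ℝ) : Prop :=
  ContDiff ℝ ∞ (fun t : ℝ => φ (t : UnitAddCircle)) ∧
    ∀ t : ℝ, HasDerivAt (fun s : ℝ => φ (s : UnitAddCircle)) (φ' (t : UnitAddCircle)) t

theorem fourier_coe_eq (n : ℤ) (t : ℝ) :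
    fourier n (t : UnitAddCircle) = Complex.exp (2 * Real.pi * Complex.I * n * t) := by
  rw [fourier_coe_apply]; simp

theorem contDiff_fourier (n : ℤ) : ContDiff ℝ ∞ fun t : ℝ => fourier n (t : UnitAddCircle) := by
  simp only [fourier_coe_eq]
  exact (contDiff_const.mul Complex.ofRealCLM.contDiff).cexp

theorem hasDerivAt_fourier_primitive {n : ℤ} (hn : n ≠ 0) (t : ℝ) :
    HasDerivAt (fun t : ℝ => (2 * Real.pi * Complex.I * n)⁻¹ * fourier n (t : UnitAddCircle))
      (fourier n (t : UnitAddCircle)) t := by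
  have hn' : (n : ℂ) ≠ 0 := by exact_mod_cast hn
  have hpi : (Real.pi : ℂ) ≠ 0 := by exact_mod_cast Real.pi_ne_zero
  have := (hasDerivAt_fourier 1 n t).const_mul (2 * Real.pi * Complex.I * n : ℂ)⁻¹
  rwa [← mul_assoc, Complex.ofReal_one, div_one, inv_mul_cancel₀ (by simp [hn', hpi]),
    one_mul] at this

theorem ae_eq_const_of_integral_test {h : UnitAddCircle → ℝ} (hh : MemLp h 2 volume)
    (h0 : ∀ φ φ', IsTest φ φ' → ∫ x, φ' x * h x = 0) : ∃ c, h =ᵐ[volume] fun _ => c := by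
  have hp : IsProbabilityMeasure (volume : Measure UnitAddCircle) := by
    rw [volume_unitAddCircle]; infer_instance
  have hi : Integrable h := hh.integrable (by norm_num)
  have hic : Integrable fun x => (h x : ℂ) := hi.ofReal
  have hfi : ∀ n : ℤ, Integrable fun x => fourier n x * (h x : ℂ) := fun n => by
    refine hic.bdd_mul (c := 1) (fourier n).continuous.aestronglyMeasurable ?_
    filter_upwards with x
    rw [fourier_apply, Circle.norm_coe]
  have key : ∀ n : ℤ, n ≠ 0 → ∫ x, fourier n x * (h x : ℂ) = 0 := by
    intro n hn
    have hcd : ContDiff ℝ ∞ fun t : ℝ =>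
        (2 * Real.pi * Complex.I * n)⁻¹ * fourier n (t : UnitAddCircle) :=
      contDiff_const.mul (contDiff_fourier n)
    have hd : ∀ t : ℝ, HasDerivAt (fun t : ℝ =>
        (2 * Real.pi * Complex.I * n)⁻¹ * fourier n (t : UnitAddCircle))
          (fourier n (t : UnitAddCircle)) t := fun t => by
      exact hasDerivAt_fourier_primitive hn t
    have hint : Integrable fun x => fourier n x * (h x : ℂ) := hfi n
    have hre := h0 (fun x => Complex.re ((2 * Real.pi * Complex.I * n)⁻¹ * fourier n x))
      (fun x => (fourier n x).re)
      ⟨Complex.reCLM.contDiff.comp hcd, fun t => Complex.reCLM.hasFDerivAt.comp_hasDerivAt t (hd t)⟩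
    have him := h0 (fun x => Complex.im ((2 * Real.pi * Complex.I * n)⁻¹ * fourier n x))
      (fun x => (fourier n x).im)
      ⟨Complex.imCLM.contDiff.comp hcd, fun t => Complex.imCLM.hasFDerivAt.comp_hasDerivAt t (hd t)⟩
    apply Complex.ext
    · rw [Complex.zero_re, ← hre]
      refine (Complex.reCLM.integral_comp_comm hint).symm.trans ?_
      simp
    · rw [Complex.zero_im, ← him]
      refine (Complex.imCLM.integral_comp_comm hint).symm.trans ?_
      simp
  have hf0 : ∀ n : ℤ, n ≠ 0 → ∫ x : UnitAddCircle, fourier n x = 0 := fun n hn => by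
    rw [← UnitAddCircle.intervalIntegral_preimage 0]
    have hd : ∀ t : ℝ, HasDerivAt (fun t : ℝ =>
        (2 * Real.pi * Complex.I * n)⁻¹ * fourier n (t : UnitAddCircle))
          (fourier n (t : UnitAddCircle)) t := fun t => by
      exact hasDerivAt_fourier_primitive hn t
    rw [intervalIntegral.integral_eq_sub_of_hasDerivAt (fun t _ => hd t)
      ((contDiff_fourier n).continuous.intervalIntegrable _ _)]
    have : ((0 + 1 : ℝ) : UnitAddCircle) = ((0 : ℝ) : UnitAddCircle) := by simp
    rw [this, sub_self]
  refine ⟨∫ x, h x, ?_⟩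
  have := ae_eq_zero_of_fourier (h := fun x => ((h x - ∫ y, h y : ℝ) : ℂ))
    ((hh.sub (memLp_const _)).ofReal) fun n => by
      have hint : Integrable fun x => fourier n x * (h x : ℂ) := hfi n
      have hint2 : Integrable fun x : UnitAddCircle => fourier n x * ((∫ y, h y : ℝ) : ℂ) :=
        ((fourier n).continuous.mul continuous_const).integrable_of_hasCompactSupport
          (HasCompactSupport.of_compactSpace _)
      simp only [Complex.ofReal_sub, mul_sub]
      rw [integral_sub hint hint2, integral_mul_const]
      rcases eq_or_ne n 0 with rfl | hn
      · simp only [fourier_zero, one_mul, integral_const, probReal_univ, one_smul]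
        exact sub_eq_zero.2 integral_complex_ofReal
      · rw [key n hn, hf0 n hn]; simp
  filter_upwards [this] with x hx
  have hx' : h x - ∫ y, h y = 0 := Complex.ofReal_eq_zero.1 hx
  linarith

end ElasticKnot

namespace ElasticKnot
open Topology

theorem periodic_comp_coe {X : Type*} (f : UnitAddCircle → X) :
    Function.Periodic (fun t : ℝ => f (t : UnitAddCircle)) 1 := fun t => by
  simp

theorem intervalIntegrable_comp_coe {E : Type*} [NormedAddCommGroup E] {g : UnitAddCircle → E}
    (hg : Integrable g) (a b : ℝ) :
    IntervalIntegrable (fun t : ℝ => g (t : UnitAddCircle)) volume a b := by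
  refine (periodic_comp_coe g).intervalIntegrable₀ one_ne_zero ?_ a b
  rw [intervalIntegrable_iff_integrableOn_Ioc_of_le zero_le_one]
  have := (UnitAddCircle.measurePreserving_mk 0).integrable_comp_of_integrable hg
  rwa [zero_add] at this

theorem periodic_primitive {g : UnitAddCircle → ℝ} (hg : Integrable g) (h0 : ∫ x, g x = 0) :
    Function.Periodic (fun t : ℝ => ∫ s in (0:ℝ)..t, g (s : UnitAddCircle)) 1 := fun t => by
  have := UnitAddCircle.intervalIntegral_preimage t g
  rw [h0] at this
  have h := intervalIntegral.integral_add_adjacent_intervals (intervalIntegrable_comp_coe hg 0 t)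
    (intervalIntegrable_comp_coe hg t (t + 1))
  rw [this, add_zero] at h
  exact h.symm

theorem integral_test_mul {g : UnitAddCircle → ℝ} (hg : Integrable g) (h0 : ∫ x, g x = 0)
    {φ φ' : UnitAddCircle → ℝ} (hφ : IsTest φ φ') :
    ∫ x, φ x * g x = -∫ x, φ' x * (periodic_primitive hg h0).lift x := by
  rw [← UnitAddCircle.intervalIntegral_preimage 0, ← UnitAddCircle.intervalIntegral_preimage 0,
    zero_add]
  set G : ℝ → ℝ := fun t => ∫ s in (0:ℝ)..t, g (s : UnitAddCircle)
  have hgi := intervalIntegrable_comp_coe hg 0 1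
  have hG : AbsolutelyContinuousOnInterval G 0 1 :=
    hgi.absolutelyContinuousOnInterval_intervalIntegral (by simp)
  have hφ1 : AbsolutelyContinuousOnInterval (fun t : ℝ => φ (t : UnitAddCircle)) 0 1 :=
    ((hφ.1.of_le (by norm_cast)).contDiffOn).absolutelyContinuousOnInterval
  have hp := hφ1.integral_mul_deriv_eq_deriv_mul hG
  have e1 : ∫ t in (0:ℝ)..1, φ (t : UnitAddCircle) * deriv G t =
      ∫ t in (0:ℝ)..1, φ (t : UnitAddCircle) * g (t : UnitAddCircle) := by
    refine intervalIntegral.integral_congr_ae ?_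
    filter_upwards [hgi.ae_hasDerivAt_integral] with t ht htm
    rw [(ht (Set.uIoc_subset_uIcc htm) 0 (by simp)).deriv]
  have e2 : G 1 = G 0 := by simpa [G] using periodic_primitive hg h0 0
  have e3 : φ ((1:ℝ) : UnitAddCircle) = φ ((0:ℝ) : UnitAddCircle) := by
    simpa using periodic_comp_coe φ 0
  rw [← e1, hp, e2, e3, sub_self, zero_sub]
  congr 1
  refine intervalIntegral.integral_congr fun t _ => ?_
  simp only [(hφ.2 t).deriv, Function.Periodic.lift_coe]
  rfl

theorem continuous_lift {X : Type*} [TopologicalSpace X] {f : ℝ → X} (hp : Function.Periodic f 1)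
    (hf : Continuous f) : Continuous (hp.lift : UnitAddCircle → X) :=
  continuous_coinduced_dom.2 hf

theorem _root_.Continuous.memLp_unitAddCircle {E : Type*} [NormedAddCommGroup E]
    [SecondCountableTopology E] {f : UnitAddCircle → E} (hf : Continuous f) :
    MemLp f 2 volume := by
  obtain ⟨C, hC⟩ := (isCompact_range hf).isBounded.exists_norm_le
  exact MemLp.of_bound hf.aestronglyMeasurable C (.of_forall fun x => hC _ ⟨x, rfl⟩)

theorem IsTest.continuous {φ φ' : UnitAddCircle → ℝ} (h : IsTest φ φ') :
    Continuous φ ∧ Continuous φ' := by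
  have h1 : Continuous fun t : ℝ => φ' (t : UnitAddCircle) := by
    have := h.1.continuous_deriv (by norm_cast)
    rwa [show deriv (fun t : ℝ => φ (t : UnitAddCircle)) = fun t : ℝ => φ' (t : UnitAddCircle) from
      funext fun t => (h.2 t).deriv] at this
  exact ⟨continuous_coinduced_dom.2 h.1.continuous, continuous_coinduced_dom.2 h1⟩

theorem _root_.Continuous.integrable_mul_unitAddCircle {φ f : UnitAddCircle → ℝ}
    (hφ : Continuous φ) (hf : Integrable f) : Integrable fun x => φ x * f x := by
  obtain ⟨C, hC⟩ := (isCompact_range hφ).isBounded.exists_norm_le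
  exact hf.bdd_mul (c := C) hφ.aestronglyMeasurable (.of_forall fun x => hC _ ⟨x, rfl⟩)

theorem exists_continuous_primitive_real {f g : UnitAddCircle → ℝ} (hf : MemLp f 2 volume)
    (hg : MemLp g 2 volume)
    (h : ∀ φ φ', IsTest φ φ' → ∫ x, φ' x * f x = -∫ x, φ x * g x) :
    ∃ F : UnitAddCircle → ℝ, Continuous F ∧ f =ᵐ[volume] F ∧
      ∀ s t : ℝ, F t - F s = ∫ r in s..t, g (r : UnitAddCircle) := by
  have hp : IsProbabilityMeasure (volume : Measure UnitAddCircle) := by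
    rw [volume_unitAddCircle]; infer_instance
  have hgi : Integrable g := hg.integrable (by norm_num)
  have hfi : Integrable f := hf.integrable (by norm_num)
  have hg0 : ∫ x, g x = 0 := by
    have := h (fun _ => 1) (fun _ => 0) ⟨contDiff_const, fun t => hasDerivAt_const _ _⟩
    simpa using this
  set G := (periodic_primitive hgi hg0).lift
  have hG : Continuous G := continuous_lift _ (intervalIntegral.continuous_primitive
    (fun a b => intervalIntegrable_comp_coe hgi a b) 0)
  obtain ⟨c, hc⟩ := ae_eq_const_of_integral_test (hf.sub hG.memLp_unitAddCircle)
    fun φ φ' hφ => by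
      have hc := hφ.continuous
      simp only [Pi.sub_apply, mul_sub]
      rw [integral_sub (hc.2.integrable_mul_unitAddCircle hfi)
        (hc.2.integrable_mul_unitAddCircle (hG.memLp_unitAddCircle.integrable (by norm_num))),
        h φ φ' hφ, integral_test_mul hgi hg0 hφ]
      simp [G]
  refine ⟨fun x => c + G x, by fun_prop, ?_, fun s t => ?_⟩
  · filter_upwards [hc] with x hx
    rw [← hx, Pi.sub_apply]; ring
  · have := intervalIntegral.integral_add_adjacent_intervals (intervalIntegrable_comp_coe hgi 0 s)
      (intervalIntegrable_comp_coe hgi s t)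
    change (c + ∫ r in (0:ℝ)..t, g (r : UnitAddCircle)) -
      (c + ∫ r in (0:ℝ)..s, g (r : UnitAddCircle)) = _
    linarith

theorem memLp_apply {f : UnitAddCircle → E3} (hf : MemLp f 2 volume) (i : Fin 3) :
    MemLp (fun x => f x i) 2 volume :=
  (EuclideanSpace.proj i : E3 →L[ℝ] ℝ).comp_memLp' hf

theorem _root_.MeasureTheory.Integrable.bounded_smul {α : Type*} [MeasurableSpace α]
    {μ : Measure α} {φ : α → ℝ} {u : α → E3} {C : ℝ} (hφ : AEStronglyMeasurable φ μ)
    (hu : Integrable u μ) (h : ∀ x, ‖φ x‖ ≤ C) : Integrable (fun x => φ x • u x) μ :=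
  hu.bdd_smul C hφ (.of_forall h)

theorem _root_.Continuous.integrable_smul_unitAddCircle {φ : UnitAddCircle → ℝ}
    {u : UnitAddCircle → E3} (hφ : Continuous φ) (hu : Integrable u) :
    Integrable fun x => φ x • u x := by
  obtain ⟨C, hC⟩ := (isCompact_range hφ).isBounded.exists_norm_le
  have hm : AEStronglyMeasurable φ volume := hφ.aestronglyMeasurable
  exact Integrable.bounded_smul hm hu fun x => hC _ ⟨x, rfl⟩

theorem integral_apply {u : UnitAddCircle → E3} (hu : Integrable u) (i : Fin 3) :
    (∫ x, u x) i = ∫ x, u x i :=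
  ((EuclideanSpace.proj i : E3 →L[ℝ] ℝ).integral_comp_comm hu).symm

theorem intervalIntegral_apply {u : ℝ → E3} {s t : ℝ} (hu : IntervalIntegrable u volume s t)
    (i : Fin 3) : (∫ x in s..t, u x) i = ∫ x in s..t, u x i :=
  ((EuclideanSpace.proj i : E3 →L[ℝ] ℝ).intervalIntegral_comp_comm hu).symm

theorem _root_.MeasureTheory.MemLp.integrable_unitAddCircle {u : UnitAddCircle → E3}
    (hu : MemLp u 2 volume) : Integrable u := by
  have hp : IsProbabilityMeasure (volume : Measure UnitAddCircle) := by
    rw [volume_unitAddCircle]; infer_instance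
  exact hu.integrable (by norm_num)

theorem IsL2WeakDeriv.exists_continuous_primitive_apply {f g : UnitAddCircle → E3}
    (h : IsL2WeakDeriv f g) (i : Fin 3) :
    ∃ F : UnitAddCircle → ℝ, Continuous F ∧ (fun x => f x i) =ᵐ[volume] F ∧
      ∀ s t : ℝ, F t - F s = ∫ r in s..t, g (r : UnitAddCircle) i := by
  refine exists_continuous_primitive_real (memLp_apply h.memLp_left i)
    (memLp_apply h.memLp_right i) fun φ φ' hφ => ?_
  have h2 := congrArg (fun v : E3 => v i) (h.integral_eq φ φ' hφ.1 hφ.2)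
  have hc := hφ.continuous
  simp only [PiLp.neg_apply] at h2
  rw [integral_apply (hc.2.integrable_smul_unitAddCircle h.memLp_left.integrable_unitAddCircle),
    integral_apply (hc.1.integrable_smul_unitAddCircle h.memLp_right.integrable_unitAddCircle)]
    at h2
  exact h2

theorem IsL2WeakDeriv.exists_continuous_primitive {f g : UnitAddCircle → E3}
    (h : IsL2WeakDeriv f g) :
    ∃ F : UnitAddCircle → E3, Continuous F ∧ f =ᵐ[volume] F ∧
      ∀ s t : ℝ, F t - F s = ∫ r in s..t, g (r : UnitAddCircle) := by
  choose F hFc hFe hFi using h.exists_continuous_primitive_apply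
  refine ⟨fun x => WithLp.toLp 2 fun i => F i x, ?_, ?_, fun s t => ?_⟩
  · exact (PiLp.continuous_toLp 2 _).comp (continuous_pi hFc)
  · filter_upwards [ae_all_iff.2 hFe] with x hx
    ext i
    exact hx i
  · ext i
    rw [intervalIntegral_apply (intervalIntegrable_comp_coe
      h.memLp_right.integrable_unitAddCircle s t) i, ← hFi i s t]
    rfl

end ElasticKnot

namespace ElasticKnot
open Topology

theorem ae_comp_coe {p : UnitAddCircle → Prop} (h : ∀ᵐ x, p x) :
    ∀ᵐ t : ℝ, p (t : UnitAddCircle) := by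
  have := (ae_restrict_iUnion_iff (μ := (volume : Measure ℝ))
    (fun n : ℤ => Set.Ioc (n : ℝ) (n + 1)) (fun t : ℝ => p (t : UnitAddCircle))).2 fun n =>
      (UnitAddCircle.measurePreserving_mk n).quasiMeasurePreserving.ae h
  rwa [iUnion_Ioc_intCast, Measure.restrict_univ] at this

theorem hasDerivAt_of_sub_eq_integral {f T : ℝ → E3} (hT : Continuous T)
    (h : ∀ s t, f t - f s = ∫ r in s..t, T r) (t : ℝ) : HasDerivAt f (T t) t := by
  have hf : f = fun s => f 0 + ∫ r in (0:ℝ)..s, T r := by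
    funext s
    rw [← h]
    abel
  rw [hf]
  exact (intervalIntegral.integral_hasDerivAt_right (hT.intervalIntegrable _ _)
    (hT.stronglyMeasurableAtFilter _ _) hT.continuousAt).const_add _

theorem IsL2WeakDeriv.exists_unit_tangent {γ γ₁ γ₂ : UnitAddCircle → E3} (hγ : Continuous γ)
    (h₁ : IsL2WeakDeriv γ γ₁) (h₂ : IsL2WeakDeriv γ₁ γ₂)
    (hu : ∀ t : ℝ, ‖deriv (fun s : ℝ => γ (s : UnitAddCircle)) t‖ = 1) :
    ∃ T : ℝ → E3, Continuous T ∧ Function.Periodic T 1 ∧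
      (∀ t, HasDerivAt (fun s : ℝ => γ (s : UnitAddCircle)) (T t) t) ∧ (∀ t, ‖T t‖ = 1) ∧
      ∀ s t : ℝ, T t - T s = ∫ r in s..t, γ₂ (r : UnitAddCircle) := by
  obtain ⟨F, hF, hγF, hFi⟩ := h₁.exists_continuous_primitive
  obtain ⟨T, hT, hγT, hTi⟩ := h₂.exists_continuous_primitive
  have hpos : (volume : Measure UnitAddCircle).IsOpenPosMeasure := by
    rw [volume_unitAddCircle]; infer_instance
  obtain rfl : γ = F := (hγ.ae_eq_iff_eq volume hF).1 hγF
  have hTc : Continuous fun t : ℝ => T (t : UnitAddCircle) :=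
    hT.comp (AddCircle.continuous_mk' 1)
  have hd : ∀ t : ℝ, HasDerivAt (fun s : ℝ => γ (s : UnitAddCircle)) (T (t : UnitAddCircle)) t :=
    hasDerivAt_of_sub_eq_integral hTc fun s t => by
      rw [hFi]
      exact intervalIntegral.integral_congr_ae ((ae_comp_coe hγT).mono fun _ hr _ => hr)
  exact ⟨_, hTc, periodic_comp_coe T, hd, fun t => (hd t).deriv ▸ hu t, hTi⟩

theorem integral_norm_lt_of_lintegral_lt {g : UnitAddCircle → E3} (hg : MemLp g 2 volume)
    {c : ℝ} (hc : 0 ≤ c) (h : ∫⁻ x, ‖g x‖ₑ ^ 2 < ENNReal.ofReal (c ^ 2)) : ∫ x, ‖g x‖ < c := by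
  have hp : IsProbabilityMeasure (volume : Measure UnitAddCircle) := by
    rw [volume_unitAddCircle]; infer_instance
  have h1 : eLpNorm g 1 volume ≤ eLpNorm g 2 volume :=
    eLpNorm_le_eLpNorm_of_exponent_le (by norm_num) hg.aestronglyMeasurable
  have h2 : eLpNorm g 2 volume ^ 2 = ∫⁻ x, ‖g x‖ₑ ^ 2 := by
    rw [eLpNorm_eq_lintegral_rpow_enorm_toReal (by norm_num) (by norm_num), ← ENNReal.rpow_natCast,
      ← ENNReal.rpow_mul]
    simp
  rw [eLpNorm_one_eq_lintegral_enorm] at h1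
  have h3 : ∫⁻ x, ‖g x‖ₑ < ENNReal.ofReal c := by
    refine h1.trans_lt ((ENNReal.pow_lt_pow_left_iff two_ne_zero).1 ?_)
    rwa [h2, ← ENNReal.ofReal_pow hc]
  rw [integral_norm_eq_lintegral_enorm hg.aestronglyMeasurable]
  exact (ENNReal.lt_ofReal_iff_toReal_lt (h3.ne_top)).1 h3

theorem norm_sub_le_integral_norm {T : ℝ → E3} {g : UnitAddCircle → E3} (hg : Integrable g)
    (hT : ∀ s t : ℝ, T t - T s = ∫ r in s..t, g (r : UnitAddCircle)) {s t : ℝ} (hst : s ≤ t) :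
    ‖T t - T s‖ ≤ (∫ r in (0:ℝ)..t, ‖g (r : UnitAddCircle)‖) -
      ∫ r in (0:ℝ)..s, ‖g (r : UnitAddCircle)‖ := by
  have hi := fun a b => (intervalIntegrable_comp_coe hg a b).norm
  rw [hT, intervalIntegral.integral_interval_sub_left (hi 0 t) (hi 0 s)]
  exact intervalIntegral.norm_integral_le_integral_norm hst

end ElasticKnot

namespace ElasticKnot
open Topology Set

/-- The identification of `ℝ³` with `ℂ × ℝ`. -/
noncomputable def complexCoord : E3 ≃ₜ ℂ × ℝ where
  toFun x := ((⟨x 0, x 1⟩ : ℂ), x 2)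
  invFun p := !₂[p.1.re, p.1.im, p.2]
  left_inv x := by ext i; fin_cases i <;> rfl
  right_inv p := rfl
  continuous_toFun := (continuous_complex_mk (by fun_prop) (by fun_prop)).prodMk (by fun_prop)
  continuous_invFun := by
    refine (PiLp.continuous_toLp 2 _).comp (continuous_pi fun i => ?_)
    fin_cases i <;> simp <;> fun_prop

theorem hasDerivAt_complex_mk {f g : ℝ → ℝ} {f' g' t : ℝ} (hf : HasDerivAt f f' t)
    (hg : HasDerivAt g g' t) : HasDerivAt (fun s => (⟨f s, g s⟩ : ℂ)) ⟨f', g'⟩ t := by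
  have h := hf.ofReal_comp.add (hg.ofReal_comp.mul_const Complex.I)
  have e : (fun s => (⟨f s, g s⟩ : ℂ)) = (fun s => (f s : ℂ)) + fun s => (g s : ℂ) * Complex.I :=
    funext fun s => Complex.mk_eq_add_mul_I _ _
  rw [e, Complex.mk_eq_add_mul_I]
  exact h

theorem exists_linearIsometryEquiv_third {e : E3} (he : ‖e‖ = 1) :
    ∃ Q : E3 ≃ₗᵢ[ℝ] E3, ∀ v, Q v 2 = inner ℝ v e := by
  refine ⟨(ℝ ∙ (e - EuclideanSpace.single 2 1))ᗮ.reflection, fun v => ?_⟩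
  have h := Submodule.reflection_sub (v := e) (w := EuclideanSpace.single (2 : Fin 3) (1 : ℝ))
    (by simp [he])
  rw [← LinearIsometryEquiv.inner_map_map
    (ℝ ∙ (e - EuclideanSpace.single (2 : Fin 3) (1 : ℝ)))ᗮ.reflection v e, h,
    EuclideanSpace.inner_single_right]
  simp

theorem exists_homeomorph_of_no_alternation {γ T : ℝ → E3} (hT : Continuous T)
    (hTn : ∀ t, ‖T t‖ = 1) (hγT : ∀ t, HasDerivAt γ (T t) t) (hγp : Function.Periodic γ 1)
    (hinj : ∀ s t, s < t → t < s + 1 → γ s ≠ γ t) {e : E3} (he : ‖e‖ = 1)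
    (hd : Dense {t | inner ℝ (T t) e ≠ 0})
    (halt : ∀ p₁ p₂ p₃ p₄, p₁ < p₂ → p₂ < p₃ → p₃ < p₄ → p₄ < p₁ + 1 → 0 < inner ℝ (T p₁) e →
      inner ℝ (T p₂) e < 0 → 0 < inner ℝ (T p₃) e → inner ℝ (T p₄) e < 0 → False) :
    ∃ Ψ : (ℂ × ℝ) ≃ₜ E3, Ψ '' verticalCircle = range γ := by
  obtain ⟨Q, hQ⟩ := exists_linearIsometryEquiv_third he
  have hγc : Continuous γ := continuous_iff_continuousAt.2 fun t => (hγT t).continuousAt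
  have hh : ∀ t, HasDerivAt (fun t => inner ℝ (γ t) e) (inner ℝ (T t) e) t := fun t => by
    simpa using (hγT t).inner ℝ (hasDerivAt_const t e)
  obtain ⟨t₀, t₁, h01, h10, hmono, hanti, hf₀, hf₁⟩ := exists_monotone_arcs hh
    (fun t => by simp only [hγp t]) hd halt
  have hQd : ∀ t, HasDerivAt (fun t => Q (γ t)) (Q (T t)) t := fun t =>
    (Q.toContinuousLinearEquiv : E3 →L[ℝ] E3).hasFDerivAt.comp_hasDerivAt t (hγT t)
  have hQi : ∀ i t, HasDerivAt (fun t => Q (γ t) i) (Q (T t) i) t := fun i t =>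
    (EuclideanSpace.proj i : E3 →L[ℝ] ℝ).hasFDerivAt.comp_hasDerivAt t (hQd t)
  have hne : ∀ t, inner ℝ (T t) e = 0 → (⟨Q (T t) 0, Q (T t) 1⟩ : ℂ) ≠ 0 := fun t ht h0 => by
    have h1 : ‖Q (T t)‖ = 1 := by rw [Q.norm_map, hTn]
    have h2 : Q (T t) = 0 := by
      ext i
      fin_cases i
      · exact congrArg Complex.re h0
      · exact congrArg Complex.im h0
      · exact (hQ _).trans ht
    rw [h2, norm_zero] at h1
    exact zero_ne_one h1
  obtain ⟨Ψ, hΨ⟩ := exists_homeomorph_verticalCircle (x := fun t => ⟨Q (γ t) 0, Q (γ t) 1⟩)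
    (x' := fun t => ⟨Q (T t) 0, Q (T t) 1⟩) (h := fun t => inner ℝ (γ t) e)
    (fun t => hasDerivAt_complex_mk (hQi 0 t) (hQi 1 t))
    (continuous_complex_mk (by fun_prop) (by fun_prop)) (fun t => by simp only [hγp t])
    (fun t => by simp only [hγp t]) (by fun_prop) h01 h10 hmono hanti (hne _ hf₀) (hne _ hf₁)
    (fun s hs t ht hst hx => by
      refine hinj s t (hs.2.trans ht.1) (by linarith [hs.1, ht.2]) (Q.injective ?_)
      ext i
      fin_cases i
      · exact congrArg Complex.re hx
      · exact congrArg Complex.im hx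
      · exact (hQ _).trans (hst.trans (hQ _).symm))
  refine ⟨(Ψ.trans complexCoord.symm).trans Q.symm.toHomeomorph, ?_⟩
  have : ∀ p, ((Ψ.trans complexCoord.symm).trans Q.symm.toHomeomorph) p =
    Q.symm (complexCoord.symm (Ψ p)) := fun p => rfl
  simp_rw [this, ← image_image (fun y => Q.symm (complexCoord.symm y)) Ψ]
  rw [hΨ, ← range_comp]
  congr 1
  funext t
  have : complexCoord (Q (γ t)) = (⟨Q (γ t) 0, Q (γ t) 1⟩, inner ℝ (γ t) e) := by
    rw [← hQ]; rfl
  simp only [Function.comp_apply, ← this, Homeomorph.symm_apply_apply, LinearIsometryEquiv.symm_apply_apply]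

theorem exists_homeomorph_of_total_curvature_lt {γ T : ℝ → E3} {V : ℝ → ℝ} (hT : Continuous T)
    (hTn : ∀ t, ‖T t‖ = 1) (hTp : Function.Periodic T 1) (hγT : ∀ t, HasDerivAt γ (T t) t)
    (hγp : Function.Periodic γ 1) (hinj : ∀ s t, s < t → t < s + 1 → γ s ≠ γ t)
    (hV : ∀ s t, s ≤ t → ‖T t - T s‖ ≤ V t - V s) (hV1 : V 1 - V 0 < 4 * Real.pi) :
    ∃ Ψ : (ℂ × ℝ) ≃ₜ E3, Ψ '' verticalCircle = range γ := by
  obtain ⟨e, he0, heS⟩ := exists_signChanges_le hT hTn hV hV1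
  have he : e ≠ 0 := by
    rintro rfl
    exact he0 0 0 (inner_zero_right _)
  have hen : 0 < ‖e‖ := norm_pos_iff.2 he
  have hfp : Function.Periodic (fun t => inner ℝ (T t) e) 1 := fun t => by simp only [hTp t]
  have hc : ∀ t, inner ℝ (T t) (‖e‖⁻¹ • e) = ‖e‖⁻¹ * inner ℝ (T t) e := fun t =>
    inner_smul_right _ _ _
  have hpos : ∀ t, 0 < inner ℝ (T t) (‖e‖⁻¹ • e) → 0 < inner ℝ (T t) e := fun t h => by
    rw [hc] at h; exact pos_of_mul_pos_right h (by positivity)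
  have hneg : ∀ t, inner ℝ (T t) (‖e‖⁻¹ • e) < 0 → inner ℝ (T t) e < 0 := fun t h => by
    rw [hc] at h; exact neg_of_mul_neg_right h (by positivity)
  refine exists_homeomorph_of_no_alternation hT hTn hγT hγp hinj (e := ‖e‖⁻¹ • e)
    (by rw [norm_smul, norm_inv, norm_norm, inv_mul_cancel₀ hen.ne']) ?_ ?_
  · convert dense_of_dyadic hfp he0 using 3
    rw [hc]
    simp [he]
  · intro p₁ p₂ p₃ p₄ h12 h23 h34 h41 h1 h2 h3 h4
    exact not_alternating (by fun_prop) hfp he0 heS h12 h23 h34 h41 (hpos _ h1) (hneg _ h2)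
      (hpos _ h3) (hneg _ h4)

theorem complexCoord_apply (x : E3) : complexCoord x = (⟨x 0, x 1⟩, x 2) := rfl

theorem torusKnotTwo_eq (n : ℕ) (ρ t : ℝ) : torusKnotTwo n ρ t =
    (⟨(1 + ρ * Real.cos (n * t)) * Real.cos (2 * t), (1 + ρ * Real.cos (n * t)) * Real.sin (2 * t)⟩,
      ρ * Real.sin (n * t)) := by
  have h : (2 * t * Complex.I : ℂ) = ((2 * t : ℝ) : ℂ) * Complex.I := by push_cast; ring
  refine Prod.ext (Complex.ext ?_ ?_) rfl
  · rw [torusKnotTwo, h, Complex.re_ofReal_mul, Complex.exp_ofReal_mul_I_re]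
  · rw [torusKnotTwo, h, Complex.im_ofReal_mul, Complex.exp_ofReal_mul_I_im]

theorem complexCoord_torusKnot {n : ℕ} (ρ t : ℝ) :
    complexCoord (torusKnot 2 n ρ t) = torusKnotTwo n ρ t := by
  rw [complexCoord_apply, torusKnotTwo_eq]
  simp [torusKnot]

theorem complexCoord_torusKnot_neg {n : ℕ} (ρ t : ℝ) :
    complexCoord (torusKnot 2 (-n) ρ t) = ((torusKnotTwo n ρ t).1, -(torusKnotTwo n ρ t).2) := by
  rw [complexCoord_apply, torusKnotTwo_eq]
  simp [torusKnot]

theorem _root_.Homeomorph.image_trans {X Y Z : Type*} [TopologicalSpace X] [TopologicalSpace Y]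
    [TopologicalSpace Z] (f : X ≃ₜ Y) (g : Y ≃ₜ Z) (s : Set X) :
    f.trans g '' s = g '' (f '' s) :=
  image_comp g f s

theorem image_verticalCircle_ne_torusKnot {b : ℤ} (hb : Odd b) (hb1 : b.natAbs ≠ 1) {ρ : ℝ}
    (hρ0 : 0 < ρ) (hρ : ρ < 1) (Ψ : (ℂ × ℝ) ≃ₜ E3) :
    Ψ '' verticalCircle ≠ range (torusKnot 2 b ρ) := by
  intro h
  have hodd : Odd b.natAbs := Int.natAbs_odd.2 hb
  rcases Int.natAbs_eq b with hb' | hb'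
  · refine image_verticalCircle_ne_torusKnotTwo hodd hb1 hρ0 hρ (Ψ.trans complexCoord) ?_
    rw [Homeomorph.image_trans, h, hb', ← range_comp]
    congr 1
    funext t
    exact complexCoord_torusKnot ρ t
  · refine image_verticalCircle_ne_torusKnotTwo hodd hb1 hρ0 hρ ((Ψ.trans complexCoord).trans
      ((Homeomorph.refl ℂ).prodCongr (Homeomorph.neg ℝ))) ?_
    rw [Homeomorph.image_trans, Homeomorph.image_trans, h, hb', ← range_comp,
      ← range_comp, Int.natAbs_neg, Int.natAbs_natCast]
    congr 1
    funext t
    simp only [Function.comp_apply, complexCoord_torusKnot_neg]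
    simp

theorem le_bendingEnergy_of_mem_unitLoops {b : ℤ} (hb : Odd b) (hb1 : b.natAbs ≠ 1)
    {γ : UnitAddCircle → E3} (hγ : γ ∈ unitLoops (torusKnotClass 2 b)) :
    ENNReal.ofReal ((4 * Real.pi) ^ 2) ≤ bendingEnergy γ := by
  obtain ⟨⟨hγc, -⟩, -, hγu, hγi, ρ, ⟨hρ0, hρ⟩, H, -, -, hH⟩ := hγ
  refine le_iInf fun γ₁ => le_iInf fun γ₂ => le_iInf fun h12 => ?_
  by_contra! hlt
  obtain ⟨T, hT, hTp, hγT, hTn, hTi⟩ := h12.1.exists_unit_tangent hγc h12.2 hγu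
  have hlt' := integral_norm_lt_of_lintegral_lt h12.2.memLp_right (by positivity) hlt
  rw [← UnitAddCircle.intervalIntegral_preimage 0, zero_add] at hlt'
  obtain ⟨Ψ, hΨ⟩ := exists_homeomorph_of_total_curvature_lt
    (V := fun t => ∫ r in (0:ℝ)..t, ‖γ₂ (r : UnitAddCircle)‖) hT hTn hTp hγT (periodic_comp_coe γ)
    (fun s t hst hts h => by
      have h1 := hγi h
      have := (AddCircle.coe_eq_coe_iff_of_mem_Ico (a := s) (p := (1 : ℝ)) ⟨le_rfl, by linarith⟩
        ⟨hst.le, hts⟩).1 h1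
      exact hst.ne this)
    (fun s t hst => norm_sub_le_integral_norm h12.2.memLp_right.integrable_unitAddCircle hTi hst)
    (by simpa using hlt')
  refine image_verticalCircle_ne_torusKnot hb hb1 hρ0 hρ (Ψ.trans (H 1).symm) ?_
  have hr : range (fun t : ℝ => γ (t : UnitAddCircle)) = range γ :=
    Function.Surjective.range_comp QuotientAddGroup.mk_surjective γ
  rw [Homeomorph.image_trans, hΨ, hr, ← hH]
  exact (H 1).toEquiv.symm_image_image _

end ElasticKnot

namespace ElasticKnot
open Topology Set

theorem isL2WeakDeriv_lift {f f' : ℝ → E3} (hf : ∀ t, HasDerivAt f (f' t) t) (hc : Continuous f')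
    (hp : Function.Periodic f 1) (hp' : Function.Periodic f' 1) :
    IsL2WeakDeriv hp.lift hp'.lift where
  memLp_left := (continuous_lift hp
    (continuous_iff_continuousAt.2 fun t => (hf t).continuousAt)).memLp_unitAddCircle
  memLp_right := (continuous_lift hp' hc).memLp_unitAddCircle
  integral_eq φ φ' h1 h2 := by
    have hφ := IsTest.continuous ⟨h1, h2⟩
    have hmk : Continuous fun t : ℝ => (t : UnitAddCircle) := AddCircle.continuous_mk' 1
    rw [← UnitAddCircle.intervalIntegral_preimage 0, ← UnitAddCircle.intervalIntegral_preimage 0,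
      zero_add, eq_neg_iff_add_eq_zero]
    simp only [Function.Periodic.lift_coe]
    have hfc : Continuous f := continuous_iff_continuousAt.2 fun t => (hf t).continuousAt
    have c1 : Continuous fun t : ℝ => φ (t : UnitAddCircle) := hφ.1.comp hmk
    have c2 : Continuous fun t : ℝ => φ' (t : UnitAddCircle) := hφ.2.comp hmk
    have i1 : Continuous fun t : ℝ => φ' (t : UnitAddCircle) • f t := c2.smul hfc
    have i2 : Continuous fun t : ℝ => φ (t : UnitAddCircle) • f' t := c1.smul hc
    rw [← intervalIntegral.integral_add (i1.intervalIntegrable _ _) (i2.intervalIntegrable _ _)]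
    have := intervalIntegral.integral_eq_sub_of_hasDerivAt (a := 0) (b := 1)
      (fun t _ => (h2 t).smul (hf t)) ((i2.add i1).intervalIntegrable _ _)
    have e1 : φ ((1:ℝ) : UnitAddCircle) = φ ((0:ℝ) : UnitAddCircle) := by
      simpa using periodic_comp_coe φ 0
    have e2 : f 1 = f 0 := by simpa using hp 0
    rw [Pi.smul_apply', Pi.smul_apply', e1, e2, sub_self] at this
    rw [← this]
    exact intervalIntegral.integral_congr fun t _ => add_comm _ _

theorem periodic_of_hasDerivAt {f f' : ℝ → E3} {c : ℝ} (hf : ∀ t, HasDerivAt f (f' t) t)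
    (hp : Function.Periodic f c) : Function.Periodic f' c := fun t => by
  have h := (hf (t + c)).comp_add_const t c
  rw [show (fun x => f (x + c)) = f from funext hp] at h
  exact h.unique (hf t)

theorem bendingEnergy_le {f f' f'' : ℝ → E3} {g : ℝ → ℝ} (hp : Function.Periodic f 1)
    (hf : ∀ t, HasDerivAt f (f' t) t) (hf' : ∀ t, HasDerivAt f' (f'' t) t)
    (hc : Continuous f'') (hg : Continuous g) (hle : ∀ t, ‖f'' t‖ ^ 2 ≤ g t) :
    MemH2 hp.lift ∧ bendingEnergy hp.lift ≤ ENNReal.ofReal (∫ t in (0:ℝ)..1, g t) := by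
  have hp' := periodic_of_hasDerivAt hf hp
  have hp'' := periodic_of_hasDerivAt hf' hp'
  have c0 : Continuous f := continuous_iff_continuousAt.2 fun t => (hf t).continuousAt
  have c1 : Continuous f' := continuous_iff_continuousAt.2 fun t => (hf' t).continuousAt
  have w1 := isL2WeakDeriv_lift hf c1 hp hp'
  have w2 := isL2WeakDeriv_lift hf' hc hp' hp''
  refine ⟨⟨continuous_lift hp c0, _, _, w1, w2⟩, ?_⟩
  have hle' : bendingEnergy hp.lift ≤ ∫⁻ x : UnitAddCircle, ‖hp''.lift x‖ₑ ^ 2 :=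
    iInf_le_of_le hp'.lift (iInf_le_of_le hp''.lift (iInf_le _ ⟨w1, w2⟩))
  refine hle'.trans ?_
  rw [← UnitAddCircle.lintegral_preimage 0, zero_add,
    intervalIntegral.integral_of_le zero_le_one, ofReal_integral_eq_lintegral_ofReal
      ((hg.intervalIntegrable 0 1).1) (.of_forall fun t => (sq_nonneg _).trans (hle t))]
  refine lintegral_mono fun t => ?_
  simp only [Function.Periodic.lift_coe]
  rw [← ofReal_norm, ← ENNReal.ofReal_pow (norm_nonneg _)]
  exact ENNReal.ofReal_le_ofReal (hle t)

/-- The derivative of the unit tangent of a curve with velocity `p` and acceleration `q`. -/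
noncomputable def unitTangentDeriv (p q : E3) : E3 :=
  ‖p‖⁻¹ • (q - (inner ℝ p q / ‖p‖ ^ 2) • p)

theorem hasDerivAt_unitTangent {p q : ℝ → E3} (hp : ∀ t, HasDerivAt p (q t) t) {t : ℝ}
    (h0 : p t ≠ 0) : HasDerivAt (fun s => ‖p s‖⁻¹ • p s) (unitTangentDeriv (p t) (q t)) t := by
  have hn : ‖p t‖ ≠ 0 := norm_ne_zero_iff.2 h0
  have h1 : HasDerivAt (fun s => ‖p s‖) (inner ℝ (p t) (q t) / ‖p t‖) t := by
    have h := (hp t).norm_sq.sqrt (by positivity)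
    simp only [Real.sqrt_sq (norm_nonneg _)] at h
    convert h using 1
    field_simp
  have e : unitTangentDeriv (p t) (q t) =
      ‖p t‖⁻¹ • q t + (-(inner ℝ (p t) (q t) / ‖p t‖) / ‖p t‖ ^ 2) • p t := by
    rw [unitTangentDeriv, smul_sub, smul_smul, sub_eq_add_neg, ← neg_smul]
    congr 2
    field_simp
  rw [e]
  exact (h1.inv hn).smul (hp t)

theorem norm_unitTangentDeriv_sq_le {p : E3} (q : E3) (h0 : p ≠ 0) :
    ‖unitTangentDeriv p q‖ ^ 2 ≤ ‖q‖ ^ 2 / ‖p‖ ^ 2 := by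
  have hn : ‖p‖ ≠ 0 := norm_ne_zero_iff.2 h0
  rw [unitTangentDeriv, norm_smul, mul_pow, norm_inv, norm_norm, norm_sub_sq_real, norm_smul,
    inner_smul_right, mul_pow, Real.norm_eq_abs, sq_abs, real_inner_comm p q]
  have h : ‖q‖ ^ 2 - 2 * (inner ℝ p q / ‖p‖ ^ 2 * inner ℝ p q) +
      (inner ℝ p q / ‖p‖ ^ 2) ^ 2 * ‖p‖ ^ 2 = ‖q‖ ^ 2 - (inner ℝ p q / ‖p‖) ^ 2 := by
    field_simp; ring
  rw [h, inv_pow, inv_mul_eq_div]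
  gcongr
  linarith [sq_nonneg (inner ℝ p q / ‖p‖)]

end ElasticKnot

namespace ElasticKnot
open Topology Set

/-- A positive speed of period `c` is the speed of a reparametrization of `ℝ`, here normalised
to period `1`. -/
theorem exists_orderIso_hasDerivAt {v : ℝ → ℝ} {c : ℝ} (hc0 : 0 < c) (hv : Continuous v)
    (hv1 : ∀ t, 1 ≤ v t) (hp : Function.Periodic v c) :
    0 < ∫ t in (0:ℝ)..c, v t ∧ ∃ σ : ℝ ≃o ℝ, σ 0 = 0 ∧ (∀ s, σ (s + 1) = σ s + c) ∧
      ∀ s, HasDerivAt σ ((∫ t in (0:ℝ)..c, v t) / v (σ s)) s := by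
  set L := ∫ t in (0:ℝ)..c, v t with hL
  have hi : ∀ a b, IntervalIntegrable v volume a b := fun a b => hv.intervalIntegrable a b
  have hle : ∀ a b, a ≤ b → b - a ≤ ∫ t in a..b, v t := fun a b hab => by
    have := intervalIntegral.integral_mono_on hab (intervalIntegrable_const (c := (1:ℝ))) (hi a b)
      fun t _ => hv1 t
    simpa using this
  have hL0 : 0 < L := hc0.trans_le (by simpa using hle 0 c hc0.le)
  refine ⟨hL0, ?_⟩
  set S : ℝ → ℝ := fun t => (∫ r in (0:ℝ)..t, v r) / L with hS
  have hSd : ∀ t, HasDerivAt S (v t / L) t := fun t =>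
    (intervalIntegral.integral_hasDerivAt_right (hi _ _) (hv.stronglyMeasurableAtFilter _ _)
      hv.continuousAt).div_const L
  have hSc : Continuous S := continuous_iff_continuousAt.2 fun t => (hSd t).continuousAt
  have hmono : StrictMono S := strictMono_of_deriv_pos fun t => by
    rw [(hSd t).deriv]; exact div_pos (one_pos.trans_le (hv1 t)) hL0
  have hsurj : Function.Surjective S := by
    refine hSc.surjective ?_ ?_
    · refine Filter.tendsto_atTop_mono' Filter.atTop ?_
        (Filter.tendsto_id.atTop_div_const hL0)
      filter_upwards [Filter.eventually_ge_atTop 0] with t ht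
      have := hle 0 t ht
      simp only [hS, id]
      gcongr
      linarith
    · refine Filter.tendsto_atBot_mono' Filter.atBot ?_
        (Filter.tendsto_id.atBot_div_const hL0)
      filter_upwards [Filter.eventually_le_atBot 0] with t ht
      have := hle t 0 ht
      rw [intervalIntegral.integral_symm] at this
      simp only [hS, id]
      gcongr
      linarith
  set U := hmono.orderIsoOfSurjective S hsurj
  have hU : ∀ t, U t = S t := fun t => rfl
  have hper : ∀ t, S (t + c) = S t + 1 := fun t => by
    have h1 := intervalIntegral.integral_add_adjacent_intervals (hi 0 t) (hi t (t + c))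
    have h2 := hp.intervalIntegral_add_eq t 0
    rw [zero_add] at h2
    simp only [hS]
    rw [← h1, h2, add_div, div_self hL0.ne']
  refine ⟨U.symm, ?_, fun s => ?_, fun s => ?_⟩
  · rw [U.symm_apply_eq, hU]
    simp [hS]
  · rw [U.symm_apply_eq, hU, hper, ← hU, U.apply_symm_apply]
  · have := HasDerivAt.of_local_left_inverse (f := S) (g := U.symm) (a := s)
      U.symm.continuous.continuousAt (hSd _)
      (div_pos (one_pos.trans_le (hv1 _)) hL0).ne' (.of_forall fun y => U.apply_symm_apply y)
    rwa [inv_div] at this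

theorem exists_arclength_loop {τ τ' τ'' : ℝ → E3} {c : ℝ} (hc0 : 0 < c)
    (hτ : ∀ t, HasDerivAt τ (τ' t) t) (hτ' : ∀ t, HasDerivAt τ' (τ'' t) t) (hc : Continuous τ'')
    (hp : Function.Periodic τ c) (h1 : ∀ t, 1 ≤ ‖τ' t‖) :
    0 < ∫ t in (0:ℝ)..c, ‖τ' t‖ ∧ ∃ (σ : ℝ ≃o ℝ) (β : UnitAddCircle → E3),
      (∀ s, σ (s + 1) = σ s + c) ∧
      (∀ s : ℝ, β s = (∫ t in (0:ℝ)..c, ‖τ' t‖)⁻¹ • (τ (σ s) - τ 0)) ∧ MemH2 β ∧ β 0 = 0 ∧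
      (∀ t : ℝ, ‖deriv (fun s : ℝ => β (s : UnitAddCircle)) t‖ = 1) ∧
      bendingEnergy β ≤ ENNReal.ofReal
        ((∫ t in (0:ℝ)..c, ‖τ' t‖) * ∫ t in (0:ℝ)..c, ‖τ'' t‖ ^ 2 / ‖τ' t‖ ^ 3) := by
  have hp' := periodic_of_hasDerivAt hτ hp
  have c1 : Continuous τ' := continuous_iff_continuousAt.2 fun t => (hτ' t).continuousAt
  obtain ⟨hL, σ, hσ0, hσ1, hσd⟩ := exists_orderIso_hasDerivAt hc0 c1.norm h1
    fun t => by simp only [hp' t]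
  set L := ∫ t in (0:ℝ)..c, ‖τ' t‖ with hLdef
  have hne : ∀ t, τ' t ≠ 0 := fun t => norm_ne_zero_iff.1 (one_pos.trans_le (h1 t)).ne'
  have hn0 : ∀ t, ‖τ' t‖ ≠ 0 := fun t => norm_ne_zero_iff.2 (hne t)
  have hσc : Continuous σ := σ.continuous
  set f : ℝ → E3 := fun s => L⁻¹ • (τ (σ s) - τ 0) with hf
  set u : ℝ → E3 := fun t => ‖τ' t‖⁻¹ • τ' t with hu
  have hfp : Function.Periodic f 1 := fun s => by simp only [hf, hσ1, hp (σ s)]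
  have hfd : ∀ s, HasDerivAt f (u (σ s)) s := fun s => by
    have h := (((hτ (σ s)).scomp s (hσd s)).sub_const (τ 0)).const_smul L⁻¹
    rw [smul_smul, inv_mul_eq_div, div_div_cancel_left' hL.ne'] at h
    exact h
  have hud : ∀ s, HasDerivAt (fun s => u (σ s))
      ((L / ‖τ' (σ s)‖) • unitTangentDeriv (τ' (σ s)) (τ'' (σ s))) s := fun s =>
    (hasDerivAt_unitTangent hτ' (hne (σ s))).scomp s (hσd s)
  have cu : Continuous fun t => unitTangentDeriv (τ' t) (τ'' t) := by
    have ci : Continuous fun t => inner ℝ (τ' t) (τ'' t) / ‖τ' t‖ ^ 2 :=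
      (c1.inner hc).div (c1.norm.pow 2) fun t => pow_ne_zero 2 (hn0 t)
    exact (c1.norm.inv₀ hn0).smul (hc.sub (ci.smul c1))
  have cg : Continuous fun t => L * (‖τ'' t‖ ^ 2 / ‖τ' t‖ ^ 3) :=
    continuous_const.mul ((hc.norm.pow 2).div (c1.norm.pow 3) fun t => pow_ne_zero 3 (hn0 t))
  have cd : Continuous fun s => L / ‖τ' (σ s)‖ :=
    continuous_const.div (c1.norm.comp hσc) fun s => hn0 _
  obtain ⟨hH, hB⟩ := bendingEnergy_le
    (g := fun s => (L * (‖τ'' (σ s)‖ ^ 2 / ‖τ' (σ s)‖ ^ 3)) * (L / ‖τ' (σ s)‖))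
    hfp hfd hud (cd.smul (cu.comp hσc)) ((cg.comp hσc).mul cd) fun s => by
      rw [norm_smul, mul_pow, Real.norm_eq_abs, sq_abs]
      refine (mul_le_mul_of_nonneg_left (norm_unitTangentDeriv_sq_le _ (hne _))
        (sq_nonneg _)).trans_eq ?_
      have := hn0 (σ s)
      field_simp
  refine ⟨hL, σ, hfp.lift, hσ1, fun s => rfl, hH, ?_, fun t => ?_, hB.trans_eq ?_⟩
  · change f 0 = 0
    simp [hf, hσ0]
  · change ‖deriv f t‖ = 1
    rw [(hfd t).deriv, hu, norm_smul, norm_inv, norm_norm, inv_mul_cancel₀ (hn0 _)]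
  · congr 1
    have := intervalIntegral.integral_comp_mul_deriv (a := 0) (b := 1) (fun s _ => hσd s)
      cd.continuousOn cg
    refine this.trans ?_
    have h1' : σ 1 = c := by simpa [hσ0] using hσ1 0
    rw [hσ0, h1', intervalIntegral.integral_const_mul]

end ElasticKnot

namespace ElasticKnot
open Topology Set

/-- The velocity of the standard torus knot. -/
noncomputable def torusKnotVelocity (a b : ℤ) (ρ t : ℝ) : E3 :=
  !₂[-(ρ * b * Real.sin (b * t)) * Real.cos (a * t) -
      a * (1 + ρ * Real.cos (b * t)) * Real.sin (a * t),
    -(ρ * b * Real.sin (b * t)) * Real.sin (a * t) +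
      a * (1 + ρ * Real.cos (b * t)) * Real.cos (a * t),
    ρ * b * Real.cos (b * t)]

/-- The acceleration of the standard torus knot. -/
noncomputable def torusKnotAccel (a b : ℤ) (ρ t : ℝ) : E3 :=
  !₂[-(ρ * b ^ 2 * Real.cos (b * t) + a ^ 2 * (1 + ρ * Real.cos (b * t))) * Real.cos (a * t) +
      2 * a * (ρ * b * Real.sin (b * t)) * Real.sin (a * t),
    -(ρ * b ^ 2 * Real.cos (b * t) + a ^ 2 * (1 + ρ * Real.cos (b * t))) * Real.sin (a * t) -
      2 * a * (ρ * b * Real.sin (b * t)) * Real.cos (a * t),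
    -(ρ * b ^ 2 * Real.sin (b * t))]

theorem hasDerivAt_vec3 {f g h : ℝ → ℝ} {f' g' h' t : ℝ} (hf : HasDerivAt f f' t)
    (hg : HasDerivAt g g' t) (hh : HasDerivAt h h' t) :
    HasDerivAt (fun s => (!₂[f s, g s, h s] : E3)) !₂[f', g', h'] t := by
  have h : HasDerivAt (fun s => ![f s, g s, h s]) ![f', g', h'] t := by
    rw [hasDerivAt_pi]
    intro i
    fin_cases i <;> assumption
  exact (EuclideanSpace.equiv (Fin 3) ℝ).symm.toContinuousLinearMap.hasFDerivAt.comp_hasDerivAt t h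

theorem hasDerivAt_cos_mul (b t : ℝ) :
    HasDerivAt (fun s => Real.cos (b * s)) (-(b * Real.sin (b * t))) t := by
  have h := ((hasDerivAt_id t).const_mul b).cos
  simp only [id, mul_one] at h
  convert h using 1
  ring

theorem hasDerivAt_sin_mul (b t : ℝ) :
    HasDerivAt (fun s => Real.sin (b * s)) (b * Real.cos (b * t)) t := by
  have h := ((hasDerivAt_id t).const_mul b).sin
  simp only [id, mul_one] at h
  convert h using 1
  ring

theorem hasDerivAt_torusKnot (a b : ℤ) (ρ t : ℝ) :
    HasDerivAt (torusKnot a b ρ) (torusKnotVelocity a b ρ t) t := by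
  have cb := hasDerivAt_cos_mul b t
  have sb := hasDerivAt_sin_mul b t
  have ca := hasDerivAt_cos_mul a t
  have sa := hasDerivAt_sin_mul a t
  have h := hasDerivAt_vec3 (((cb.const_mul ρ).const_add 1).mul ca)
    (((cb.const_mul ρ).const_add 1).mul sa) (sb.const_mul ρ)
  refine h.congr_deriv ?_
  ext i
  fin_cases i <;> simp [torusKnotVelocity] <;> ring

theorem hasDerivAt_torusKnotVelocity (a b : ℤ) (ρ t : ℝ) :
    HasDerivAt (torusKnotVelocity a b ρ) (torusKnotAccel a b ρ t) t := by
  have cb := hasDerivAt_cos_mul b t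
  have sb := hasDerivAt_sin_mul b t
  have ca := hasDerivAt_cos_mul a t
  have sa := hasDerivAt_sin_mul a t
  have h := hasDerivAt_vec3
    (((sb.const_mul (ρ * b)).neg.mul ca).sub
      ((((cb.const_mul ρ).const_add 1).const_mul (a : ℝ)).mul sa))
    (((sb.const_mul (ρ * b)).neg.mul sa).add
      ((((cb.const_mul ρ).const_add 1).const_mul (a : ℝ)).mul ca)) (cb.const_mul (ρ * b))
  refine h.congr_deriv ?_
  ext i
  fin_cases i <;> simp [torusKnotAccel] <;> ring

theorem continuous_torusKnotAccel (a b : ℤ) (ρ : ℝ) : Continuous (torusKnotAccel a b ρ) := by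
  refine (PiLp.continuous_toLp 2 _).comp (continuous_pi fun i => ?_)
  fin_cases i <;> simp <;> fun_prop

theorem norm_sq_vec3 (x y z : ℝ) : ‖(!₂[x, y, z] : E3)‖ ^ 2 = x ^ 2 + y ^ 2 + z ^ 2 := by
  rw [EuclideanSpace.norm_sq_eq, Fin.sum_univ_three]
  simp

theorem norm_sq_torusKnotVelocity (a b : ℤ) (ρ t : ℝ) : ‖torusKnotVelocity a b ρ t‖ ^ 2 =
    a ^ 2 * (1 + ρ * Real.cos (b * t)) ^ 2 + ρ ^ 2 * b ^ 2 := by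
  rw [torusKnotVelocity, norm_sq_vec3]
  linear_combination ((ρ * b * Real.sin (b * t)) ^ 2 + (a * (1 + ρ * Real.cos (b * t))) ^ 2) *
    Real.sin_sq_add_cos_sq (a * t) + ρ ^ 2 * b ^ 2 * Real.sin_sq_add_cos_sq (b * t)

theorem norm_sq_torusKnotAccel (a b : ℤ) (ρ t : ℝ) : ‖torusKnotAccel a b ρ t‖ ^ 2 =
    a ^ 4 * (1 + ρ * Real.cos (b * t)) ^ 2 +
      2 * a ^ 2 * b ^ 2 * (1 + ρ * Real.cos (b * t)) * (ρ * Real.cos (b * t)) +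
      ρ ^ 2 * (b ^ 4 + 4 * a ^ 2 * b ^ 2 * Real.sin (b * t) ^ 2) := by
  rw [torusKnotAccel, norm_sq_vec3]
  linear_combination ((ρ * b ^ 2 * Real.cos (b * t) + a ^ 2 * (1 + ρ * Real.cos (b * t))) ^ 2 +
    (2 * a * (ρ * b * Real.sin (b * t))) ^ 2) * Real.sin_sq_add_cos_sq (a * t) +
    ρ ^ 2 * b ^ 4 * Real.sin_sq_add_cos_sq (b * t)

theorem torusKnot_periodic (a b : ℤ) (ρ : ℝ) :
    Function.Periodic (torusKnot a b ρ) (2 * Real.pi) := fun t => by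
  simp only [torusKnot, mul_add, Real.cos_add_int_mul_two_pi, Real.sin_add_int_mul_two_pi]

theorem two_le_abs {a : ℤ} (ha : a ∉ ({-1, 0, 1} : Set ℤ)) : 2 ≤ |(a : ℝ)| := by
  simp only [mem_insert_iff, mem_singleton_iff, not_or] at ha
  have : 2 ≤ |a| := by
    rcases abs_cases a with ⟨h, _⟩ | ⟨h, _⟩ <;> omega
  exact_mod_cast this

theorem half_le_one_add {ρ : ℝ} (hρ0 : 0 < ρ) (hρ : ρ ≤ 1 / 2) (y : ℝ) :
    1 / 2 ≤ 1 + ρ * Real.cos y := by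
  nlinarith [Real.neg_one_le_cos y]

theorem one_add_le {ρ : ℝ} (hρ0 : 0 < ρ) (hρ : ρ ≤ 1 / 2) (y : ℝ) :
    1 + ρ * Real.cos y ≤ 3 / 2 := by
  nlinarith [Real.cos_le_one y]

theorem one_le_abs_mul {ρ : ℝ} (hρ0 : 0 < ρ) (hρ : ρ ≤ 1 / 2) {a : ℝ} (ha : 2 ≤ |a|) (y : ℝ) :
    1 ≤ |a| * (1 + ρ * Real.cos y) := by
  nlinarith [half_le_one_add hρ0 hρ y]

theorem abs_mul_le_norm_torusKnotVelocity (a b : ℤ) (ρ t : ℝ) :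
    |(a : ℝ)| * (1 + ρ * Real.cos (b * t)) ≤ ‖torusKnotVelocity a b ρ t‖ := by
  refine le_of_sq_le_sq ?_ (norm_nonneg _)
  rw [norm_sq_torusKnotVelocity, mul_pow, sq_abs]
  linarith [mul_nonneg (sq_nonneg ρ) (sq_nonneg (b : ℝ))]

theorem one_le_norm_torusKnotVelocity {a b : ℤ} {ρ : ℝ} (ha : 2 ≤ |(a : ℝ)|) (hρ0 : 0 < ρ)
    (hρ : ρ ≤ 1 / 2) (t : ℝ) : 1 ≤ ‖torusKnotVelocity a b ρ t‖ :=
  (one_le_abs_mul hρ0 hρ ha _).trans (abs_mul_le_norm_torusKnotVelocity a b ρ t)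

theorem norm_torusKnotVelocity_le {a b : ℤ} {ρ : ℝ} (ha : 2 ≤ |(a : ℝ)|) (hρ0 : 0 < ρ)
    (hρ : ρ ≤ 1 / 2) (t : ℝ) : ‖torusKnotVelocity a b ρ t‖ ≤
      |(a : ℝ)| + |(a : ℝ)| * ρ * Real.cos (b * t) + b ^ 2 / 2 * ρ ^ 2 := by
  have h1 := one_le_abs_mul hρ0 hρ ha (b * t)
  have h2 : 0 ≤ (b:ℝ) ^ 2 / 2 * ρ ^ 2 := by positivity
  refine le_of_sq_le_sq ?_ (by linarith)
  rw [norm_sq_torusKnotVelocity, ← sq_abs (a : ℝ)]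
  nlinarith [mul_nonneg (sub_nonneg.2 h1) h2]

theorem norm_torusKnotVelocity_le_const {a b : ℤ} {ρ : ℝ} (hρ0 : 0 < ρ)
    (hρ : ρ ≤ 1 / 2) (t : ℝ) : ‖torusKnotVelocity a b ρ t‖ ≤ 2 * |(a : ℝ)| + |(b : ℝ)| := by
  refine le_of_sq_le_sq ?_ (by positivity)
  rw [norm_sq_torusKnotVelocity, ← sq_abs (a : ℝ), ← sq_abs (b : ℝ)]
  have h1 : (1 + ρ * Real.cos (b * t)) ^ 2 ≤ 4 := by
    nlinarith [half_le_one_add hρ0 hρ (b * t), one_add_le hρ0 hρ (b * t)]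
  have h2 : ρ ^ 2 ≤ 1 := by nlinarith
  nlinarith [mul_le_mul_of_nonneg_left h1 (sq_nonneg |(a : ℝ)|),
    mul_le_mul_of_nonneg_right h2 (sq_nonneg |(b : ℝ)|),
    mul_nonneg (abs_nonneg (a : ℝ)) (abs_nonneg (b : ℝ))]

theorem norm_torusKnotAccel_sq_le {a b : ℤ} {ρ : ℝ} (t : ℝ) :
    ‖torusKnotAccel a b ρ t‖ ^ 2 ≤ a ^ 4 * (1 + ρ * Real.cos (b * t)) ^ 2 +
      2 * a ^ 2 * b ^ 2 * (1 + ρ * Real.cos (b * t)) * (ρ * Real.cos (b * t)) +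
      ρ ^ 2 * (b ^ 4 + 4 * a ^ 2 * b ^ 2) := by
  rw [norm_sq_torusKnotAccel]
  have h : 4 * (a:ℝ) ^ 2 * b ^ 2 * Real.sin (b * t) ^ 2 ≤ 4 * a ^ 2 * b ^ 2 :=
    mul_le_of_le_one_right (by positivity) (Real.sin_sq_le_one _)
  gcongr

theorem norm_torusKnotAccel_le_const {a b : ℤ} {ρ : ℝ} (hρ0 : 0 < ρ)
    (hρ : ρ ≤ 1 / 2) (t : ℝ) :
    ‖torusKnotAccel a b ρ t‖ ≤ 2 * (a : ℝ) ^ 2 + 2 * (b : ℝ) ^ 2 := by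
  refine le_of_sq_le_sq ((norm_torusKnotAccel_sq_le t).trans ?_) (by positivity)
  have h0 := half_le_one_add hρ0 hρ (b * t)
  have h1 : (1 + ρ * Real.cos (b * t)) ^ 2 ≤ 4 := by
    nlinarith [one_add_le hρ0 hρ (b * t)]
  have h2 : ρ ^ 2 ≤ 1 / 4 := by nlinarith
  have h3 : (1 + ρ * Real.cos (b * t)) * (ρ * Real.cos (b * t)) ≤ 1 := by
    nlinarith [one_add_le hρ0 hρ (b * t)]
  have ha : 0 ≤ (a : ℝ) ^ 4 := by positivity
  have hb : 0 ≤ (b : ℝ) ^ 4 := by positivity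
  have hab : 0 ≤ (a : ℝ) ^ 2 * b ^ 2 := by positivity
  nlinarith [mul_le_mul_of_nonneg_left h1 ha, mul_le_mul_of_nonneg_left h3 hab,
    mul_le_mul_of_nonneg_right h2 hb, mul_le_mul_of_nonneg_right h2 hab]

theorem norm_torusKnotAccel_div_le {a b : ℤ} {ρ : ℝ} (ha : 2 ≤ |(a : ℝ)|) (hρ0 : 0 < ρ)
    (hρ : ρ ≤ 1 / 2) (t : ℝ) :
    ‖torusKnotAccel a b ρ t‖ ^ 2 / ‖torusKnotVelocity a b ρ t‖ ^ 3 ≤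
      |(a : ℝ)| + (2 * b ^ 2 / |(a : ℝ)| - |(a : ℝ)|) * ρ * Real.cos (b * t) +
        (2 * |(a : ℝ)| + b ^ 4 + 4 * a ^ 2 * b ^ 2) * ρ ^ 2 := by
  have h1 := one_le_abs_mul hρ0 hρ ha (b * t)
  have h2 := half_le_one_add hρ0 hρ (b * t)
  have h3 := abs_mul_le_norm_torusKnotVelocity a b ρ t
  have h4 := norm_torusKnotAccel_sq_le (a := a) (b := b) (ρ := ρ) t
  rw [← sq_abs (a : ℝ), show (a : ℝ) ^ 4 = |(a : ℝ)| ^ 4 by rw [← abs_pow, abs_of_nonneg (by positivity)]] at h4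
  rw [← sq_abs (a : ℝ)]
  set A := |(a : ℝ)|
  set c := Real.cos (b * t) with hc
  have hA : 0 < A := by linarith
  have hx : 0 < 1 + ρ * c := by linarith
  have hc1 : c ^ 2 ≤ 1 := Real.cos_sq_le_one _
  have hv : (A * (1 + ρ * c)) ^ 3 ≤ ‖torusKnotVelocity a b ρ t‖ ^ 3 := by gcongr
  refine (div_le_div₀ ((sq_nonneg _).trans h4) h4 (by positivity) hv).trans ?_
  have e : (A ^ 4 * (1 + ρ * c) ^ 2 + 2 * A ^ 2 * b ^ 2 * (1 + ρ * c) * (ρ * c) +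
      ρ ^ 2 * (b ^ 4 + 4 * A ^ 2 * b ^ 2)) / (A * (1 + ρ * c)) ^ 3 =
      A * (1 / (1 + ρ * c)) + 2 * b ^ 2 / A * (ρ * c / (1 + ρ * c) ^ 2) +
        ρ ^ 2 * (b ^ 4 + 4 * A ^ 2 * b ^ 2) / (A * (1 + ρ * c)) ^ 3 := by
    field_simp
  rw [e]
  have b1 : 1 / (1 + ρ * c) ≤ 1 - ρ * c + 2 * ρ ^ 2 := by
    rw [div_le_iff₀ hx]
    nlinarith [mul_le_mul_of_nonneg_left hc1 (sq_nonneg ρ), mul_nonneg (sq_nonneg ρ) (sub_nonneg.2 h2)]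
  have b2 : ρ * c / (1 + ρ * c) ^ 2 ≤ ρ * c := by
    rw [div_le_iff₀ (by positivity)]
    nlinarith [mul_nonneg (sq_nonneg (ρ * c)) (by linarith : 0 ≤ 2 + ρ * c)]
  have b3 : ρ ^ 2 * (b ^ 4 + 4 * A ^ 2 * b ^ 2) / (A * (1 + ρ * c)) ^ 3 ≤
      ρ ^ 2 * (b ^ 4 + 4 * A ^ 2 * b ^ 2) :=
    div_le_self (by positivity) (one_le_pow₀ h1)
  have := mul_le_mul_of_nonneg_left b1 hA.le
  have := mul_le_mul_of_nonneg_left b2 (by positivity : 0 ≤ 2 * (b : ℝ) ^ 2 / A)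
  linarith

theorem integral_cos_int_mul {b : ℤ} (hb : b ≠ 0) :
    ∫ t in (0:ℝ)..2 * Real.pi, Real.cos (b * t) = 0 := by
  rw [intervalIntegral.integral_comp_mul_left _ (by exact_mod_cast hb), integral_cos]
  have h : Real.sin (b * (2 * Real.pi)) = 0 := by
    rw [← Real.sin_int_mul_pi (b * 2)]
    push_cast
    ring_nf
  rw [h]
  simp

theorem integral_le_of_le_cos {f : ℝ → ℝ} (hf : Continuous f) {b : ℤ} (hb : b ≠ 0) {p q : ℝ}
    (h : ∀ t, f t ≤ p + q * Real.cos (b * t)) :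
    ∫ t in (0:ℝ)..2 * Real.pi, f t ≤ 2 * Real.pi * p := by
  have hc : Continuous fun t : ℝ => q * Real.cos (b * t) := by fun_prop
  refine (intervalIntegral.integral_mono_on (by positivity) (hf.intervalIntegrable _ _)
    ((hc.const_add p).intervalIntegrable _ _) fun t _ => h t).trans_eq ?_
  rw [intervalIntegral.integral_add (intervalIntegrable_const) (hc.intervalIntegrable _ _),
    intervalIntegral.integral_const_mul, integral_cos_int_mul hb]
  simp

theorem exists_bending_torusKnot_le {a b : ℤ} (ha : 2 ≤ |(a : ℝ)|) (hb : b ≠ 0) :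
    ∃ C : ℝ, 0 ≤ C ∧ ∀ ρ : ℝ, 0 < ρ → ρ ≤ 1 / 2 →
      (∫ t in (0:ℝ)..2 * Real.pi, ‖torusKnotVelocity a b ρ t‖) ≤ C ∧
      (∫ t in (0:ℝ)..2 * Real.pi, ‖torusKnotVelocity a b ρ t‖) *
        (∫ t in (0:ℝ)..2 * Real.pi,
          ‖torusKnotAccel a b ρ t‖ ^ 2 / ‖torusKnotVelocity a b ρ t‖ ^ 3) ≤
      (2 * a * Real.pi) ^ 2 + C * ρ ^ 2 := by
  set A := |(a : ℝ)| with hA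
  set M := 2 * A + b ^ 4 + 4 * a ^ 2 * b ^ 2 with hM
  have hM0 : 0 ≤ M := by positivity
  set N := (b : ℝ) ^ 2 / 2 with hN
  have hN0 : 0 ≤ N := by positivity
  refine ⟨(2 * Real.pi) * (A + N) + (2 * Real.pi) ^ 2 * (A * M + N * A + N * M), by positivity,
    fun ρ hρ0 hρ => ?_⟩
  have hc : Continuous fun t => ‖torusKnotVelocity a b ρ t‖ :=
    (continuous_iff_continuousAt.2 fun t =>
      (hasDerivAt_torusKnotVelocity a b ρ t).continuousAt).norm
  have hc2 : Continuous fun t => ‖torusKnotAccel a b ρ t‖ ^ 2 / ‖torusKnotVelocity a b ρ t‖ ^ 3 :=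
    ((continuous_torusKnotAccel a b ρ).norm.pow 2).div (hc.pow 3) fun t =>
      (pow_pos (one_pos.trans_le (one_le_norm_torusKnotVelocity ha hρ0 hρ t)) 3).ne'
  have h1 := integral_le_of_le_cos hc hb (p := A + N * ρ ^ 2) (q := A * ρ) fun t => by
    have := norm_torusKnotVelocity_le ha hρ0 hρ (b := b) t
    rw [← hA, ← hN] at this
    linarith
  have h2 := integral_le_of_le_cos hc2 hb (p := A + M * ρ ^ 2)
    (q := (2 * b ^ 2 / A - A) * ρ) fun t => by
      have := norm_torusKnotAccel_div_le ha hρ0 hρ (b := b) t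
      rw [← hA, ← hM] at this
      linarith
  have h3 : ρ ^ 2 ≤ 1 := by nlinarith
  have hπ := Real.pi_pos
  have h4 : (0:ℝ) ≤ (2 * Real.pi) ^ 2 * (A * M + N * A + N * M) := by positivity
  constructor
  · have : N * ρ ^ 2 ≤ N := mul_le_of_le_one_right hN0 h3
    nlinarith [mul_le_mul_of_nonneg_left this (by positivity : 0 ≤ 2 * Real.pi)]
  · have hnn : 0 ≤ ∫ t in (0:ℝ)..2 * Real.pi,
        ‖torusKnotAccel a b ρ t‖ ^ 2 / ‖torusKnotVelocity a b ρ t‖ ^ 3 :=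
      intervalIntegral.integral_nonneg (by positivity) fun t _ => by positivity
    refine (mul_le_mul h1 h2 hnn (by positivity)).trans ?_
    have e : (2 * a * Real.pi) ^ 2 = (2 * Real.pi) ^ 2 * A ^ 2 := by rw [sq_abs]; ring
    rw [e]
    have h5 : N * M * (ρ ^ 2 * ρ ^ 2) ≤ N * M * (ρ ^ 2) := by
      gcongr
      exact mul_le_of_le_one_right (sq_nonneg _) h3
    have h6 : 0 ≤ (2 * Real.pi) * (A + N) * ρ ^ 2 := by positivity
    nlinarith [mul_le_mul_of_nonneg_left h5 (sq_nonneg (2 * Real.pi))]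

end ElasticKnot

namespace ElasticKnot
open Topology Set

theorem norm_zpow_sub_one_le {z : ℂ} (hz : ‖z‖ = 1) (m : ℤ) :
    ‖z ^ m - 1‖ ≤ |(m : ℝ)| * ‖z - 1‖ := by
  have hz0 : z ≠ 0 := norm_ne_zero_iff.1 (by rw [hz]; exact one_ne_zero)
  have hn : ∀ n : ℕ, ‖z ^ n - 1‖ ≤ n * ‖z - 1‖ := fun n => by
    induction n with
    | zero => simp
    | succ k ih =>
      rw [pow_succ, show z ^ k * z - 1 = z ^ k * (z - 1) + (z ^ k - 1) by ring]
      refine (norm_add_le _ _).trans ?_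
      rw [norm_mul, norm_pow, hz, one_pow, one_mul]
      push_cast
      linarith
  obtain ⟨n, rfl | rfl⟩ := m.eq_nat_or_neg
  · simpa using hn n
  · rw [zpow_neg, zpow_natCast, show (z ^ n)⁻¹ - 1 = -((z ^ n)⁻¹ * (z ^ n - 1)) by
      field_simp; ring, norm_neg, norm_mul, norm_inv, norm_pow, hz]
    simpa using hn n

theorem norm_sub_one_le_of_gcd {a b : ℤ} (hab : Int.gcd a b = 1) {z : ℂ} (hz : ‖z‖ = 1) :
    ‖z - 1‖ ≤ |(Int.gcdA a b : ℝ)| * ‖z ^ a - 1‖ + |(Int.gcdB a b : ℝ)| * ‖z ^ b - 1‖ := by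
  have hz0 : z ≠ 0 := norm_ne_zero_iff.1 (by rw [hz]; exact one_ne_zero)
  have h : z = (z ^ a) ^ Int.gcdA a b * (z ^ b) ^ Int.gcdB a b := by
    rw [← zpow_mul, ← zpow_mul, ← zpow_add₀ hz0, ← Int.gcd_eq_gcd_ab, hab]
    simp
  have h1 : ∀ n : ℤ, ‖z ^ n‖ = 1 := fun n => by rw [norm_zpow, hz, one_zpow]
  have h2 := norm_zpow_sub_one_le (h1 a) (Int.gcdA a b)
  have h3 := norm_zpow_sub_one_le (h1 b) (Int.gcdB a b)
  calc ‖z - 1‖ = ‖(z ^ a) ^ Int.gcdA a b * ((z ^ b) ^ Int.gcdB a b - 1) +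
        ((z ^ a) ^ Int.gcdA a b - 1)‖ := by
        congr 1
        nth_rewrite 1 [h]
        ring
    _ ≤ ‖(z ^ a) ^ Int.gcdA a b * ((z ^ b) ^ Int.gcdB a b - 1)‖ +
        ‖(z ^ a) ^ Int.gcdA a b - 1‖ := norm_add_le _ _
    _ ≤ _ := by
        rw [norm_mul, norm_zpow, h1 a, one_zpow, one_mul]
        linarith

theorem norm_exp_sub_exp (k : ℤ) (s t : ℝ) :
    ‖Complex.exp ((k * t : ℝ) * Complex.I) - Complex.exp ((k * s : ℝ) * Complex.I)‖ =
      ‖Complex.exp ((t - s : ℝ) * Complex.I) ^ k - 1‖ := by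
  have h : Complex.exp ((k * t : ℝ) * Complex.I) - Complex.exp ((k * s : ℝ) * Complex.I) =
      Complex.exp ((k * s : ℝ) * Complex.I) * (Complex.exp ((t - s : ℝ) * Complex.I) ^ k - 1) := by
    rw [← Complex.exp_int_mul, mul_sub, ← Complex.exp_add, mul_one]
    congr 2
    push_cast
    ring
  rw [h, norm_mul, Complex.norm_exp_ofReal_mul_I, one_mul]

theorem complexCoord_torusKnot_eq (a b : ℤ) (ρ t : ℝ) : complexCoord (torusKnot a b ρ t) =
    (((1 + ρ * Real.cos (b * t) : ℝ) : ℂ) * Complex.exp ((a * t : ℝ) * Complex.I),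
      ρ * Real.sin (b * t)) := by
  rw [complexCoord_apply]
  refine Prod.ext (Complex.ext ?_ ?_) (by simp [torusKnot])
  · rw [Complex.re_ofReal_mul, Complex.exp_ofReal_mul_I_re]
    simp [torusKnot]
  · rw [Complex.im_ofReal_mul, Complex.exp_ofReal_mul_I_im]
    simp [torusKnot]

theorem norm_sq_eq_complexCoord (x : E3) :
    ‖x‖ ^ 2 = ‖(complexCoord x).1‖ ^ 2 + (complexCoord x).2 ^ 2 := by
  rw [EuclideanSpace.norm_sq_eq, Fin.sum_univ_three, complexCoord_apply, Complex.sq_norm,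
    Complex.normSq_mk]
  simp only [Real.norm_eq_abs, sq_abs]
  ring

theorem complexCoord_sub (x y : E3) : complexCoord (x - y) = complexCoord x - complexCoord y := rfl

/-- Two points of the torus knot are close only if their parameters are. -/
theorem norm_exp_sub_one_le {a b : ℤ} (hab : Int.gcd a b = 1) {ρ : ℝ} (hρ0 : 0 < ρ)
    (hρ : ρ ≤ 1 / 2) (s t : ℝ) : ρ * ‖Complex.exp ((t - s : ℝ) * Complex.I) - 1‖ ≤
      2 * (|(Int.gcdA a b : ℝ)| + |(Int.gcdB a b : ℝ)|) *
        ‖torusKnot a b ρ t - torusKnot a b ρ s‖ := by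
  set d := ‖torusKnot a b ρ t - torusKnot a b ρ s‖ with hd
  have hsq := norm_sq_eq_complexCoord (torusKnot a b ρ t - torusKnot a b ρ s)
  rw [complexCoord_sub, complexCoord_torusKnot_eq, complexCoord_torusKnot_eq, ← hd, Prod.mk_sub_mk]
    at hsq
  simp only at hsq
  set et := Complex.exp ((a * t : ℝ) * Complex.I)
  set es := Complex.exp ((a * s : ℝ) * Complex.I)
  set xt := 1 + ρ * Real.cos (b * t) with hxt
  set xs := 1 + ρ * Real.cos (b * s) with hxs
  have het : ‖et‖ = 1 := Complex.norm_exp_ofReal_mul_I _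
  have hes : ‖es‖ = 1 := Complex.norm_exp_ofReal_mul_I _
  have hd0 : 0 ≤ d := norm_nonneg _
  have h1 : ‖(xt : ℂ) * et - xs * es‖ ≤ d :=
    le_of_sq_le_sq (by linarith [sq_nonneg (ρ * Real.sin (b * t) - ρ * Real.sin (b * s))]) hd0
  have h2 : |ρ * Real.sin (b * t) - ρ * Real.sin (b * s)| ≤ d :=
    le_of_sq_le_sq (by rw [sq_abs]; linarith [sq_nonneg ‖(xt : ℂ) * et - xs * es‖]) hd0
  have hx0 : ∀ y, 0 < 1 + ρ * Real.cos y := fun y => by linarith [half_le_one_add hρ0 hρ y]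
  have h3 : |xt - xs| ≤ d := by
    have h := abs_norm_sub_norm_le ((xt : ℂ) * et) (xs * es)
    rw [norm_mul, norm_mul, het, hes, mul_one, mul_one, Complex.norm_real, Complex.norm_real,
      Real.norm_of_nonneg (hx0 _).le, Real.norm_of_nonneg (hx0 _).le] at h
    exact h.trans h1
  have ha : ρ * ‖et - es‖ ≤ 2 * d := by
    have h : (xt : ℂ) * (et - es) = (xt * et - xs * es) - ((xt - xs : ℝ) : ℂ) * es := by
      push_cast; ring
    have h4 : xt * ‖et - es‖ ≤ 2 * d := by
      calc xt * ‖et - es‖ = ‖(xt : ℂ) * (et - es)‖ := by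
            rw [norm_mul, Complex.norm_real, Real.norm_of_nonneg (hx0 _).le]
        _ ≤ ‖(xt : ℂ) * et - xs * es‖ + ‖((xt - xs : ℝ) : ℂ) * es‖ := h ▸ norm_sub_le _ _
        _ ≤ d + d := by
            rw [norm_mul, hes, mul_one, Complex.norm_real]
            exact add_le_add h1 h3
        _ = 2 * d := by ring
    refine (mul_le_mul_of_nonneg_right ?_ (norm_nonneg _)).trans h4
    linarith [half_le_one_add hρ0 hρ (b * t)]
  have hb : ρ * ‖Complex.exp ((b * t : ℝ) * Complex.I) - Complex.exp ((b * s : ℝ) * Complex.I)‖ ≤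
      2 * d := by
    have h : (ρ : ℂ) * (Complex.exp ((b * t : ℝ) * Complex.I) -
        Complex.exp ((b * s : ℝ) * Complex.I)) = ((xt - xs : ℝ) : ℂ) +
          ((ρ * Real.sin (b * t) - ρ * Real.sin (b * s) : ℝ) : ℂ) * Complex.I := by
      rw [Complex.exp_mul_I, Complex.exp_mul_I, hxt, hxs]
      push_cast
      ring
    calc _ = ‖(ρ : ℂ) * (Complex.exp ((b * t : ℝ) * Complex.I) -
          Complex.exp ((b * s : ℝ) * Complex.I))‖ := by
          rw [norm_mul, Complex.norm_real, Real.norm_of_nonneg hρ0.le]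
      _ ≤ ‖((xt - xs : ℝ) : ℂ)‖ +
          ‖((ρ * Real.sin (b * t) - ρ * Real.sin (b * s) : ℝ) : ℂ) * Complex.I‖ :=
          h ▸ norm_add_le _ _
      _ ≤ d + d := by
          rw [norm_mul, Complex.norm_I, mul_one, Complex.norm_real, Complex.norm_real]
          exact add_le_add h3 h2
      _ = 2 * d := by ring
  have hg := norm_sub_one_le_of_gcd hab (Complex.norm_exp_ofReal_mul_I (t - s))
  rw [norm_exp_sub_exp] at ha hb
  calc _ ≤ ρ * (|(Int.gcdA a b : ℝ)| * ‖Complex.exp ((t - s : ℝ) * Complex.I) ^ a - 1‖ +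
        |(Int.gcdB a b : ℝ)| * ‖Complex.exp ((t - s : ℝ) * Complex.I) ^ b - 1‖) := by gcongr
    _ = |(Int.gcdA a b : ℝ)| * (ρ * ‖Complex.exp ((t - s : ℝ) * Complex.I) ^ a - 1‖) +
        |(Int.gcdB a b : ℝ)| * (ρ * ‖Complex.exp ((t - s : ℝ) * Complex.I) ^ b - 1‖) := by ring
    _ ≤ |(Int.gcdA a b : ℝ)| * (2 * d) + |(Int.gcdB a b : ℝ)| * (2 * d) := by gcongr
    _ = _ := by ring

theorem exists_int_abs_sub_le (δ : ℝ) : ∃ n : ℤ, |δ - n * (2 * Real.pi)| ≤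
    Real.pi / 2 * ‖Complex.exp (δ * Complex.I) - 1‖ := by
  have hπ := Real.pi_pos
  refine ⟨round (δ / (2 * Real.pi)), ?_⟩
  set n := round (δ / (2 * Real.pi))
  set ε := δ - n * (2 * Real.pi) with hε
  have h1 : |ε| ≤ Real.pi := by
    have h := abs_sub_round (δ / (2 * Real.pi))
    have e : ε = (δ / (2 * Real.pi) - n) * (2 * Real.pi) := by rw [hε]; field_simp
    rw [e, abs_mul, abs_of_pos (by positivity : 0 < 2 * Real.pi)]
    nlinarith
  have h2 : Complex.exp (δ * Complex.I) = Complex.exp (Complex.I * ε) := by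
    rw [Complex.exp_eq_exp_iff_exists_int]
    exact ⟨n, by rw [hε]; push_cast; ring⟩
  have h3 := Real.mul_abs_le_abs_sin (x := ε / 2) (by
    rw [abs_div, abs_two]; linarith)
  rw [h2, Complex.norm_exp_I_mul_ofReal_sub_one, norm_mul, Real.norm_eq_abs, Real.norm_eq_abs, abs_two]
  rw [abs_div, abs_two, div_mul_div_comm, div_le_iff₀ (by positivity)] at h3
  linarith

end ElasticKnot

namespace ElasticKnot
open Topology Set

theorem _root_.StrictConvexOn.false_of_three_eq {s : Set ℝ} {f : ℝ → ℝ} (hf : StrictConvexOn ℝ s f)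
    {p q r : ℝ} (hp : p ∈ s) (hq : q ∈ s) (hr : r ∈ s) (hpq : p ≠ q) (hqr : q ≠ r) (hrp : r ≠ p)
    (h1 : f p = f q) (h2 : f q = f r) : False := by
  have key : ∀ {x y z : ℝ}, x ∈ s → z ∈ s → x < y → y < z → f x = f y → f y = f z → False := by
    intro x y z hx hz hxy hyz h h'
    have h3 := hf.lt_on_openSegment hx hz (hxy.trans hyz).ne
      (by rw [openSegment_eq_Ioo (hxy.trans hyz)]; exact ⟨hxy, hyz⟩ : y ∈ openSegment ℝ x z)
    rw [h, h', max_self] at h3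
    exact lt_irrefl _ h3
  rcases lt_or_gt_of_ne hpq with a | a <;> rcases lt_or_gt_of_ne hqr with b | b <;>
    rcases lt_or_gt_of_ne hrp with c | c
  · exact key hp hr a b h1 h2
  · exact key hp hr a b h1 h2
  · exact key hr hq c a (h1.trans h2).symm h1
  · exact key hp hq c b (h1.trans h2) h2.symm
  · exact key hq hp b c h2 (h1.trans h2).symm
  · exact key hq hr a c h1.symm (h1.trans h2)
  · exact key hr hp b a h2.symm h1.symm
  · exact key hr hp b a h2.symm h1.symm

theorem strictConvexOn_dist_sq {τ τ' τ'' : ℝ → E3} (hτ : ∀ t, HasDerivAt τ (τ' t) t)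
    (hτ' : ∀ t, HasDerivAt τ' (τ'' t) t) {s : Set ℝ} (hs : Convex ℝ s) {c : E3}
    (h : ∀ t ∈ s, ‖τ'' t‖ * ‖τ t - c‖ < ‖τ' t‖ ^ 2) :
    StrictConvexOn ℝ s fun t => ‖τ t - c‖ ^ 2 := by
  have h1 : ∀ t, HasDerivAt (fun t => ‖τ t - c‖ ^ 2) (2 * inner ℝ (τ t - c) (τ' t)) t := fun t =>
    ((hτ t).sub_const c).norm_sq
  have h2 : ∀ t, HasDerivAt (fun t => 2 * inner ℝ (τ t - c) (τ' t))
      (2 * (inner ℝ (τ t - c) (τ'' t) + inner ℝ (τ' t) (τ' t))) t := fun t =>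
    (((hτ t).sub_const c).inner ℝ (hτ' t)).const_mul 2
  refine strictConvexOn_of_deriv2_pos' hs
    (continuous_iff_continuousAt.2 fun t => (h1 t).continuousAt).continuousOn fun t ht => ?_
  have e : deriv (fun t => ‖τ t - c‖ ^ 2) = fun t => 2 * inner ℝ (τ t - c) (τ' t) :=
    funext fun t => (h1 t).deriv
  rw [Function.iterate_succ_apply, Function.iterate_one, e, (h2 t).deriv,
    real_inner_self_eq_norm_sq]
  have := neg_le_of_abs_le (abs_real_inner_le_norm (τ t - c) (τ'' t))
  nlinarith [h t ht]

theorem norm_torusKnot_sub_le {a b : ℤ} {ρ : ℝ} (hρ0 : 0 < ρ) (hρ : ρ ≤ 1 / 2) (s t : ℝ) :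
    ‖torusKnot a b ρ t - torusKnot a b ρ s‖ ≤ (2 * |(a : ℝ)| + |(b : ℝ)|) * |t - s| :=
  convex_univ.norm_image_sub_le_of_norm_hasDerivWithin_le
    (fun t _ => (hasDerivAt_torusKnot a b ρ t).hasDerivWithinAt)
    (fun t _ => norm_torusKnotVelocity_le_const hρ0 hρ t) (mem_univ s) (mem_univ t)

/-- A sphere through three points of the torus knot is not small. -/
theorem exists_radius_torusKnot_ge {a b : ℤ} (ha : 2 ≤ |(a : ℝ)|) (hab : Int.gcd a b = 1) :
    ∃ κ : ℝ, 0 < κ ∧ ∀ ρ : ℝ, 0 < ρ → ρ ≤ 1 / 2 → ∀ (c : E3) (R t₁ t₂ t₃ : ℝ),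
      (∀ n : ℤ, t₁ ≠ t₂ + n * (2 * Real.pi)) → (∀ n : ℤ, t₂ ≠ t₃ + n * (2 * Real.pi)) →
      (∀ n : ℤ, t₃ ≠ t₁ + n * (2 * Real.pi)) → ‖torusKnot a b ρ t₁ - c‖ = R →
      ‖torusKnot a b ρ t₂ - c‖ = R → ‖torusKnot a b ρ t₃ - c‖ = R → κ * ρ ≤ R := by
  set V := 2 * |(a : ℝ)| + |(b : ℝ)| with hV
  set M := 2 * (a : ℝ) ^ 2 + 2 * (b : ℝ) ^ 2 with hM
  set K := 2 * (|(Int.gcdA a b : ℝ)| + |(Int.gcdB a b : ℝ)|) with hK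
  have hV0 : 0 ≤ V := by positivity
  have hM0 : 0 ≤ M := by positivity
  have hK0 : 0 ≤ K := by positivity
  have hπ := Real.pi_pos
  refine ⟨(M * (V * (Real.pi * K) + 1) + 1)⁻¹, by positivity, ?_⟩
  set κ := (M * (V * (Real.pi * K) + 1) + 1)⁻¹ with hκ
  have hκ0 : 0 < κ := by positivity
  have hκ1 : M * (V * (Real.pi * K) + 1) * κ < 1 := by
    rw [hκ, mul_inv_lt_iff₀ (by positivity)]
    linarith
  intro ρ hρ0 hρ c R t₁ t₂ t₃ h12 h23 h31 h1 h2 h3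
  by_contra! hR
  have hclose : ∀ t, ‖torusKnot a b ρ t - c‖ = R →
      ∃ n : ℤ, |t - n * (2 * Real.pi) - t₁| ≤ Real.pi * K * κ := fun t ht => by
    have hd : ‖torusKnot a b ρ t - torusKnot a b ρ t₁‖ ≤ 2 * R := by
      rw [← sub_sub_sub_cancel_right _ _ c]
      refine (norm_sub_le _ _).trans ?_
      rw [ht, h1]
      linarith
    have he := norm_exp_sub_one_le hab hρ0 hρ t₁ t
    obtain ⟨n, hn⟩ := exists_int_abs_sub_le (t - t₁)
    refine ⟨n, ?_⟩
    rw [show t - n * (2 * Real.pi) - t₁ = t - t₁ - n * (2 * Real.pi) by ring]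
    refine hn.trans ?_
    have h4 : ρ * ‖Complex.exp ((t - t₁ : ℝ) * Complex.I) - 1‖ ≤ ρ * (K * (2 * κ)) := by
      refine he.trans ((mul_le_mul_of_nonneg_left (hd.trans (by linarith : 2 * R ≤ 2 * (κ * ρ)))
        hK0).trans_eq (by ring))
    have h5 := le_of_mul_le_mul_left h4 hρ0
    calc _ ≤ Real.pi / 2 * (K * (2 * κ)) := by gcongr
      _ = _ := by ring
  obtain ⟨n₂, hn₂⟩ := hclose t₂ h2
  obtain ⟨n₃, hn₃⟩ := hclose t₃ h3
  have hper : ∀ (t : ℝ) (n : ℤ), torusKnot a b ρ (t - n * (2 * Real.pi)) = torusKnot a b ρ t :=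
    fun t n => (torusKnot_periodic a b ρ).sub_int_mul_eq n
  have hκρ : κ * ρ ≤ κ := mul_le_of_le_one_right hκ0.le (by linarith)
  have hconv := strictConvexOn_dist_sq (hasDerivAt_torusKnot a b ρ)
    (hasDerivAt_torusKnotVelocity a b ρ)
    (convex_closedBall t₁ (Real.pi * K * κ)) (c := c) fun t ht => by
      rw [Metric.mem_closedBall, Real.dist_eq] at ht
      have e1 : ‖torusKnot a b ρ t - c‖ ≤ V * (Real.pi * K * κ) + κ := by
        rw [← sub_add_sub_cancel _ (torusKnot a b ρ t₁)]
        refine (norm_add_le _ _).trans (add_le_add ?_ (by linarith))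
        exact (norm_torusKnot_sub_le hρ0 hρ t₁ t).trans (by gcongr)
      calc ‖torusKnotAccel a b ρ t‖ * ‖torusKnot a b ρ t - c‖
          ≤ M * (V * (Real.pi * K * κ) + κ) :=
            mul_le_mul (norm_torusKnotAccel_le_const hρ0 hρ t) e1 (norm_nonneg _) hM0
        _ = M * (V * (Real.pi * K) + 1) * κ := by ring
        _ < 1 := hκ1
        _ ≤ _ := one_le_pow₀ (one_le_norm_torusKnotVelocity ha hρ0 hρ t)
  refine hconv.false_of_three_eq (p := t₁) (q := t₂ - n₂ * (2 * Real.pi))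
    (r := t₃ - n₃ * (2 * Real.pi)) (Metric.mem_closedBall_self (by positivity)) ?_ ?_ ?_ ?_ ?_ ?_ ?_
  · rwa [Metric.mem_closedBall, Real.dist_eq]
  · rwa [Metric.mem_closedBall, Real.dist_eq]
  · intro h
    refine h12 (-n₂) ?_
    rw [h]; push_cast; ring
  · intro h
    refine h23 (n₂ - n₃) ?_
    push_cast; linarith
  · intro h
    refine h31 n₃ ?_
    rw [← h]; ring
  · simp only [hper, h1, h2]
  · simp only [hper, h3, h2]

end ElasticKnot

namespace ElasticKnot
open Topology Set

theorem ambientIsotopic_image_smul_sub (K : Set E3) (p : E3) {r : ℝ} (hr : 0 < r) :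
    AmbientIsotopic K ((fun x => r • (x - p)) '' K) := by
  have hpos : ∀ s : unitInterval, 0 < 1 - (s : ℝ) + s * r := fun s => by
    rcases s.2.2.lt_or_eq with h | h
    · have := mul_nonneg s.2.1 hr.le
      linarith
    · rw [h]; linarith
  refine ⟨fun s => (Homeomorph.subRight ((s : ℝ) • p)).trans
    (Homeomorph.smulOfNeZero (1 - (s : ℝ) + s * r) (hpos s).ne'), ?_, fun x => ?_, ?_⟩
  · change Continuous fun q : unitInterval × E3 =>
      (1 - (q.1 : ℝ) + q.1 * r) • (q.2 - (q.1 : ℝ) • p)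
    fun_prop
  · change (1 - ((0 : unitInterval) : ℝ) + ((0 : unitInterval) : ℝ) * r) •
      (x - ((0 : unitInterval) : ℝ) • p) = x
    simp
  · congr 1
    funext x
    change (1 - ((1 : unitInterval) : ℝ) + ((1 : unitInterval) : ℝ) * r) •
      (x - ((1 : unitInterval) : ℝ) • p) = r • (x - p)
    simp

theorem arcLength_eq_one {γ : UnitAddCircle → E3}
    (h : ∀ t : ℝ, ‖deriv (fun s : ℝ => γ (s : UnitAddCircle)) t‖ = 1) : arcLength γ = 1 := by
  have h' : ∀ t : ℝ, ‖deriv (fun s : ℝ => γ (s : UnitAddCircle)) t‖ₑ = 1 := fun t => by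
    rw [← ofReal_norm, h, ENNReal.ofReal_one]
  simp [arcLength, h']

/-- A small multiple of the torus knot on the torus with radii `1` and `ρ`, parametrized by
arclength, has small bending energy and large thickness. -/
theorem exists_unitLoop_torusKnotClass {a b : ℤ} (ha : a ∉ ({-1, 0, 1} : Set ℤ)) (hb : b ≠ 0)
    (hab : Int.gcd a b = 1) : ∃ C : ℝ, 0 ≤ C ∧ ∀ ρ : ℝ, 0 < ρ → ρ ≤ 1 / 2 →
      ∃ β ∈ unitLoops (torusKnotClass a b),
        bendingEnergy β ≤ ENNReal.ofReal ((2 * a * Real.pi) ^ 2 + C * ρ ^ 2) ∧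
        ropelength β ≤ ENNReal.ofReal (C / ρ) := by
  have ha' := two_le_abs ha
  obtain ⟨C, hC, hCb⟩ := exists_bending_torusKnot_le ha' hb
  obtain ⟨κ, hκ, hR⟩ := exists_radius_torusKnot_ge ha' hab
  refine ⟨C + C / κ, by positivity, fun ρ hρ0 hρ => ?_⟩
  obtain ⟨hLC, hE⟩ := hCb ρ hρ0 hρ
  obtain ⟨hL, σ, β, hσ1, hβ, hH, hβ0, hβu, hβE⟩ := exists_arclength_loop
    (by positivity : 0 < 2 * Real.pi) (hasDerivAt_torusKnot a b ρ)
    (hasDerivAt_torusKnotVelocity a b ρ) (continuous_torusKnotAccel a b ρ)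
    (torusKnot_periodic a b ρ) (one_le_norm_torusKnotVelocity ha' hρ0 hρ)
  set L := ∫ t in (0:ℝ)..2 * Real.pi, ‖torusKnotVelocity a b ρ t‖
  set τ := torusKnot a b ρ
  have hσn : ∀ (s : ℝ) (n : ℤ), σ (s + n) = σ s + n * (2 * Real.pi) := fun s n => by
    have hp : Function.Periodic (fun s => σ s - s * (2 * Real.pi)) 1 := fun s => by
      simp only [hσ1]; ring
    have := hp.int_mul n s
    simp only [mul_one] at this
    linarith
  have hσne : ∀ {s t : ℝ}, (s : UnitAddCircle) ≠ t → ∀ n : ℤ, σ s ≠ σ t + n * (2 * Real.pi) := by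
    intro s t hst n h
    rw [← hσn] at h
    refine hst ?_
    rw [σ.injective h, AddCircle.coe_add]
    have : ((n : ℝ) : UnitAddCircle) = 0 := (AddCircle.coe_eq_zero_iff 1).2 ⟨n, by simp⟩
    rw [this, add_zero]
  have hinj : Function.Injective β := by
    intro u v huv
    induction u using QuotientAddGroup.induction_on with | H s =>
    induction v using QuotientAddGroup.induction_on with | H t =>
    by_contra hst
    have h1 : τ (σ s) = τ (σ t) := by
      have h := (hβ s).symm.trans (huv.trans (hβ t))
      exact sub_left_injective (smul_right_injective E3 (inv_ne_zero hL.ne') h)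
    have h2 := norm_exp_sub_one_le hab hρ0 hρ (σ t) (σ s)
    rw [show torusKnot a b ρ (σ s) = torusKnot a b ρ (σ t) from h1, sub_self, norm_zero,
      mul_zero] at h2
    have h3 : ‖Complex.exp ((σ s - σ t : ℝ) * Complex.I) - 1‖ ≤ 0 :=
      le_of_mul_le_mul_left (h2.trans_eq (mul_zero ρ).symm) hρ0
    obtain ⟨n, hn⟩ := exists_int_abs_sub_le (σ s - σ t)
    have h4 : |σ s - σ t - n * (2 * Real.pi)| ≤ 0 :=
      hn.trans (mul_nonpos_of_nonneg_of_nonpos (by positivity) h3)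
    refine hσne hst n ?_
    linarith [abs_nonpos_iff.1 h4]
  have hrange : range β = (fun x => L⁻¹ • (x - τ 0)) '' range τ := by
    rw [← Function.Surjective.range_comp QuotientAddGroup.mk_surjective β, ← range_comp,
      ← σ.surjective.range_comp ((fun x => L⁻¹ • (x - τ 0)) ∘ τ)]
    congr 1
    funext s
    exact hβ s
  refine ⟨β, ⟨hH, hβ0, hβu, hinj, ρ, ⟨hρ0, by linarith⟩, ?_⟩, ?_, ?_⟩
  · rw [hrange]
    exact ambientIsotopic_image_smul_sub _ _ (inv_pos.2 hL)
  · refine hβE.trans (ENNReal.ofReal_le_ofReal (hE.trans ?_))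
    have : 0 ≤ C / κ * ρ ^ 2 := by positivity
    linarith
  · have hth : ENNReal.ofReal (κ * ρ / L) ≤ thickness β := by
      refine le_iInf fun u => le_iInf fun v => le_iInf fun w => le_iInf fun huvw => ?_
      refine le_iInf fun c => le_iInf fun hc => ?_
      induction u using QuotientAddGroup.induction_on with | H s₁ =>
      induction v using QuotientAddGroup.induction_on with | H s₂ =>
      induction w using QuotientAddGroup.induction_on with | H s₃ =>
      obtain ⟨-, h12, h23⟩ := hc
      have hd : ∀ s : ℝ, ‖τ (σ s) - (τ 0 + L • c)‖ = L * dist c (β s) := fun s => by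
        rw [dist_comm, dist_eq_norm, hβ, ← Real.norm_of_nonneg hL.le, ← norm_smul, smul_sub,
          Real.norm_of_nonneg hL.le, smul_inv_smul₀ hL.ne', sub_sub]
      rw [edist_dist]
      refine ENNReal.ofReal_le_ofReal ?_
      rw [div_le_iff₀ hL, mul_comm (dist _ _)]
      refine hR ρ hρ0 hρ (τ 0 + L • c) _ (σ s₁) (σ s₂) (σ s₃) (hσne huvw.1) (hσne huvw.2.1)
        (hσne huvw.2.2) (hd s₁) ?_ ?_
      · rw [hd]; exact congrArg _ h12.symm
      · rw [hd]; exact congrArg _ (h12.trans h23).symm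
    rw [ropelength, arcLength_eq_one hβu, one_div]
    refine (ENNReal.inv_le_inv.2 hth).trans ?_
    rw [← ENNReal.ofReal_inv_of_pos (by positivity)]
    refine ENNReal.ofReal_le_ofReal ?_
    rw [inv_div, ← div_div]
    gcongr
    exact (div_le_div_of_nonneg_right hLC hκ.le).trans (by linarith)

/-- Comparison with torus knots on thin tori. -/
theorem exists_totalEnergy_le {a b : ℤ} (ha : a ∉ ({-1, 0, 1} : Set ℤ)) (hb : b ≠ 0)
    (hab : Int.gcd a b = 1) : ∃ C : ℝ, 0 < C ∧ ∀ θ : ℝ, 0 < θ → θ ≤ 1 →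
      ∃ β ∈ unitLoops (torusKnotClass a b), totalEnergy θ β ≤
        ENNReal.ofReal ((2 * a * Real.pi) ^ 2 + C * θ ^ (2 / 3 : ℝ)) := by
  obtain ⟨C, hC, h⟩ := exists_unitLoop_torusKnotClass ha hb hab
  refine ⟨3 * C + 1, by positivity, fun θ hθ hθ1 => ?_⟩
  have hx0 : 0 < θ ^ (1 / 3 : ℝ) := Real.rpow_pos_of_pos hθ _
  have hx1 : θ ^ (1 / 3 : ℝ) ≤ 1 := Real.rpow_le_one hθ.le hθ1 (by norm_num)
  have hx2 : θ ^ (2 / 3 : ℝ) = (θ ^ (1 / 3 : ℝ)) ^ 2 := by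
    rw [← Real.rpow_natCast, ← Real.rpow_mul hθ.le]; norm_num
  have hx3 : θ = (θ ^ (1 / 3 : ℝ)) ^ 3 := by
    rw [← Real.rpow_natCast, ← Real.rpow_mul hθ.le]; norm_num
  obtain ⟨β, hβ, hE, hR⟩ := h (θ ^ (1 / 3 : ℝ) / 2) (by positivity) (by linarith)
  refine ⟨β, hβ, ?_⟩
  refine (add_le_add hE (mul_le_mul_right hR (ENNReal.ofReal θ))).trans ?_
  rw [← ENNReal.ofReal_mul hθ.le, ← ENNReal.ofReal_add (by positivity) (by positivity), hx2]
  refine ENNReal.ofReal_le_ofReal ?_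
  nth_rewrite 2 [hx3]
  set x := θ ^ (1 / 3 : ℝ)
  have e : x ^ 3 * (C / (x / 2)) = 2 * C * x ^ 2 := by field_simp
  rw [e]
  have : 0 ≤ C * x ^ 2 := by positivity
  nlinarith [sq_nonneg x]

end ElasticKnot

theorem mainTheorem11 (a b : ℤ) (ha : a ∉ ({-1, 0, 1} : Set ℤ)) (hb : b ∉ ({-1, 0, 1} : Set ℤ))
    (hab : Int.gcd a b = 1) :
    ∃ C : ℝ, 0 < C ∧
      ∀ θ : ℝ, 0 < θ → θ ≤ 1 →
        ∀ γ ∈ ElasticKnot.unitLoops (ElasticKnot.torusKnotClass a b),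
          IsMinOn (ElasticKnot.totalEnergy θ)
            (ElasticKnot.unitLoops (ElasticKnot.torusKnotClass a b)) γ →
          ElasticKnot.totalEnergy θ γ ≤
              ENNReal.ofReal ((2 * (a : ℝ) * Real.pi) ^ 2 + C * θ ^ (2 / 3 : ℝ)) ∧
            (a = 2 → ElasticKnot.ropelength γ ≤ ENNReal.ofReal (C * θ ^ (-(1 / 3) : ℝ))) := by
  simp only [Set.mem_insert_iff, Set.mem_singleton_iff, not_or] at hb
  obtain ⟨C, hC, h⟩ := ElasticKnot.exists_totalEnergy_le ha hb.2.1 hab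
  refine ⟨C, hC, fun θ hθ hθ1 γ hγ hmin => ?_⟩
  obtain ⟨β, hβ, hβE⟩ := h θ hθ hθ1
  have hE := (isMinOn_iff.1 hmin β hβ).trans hβE
  refine ⟨hE, ?_⟩
  rintro rfl
  have hodd : Odd b := by
    rw [← Int.not_even_iff_odd, even_iff_two_dvd]
    intro hdvd
    have h2 := Int.dvd_coe_gcd (dvd_refl 2) hdvd
    rw [hab] at h2
    norm_num at h2
  have hbend := ElasticKnot.le_bendingEnergy_of_mem_unitLoops hodd (by omega) hγ
  have hx : (0 : ℝ) < θ ^ (2 / 3 : ℝ) := Real.rpow_pos_of_pos hθ _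
  have he : (2 * ((2 : ℤ) : ℝ) * Real.pi) ^ 2 = (4 * Real.pi) ^ 2 := by
    push_cast; ring
  rw [he, ENNReal.ofReal_add (by positivity) (by positivity)] at hE
  have hR : ENNReal.ofReal θ * ElasticKnot.ropelength γ ≤ ENNReal.ofReal (C * θ ^ (2 / 3 : ℝ)) :=
    (ENNReal.add_le_add_iff_left ENNReal.ofReal_ne_top).1
      ((add_le_add_left hbend (ENNReal.ofReal θ * ElasticKnot.ropelength γ)).trans hE)
  have hθ' : C * θ ^ (-(1 / 3) : ℝ) = C * θ ^ (2 / 3 : ℝ) / θ := by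
    rw [mul_div_assoc, ← Real.rpow_sub_one hθ.ne']
    norm_num
  rw [hθ', ENNReal.ofReal_div_of_pos hθ, ENNReal.le_div_iff_mul_le (.inl (by simpa using hθ))
    (.inl ENNReal.ofReal_ne_top), mul_comm]
  exact hR
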